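/- **Notation and assumptions.** Let $f_1:\mathbb R\to(0,\infty)$ be a probability density and let $\phi_{f_1}:=-\dot f_1/f_1$. Say that $f_1$ belongs to the class $\mathcal F_1$ if 1. $f_1(-z)=f_1(z)$ for all $z$, and $\int_{-\infty}^1 f_1(z)\,dz=3/4$; 2. $f_1$ is absolutely continuous: $f_1(z_2)-f_1(z_1)=\int_{z_1}^{z_2}\dot f_1(z)\,dz$ for all $z_1<z_2$, with $\dot f_1$ locally integrable; 3. $\dot f_1$ can be, and is, chosen such that $\phi_{f_1}$ is nondecreasing on $\mathbb R$ (that is, $f_1$ is log-concave); 4. $\mathcal K(f_1):=\int z^4\phi_{f_1}^2(z)f_1(z)\,dz<\infty$ (then also $\mathcal I(f_1):=\int \phi_{f_1}^2f_1<\infty$ and $\mathcal J(f_1):=\int z^2\phi_{f_1}^2(z)f_1(z)\,dz<\infty$); 5. for some $\beta>0$, $\int_y^\infty f_1(z)\,dz=O(y^{-\beta})$ as $y\to\infty$ and $\phi_{f_1}(z)=o(z^{\beta/2-2})$ as $z\to\infty$. Put $\kappa(f_1):=\mathcal J(f_1)/\mathcal I(f_1)$ and $\gamma(f_1):=\mathcal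 K(f_1)-\mathcal J^2(f_1)/\mathcal I(f_1)$. For $\theta\in\mathbb R$, $\sigma>0$ and $\xi\in\mathbb R$ with $|\xi|$ small, let $P^{(n)}_{\theta,\sigma,\xi;f_1}$ be the law of $n$ i.i.d. real variables $X_1,\dots,X_n$ with density $$\sigma^{-1}f_1(z)-\xi\sigma^{-1}\dot f_1(z)\bigl(z^2-\kappa(f_1)\bigr)I\bigl[|z|\le|z^*|\bigr]+\operatorname{sign}(\xi)\,\sigma^{-1}f_1(z)\bigl\{I[z>|z^*|]-I[z<-|z^*|]\bigr\},\qquad z:=\frac{x-\theta}{\sigma},$$ where, for $\xi\ne0$, $z^*=z^*(\xi)$ is the unique solution of $f_1(z^*)=\xi\dot f_1(z^*)\bigl((z^*)^2-\kappa(f_1)\bigr)$. If this equation has no solution because $\phi_{f_1}$ jumps where the two sides cross, $|z^*|$ is the crossing point $\inf\{y\ge\sqrt{\kappa(f_1)}: f_1(y)\le|\xi|\,|\dot f_1(y)|\,(y^2-\kappa(f_1))\}$. For $\xi=0$ the density is $\sigma^{-1}f_1(z)$. **Proposition (ULAN).** Let $f_1\in\mathcal F_1$, $\theta\in\mathbb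 R$ and $\sigma>0$. The family $\{P^{(n)}_{\theta,\sigma,\xi;f_1}\}$ is uniformly locally asymptotically normal at $\boldsymbol\vartheta=(\theta,\sigma,0)'$, with central sequence (writing $Z_i=\sigma^{-1}(X_i-\theta)$) $$\boldsymbol\Delta^{(n)}_{f_1}(\boldsymbol\vartheta)=n^{-1/2}\sum_{i=1}^n\begin{pmatrix}\sigma^{-1}\phi_{f_1}(Z_i)\\ \sigma^{-1}\bigl(\phi_{f_1}(Z_i)Z_i-1\bigr)\\ \phi_{f_1}(Z_i)\bigl(Z_i^2-\kappa(f_1)\bigr)\end{pmatrix}$$ and full-rank (positive definite) information matrix $$\boldsymbol\Gamma_{f_1}(\boldsymbol\vartheta)=\operatorname{diag}\bigl(\sigma^{-2}\mathcal I(f_1),\ \sigma^{-2}(\mathcal J(f_1)-1),\ \gamma(f_1)\bigr).$$ That is, for every $\boldsymbol\vartheta^{(n)}=(\theta^{(n)},\sigma^{(n)},0)'$ with $\sigma^{(n)}>0$, $\theta^{(n)}-\theta=O(n^{-1/2})$ and $\sigma^{(n)}-\sigma=O(n^{-1/2})$, and every bounded sequence $\boldsymbol\tau^{(n)}\in\mathbb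 R^3$, under $P^{(n)}_{\boldsymbol\vartheta^{(n)};f_1}$, as $n\to\infty$, $$\log\frac{dP^{(n)}_{\boldsymbol\vartheta^{(n)}+n^{-1/2}\boldsymbol\tau^{(n)};f_1}}{dP^{(n)}_{\boldsymbol\vartheta^{(n)};f_1}}=\boldsymbol\tau^{(n)\prime}\boldsymbol\Delta^{(n)}_{f_1}(\boldsymbol\vartheta^{(n)})-\tfrac12\boldsymbol\tau^{(n)\prime}\boldsymbol\Gamma_{f_1}(\boldsymbol\vartheta)\boldsymbol\tau^{(n)}+o_P(1)$$ and $$\boldsymbol\Delta^{(n)}_{f_1}(\boldsymbol\vartheta^{(n)})\xrightarrow{\ \mathcal L\ }\mathcal N\bigl(\mathbf 0,\boldsymbol\Gamma_{f_1}(\boldsymbol\vartheta)\bigr).$$ -/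

import Mathlib

open MeasureTheory ProbabilityTheory Filter Topology Asymptotics
open scoped Matrix ENNReal

noncomputable section

namespace EdgeworthFamily

/-- The score function `φ_{f₁} = -f₁' / f₁`. -/
def score (f f' : ℝ → ℝ) (z : ℝ) : ℝ := -f' z / f z

/-- `𝓘(f₁) = ∫ φ² f₁`. -/
def infoLoc (f f' : ℝ → ℝ) : ℝ := ∫ z, score f f' z ^ 2 * f z

/-- `𝓙(f₁) = ∫ z² φ² f₁`. -/
def infoScale (f f' : ℝ → ℝ) : ℝ := ∫ z, z ^ 2 * score f f' z ^ 2 * f z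

/-- `𝓚(f₁) = ∫ z⁴ φ² f₁`. -/
def infoSkew (f f' : ℝ → ℝ) : ℝ := ∫ z, z ^ 4 * score f f' z ^ 2 * f z

/-- The generalized kurtosis coefficient `κ(f₁) = 𝓙(f₁) / 𝓘(f₁)`. -/
def kappa (f f' : ℝ → ℝ) : ℝ := infoScale f f' / infoLoc f f'

/-- The class `𝓕₁`: `f` is a (positive) probability density on the line and `f'` is a version of its
almost everywhere derivative for which the score `-f' / f` is monotone. -/
structure MemF1 (f f' : ℝ → ℝ) : Prop where
  pos : ∀ z, 0 < f z
  integral_eq_one : ∫ z, f z = 1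
  -- (i) symmetry, and standardization: the median of the absolute value is one
  symm : ∀ z, f (-z) = f z
  standardized : ∫ z in Set.Iic (1 : ℝ), f z = 3 / 4
  -- (ii) absolute continuity
  intervalIntegrable : ∀ a b : ℝ, IntervalIntegrable f' volume a b
  sub_eq_integral : ∀ a b : ℝ, a < b → f b - f a = ∫ z in a..b, f' z
  -- (iii) strong unimodality
  monotone_score : Monotone (score f f')
  -- (iv) finiteness of `𝓚(f₁)`
  integrable_infoSkew : Integrable (fun z => z ^ 4 * score f f' z ^ 2 * f z)
  -- (v) polynomial tails, with the same `β` in both conditions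
  tails : ∃ β : ℝ, 0 < β ∧
    ((fun y : ℝ => ∫ z in Set.Ioi y, f z) =O[atTop] fun y : ℝ => y ^ (-β)) ∧
    (score f f' =o[atTop] fun z : ℝ => z ^ (β / 2 - 2))

open Classical in
/-- The truncation point `z*` of the family: the unique solution of
`f₁(z) = ξ f₁'(z) (z² - κ(f₁))`. The score may have jumps, in which case the equation may have
no solution because its two sides cross at a jump. The point where they cross, which is the
generalized inverse in the second branch, then plays the role of `|z*|` (only `|z*|` enters the
density). -/
def zStar (f f' : ℝ → ℝ) (ξ : ℝ) : ℝ :=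
  if h : ∃! z : ℝ, f z = ξ * f' z * (z ^ 2 - kappa f f') then h.choose
  else sInf {y : ℝ | √(kappa f f') ≤ y ∧ f y ≤ |ξ| * |f' y| * (y ^ 2 - kappa f f')}

/-- The density at `x` of one observation, with location `θ`, scale `σ` and skewness `ξ`. For
`ξ > 0` it vanishes to the left of `θ - σ|z*|` and is `2σ⁻¹ f₁((x - θ)/σ)` to the right of
`θ + σ|z*|`, and the other way round for `ξ < 0`. -/
def density (f f' : ℝ → ℝ) (θ σ ξ x : ℝ) : ℝ :=
  σ⁻¹ * f ((x - θ) / σ)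
    - ξ * σ⁻¹ * f' ((x - θ) / σ) * (((x - θ) / σ) ^ 2 - kappa f f')
        * (if |x - θ| ≤ σ * |zStar f f' ξ| then 1 else 0)
    + Real.sign ξ * σ⁻¹ * f ((x - θ) / σ)
        * ((if σ * |zStar f f' ξ| < x - θ then 1 else 0)
            - (if x - θ < -(σ * |zStar f f' ξ|) then 1 else 0))

/-- `P^{(n)}_{θ,σ,ξ;f₁}`: the law of `n` independent observations with the above density. -/
def law (f f' : ℝ → ℝ) (n : ℕ) (θ σ ξ : ℝ) : Measure (Fin n → ℝ) :=
  Measure.pi fun _ => volume.withDensity fun x => ENNReal.ofReal (density f f' θ σ ξ x)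

/-- The log-likelihood ratio `log (dμ/dν)`, with value `-∞` where `dμ/dν = 0`. -/
def logLR {Ω : Type*} [MeasurableSpace Ω] (μ ν : Measure Ω) (x : Ω) : EReal :=
  ENNReal.log (μ.rnDeriv ν x)

/-- The central sequence `Δ^{(n)}_{f₁}(θ, σ, 0)`, as a function of the sample `x`. -/
def centralSeq (f f' : ℝ → ℝ) (n : ℕ) (θ σ : ℝ) (x : Fin n → ℝ) : EuclideanSpace ℝ (Fin 3) :=
  let Z : Fin n → ℝ := fun i => (x i - θ) / σ
  !₂[(√(n : ℝ))⁻¹ * ∑ i, σ⁻¹ * score f f' (Z i),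
     (√(n : ℝ))⁻¹ * ∑ i, σ⁻¹ * (score f f' (Z i) * Z i - 1),
     (√(n : ℝ))⁻¹ * ∑ i, score f f' (Z i) * (Z i ^ 2 - kappa f f')]

/-- The information matrix `Γ_{f₁}(θ, σ, 0)`; it does not depend on `θ`. -/
def infoMatrix (f f' : ℝ → ℝ) (σ : ℝ) : Matrix (Fin 3) (Fin 3) ℝ :=
  Matrix.diagonal ![(σ ^ 2)⁻¹ * infoLoc f f',
    (σ ^ 2)⁻¹ * (infoScale f f' - 1),
    infoSkew f f' - infoScale f f' ^ 2 / infoLoc f f']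

end EdgeworthFamily

end

/-! The proof rests on Le Cam's principle that differentiability in quadratic mean gives a quadratic
expansion of the log-likelihood ratio (`log_likelihood_expansion`). Uniformity in the null sequence
comes from equivariance: a null sample with parameters `θn`, `σn` is an affine image of a sample
from `f` (`MemF1.law_null`). After rescaling the local parameters by `scoreScale`, every statement
therefore concerns alternatives near the single point `(0, 1, 0)`, and one infinite product space
carries all sample sizes.

Differentiability at `(0, 1, 0)` has two independent sources. The location-scale group acts
isometrically and strongly continuously on `L²`. The derivative of the transported `√f` along a
segment is the transported score function, so an average over the segment gives the linear
approximation (`MemF1.eventually_eLpNorm_locScale_sqrt_le`). In the skewness direction the root of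
`1 + ξ a`, with `a` the third score, is expanded up to the truncation point. Beyond that point the
density is `0` or `2f`, so the error has the order of the tail mass of `f`. That mass is `o(ξ²)`
because the truncation point can be reached only where `|ξ| φ(z) z²` is at least of order one, while
`φ(z) = o(z^(β/2-2))` and the tail is `O(z^(-β))` (`MemF1.eventually_setIntegral_tail_le`). Since
the group acts by isometries, the two approximations combine
(`MemF1.eventually_eLpNorm_rootDensity_sub_le`).

The density formula integrates to one by oddness, but its positivity is not guaranteed. Its negative
part is also `o(ξ²)` in mean, so the total mass is one up to an error negligible at the `n⁻¹` scale.
The scores are centered and uncorrelated by parity, by `∫ z φ f = 1` and by the choice of `κ`. The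
multivariate central limit theorem, with a Slutsky correction for `σn`, then gives the limit law of
the central sequence. -/

namespace EdgeworthFamily

/-! ### Regularity of the density, oddness of the score, and integrals against the density. -/

namespace MemF1

variable {f f' : ℝ → ℝ}

lemma deriv_eq (hf : MemF1 f f') (z : ℝ) : f' z = -score f f' z * f z := by
  have := (hf.pos z).ne'
  simp only [score]; field_simp

lemma integrable (hf : MemF1 f f') : Integrable f := by
  by_contra h
  have := hf.integral_eq_one
  rw [integral_undef h] at this
  exact zero_ne_one this

lemma sub_eq_integral' (hf : MemF1 f f') (a b : ℝ) : f b - f a = ∫ z in a..b, f' z := by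
  rcases lt_trichotomy a b with h | h | h
  · exact hf.sub_eq_integral a b h
  · simp [h]
  · rw [intervalIntegral.integral_symm, ← hf.sub_eq_integral b a h]; ring

lemma continuous (hf : MemF1 f f') : Continuous f := by
  have h : f = fun b => f 0 + ∫ z in (0 : ℝ)..b, f' z := by
    funext b
    rw [← hf.sub_eq_integral']; ring
  rw [h]
  exact continuous_const.add (intervalIntegral.continuous_primitive hf.intervalIntegrable 0)

lemma measurable_score (hf : MemF1 f f') : Measurable (score f f') :=
  hf.monotone_score.measurable

lemma measurable_deriv (hf : MemF1 f f') : Measurable f' := by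
  have h : f' = fun z => -score f f' z * f z := funext hf.deriv_eq
  rw [h]
  exact hf.measurable_score.neg.mul hf.continuous.measurable

end MemF1

/-- The discontinuity points of the score. -/
def jumpSet (f f' : ℝ → ℝ) : Set ℝ := {x | ¬ContinuousAt (score f f') x}

namespace MemF1

variable {f f' : ℝ → ℝ}

lemma countable_jumpSet (hf : MemF1 f f') : (jumpSet f f').Countable :=
  hf.monotone_score.countable_not_continuousAt

/-- Since `f' = -φ f`, the version `f'` is continuous wherever `φ` is, and the fundamental theorem
of calculus applies there. Thus `f` is differentiable off a countable set. -/
lemma hasDerivAt (hf : MemF1 f f') {x : ℝ} (hx : x ∉ jumpSet f f') : HasDerivAt f (f' x) x := by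
  have hc : ContinuousAt (score f f') x := not_not.1 hx
  have h : f = fun b => f 0 + ∫ z in (0 : ℝ)..b, f' z := by
    funext b
    rw [← hf.sub_eq_integral']; ring
  have hc' : ContinuousAt f' x := by
    have h : f' = fun z => -score f f' z * f z := funext hf.deriv_eq
    rw [h]
    exact hc.neg.mul hf.continuous.continuousAt
  have := intervalIntegral.integral_hasDerivAt_right (hf.intervalIntegrable 0 x)
    hf.measurable_deriv.stronglyMeasurable.stronglyMeasurableAtFilter hc'
  rw [h]
  exact this.const_add _

/-- Evenness of `f` makes its derivative odd where it exists. At a jump the chosen version of `f'`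
is constrained only by monotonicity of the score, so such points are excluded. -/
lemma score_neg (hf : MemF1 f f') {x : ℝ} (hx : x ∉ jumpSet f f') (hx' : -x ∉ jumpSet f f') :
    score f f' (-x) = -score f f' x := by
  have h1 : HasDerivAt f (f' (-x) * (-1)) x := by
    have h := (hf.hasDerivAt hx').comp x (hasDerivAt_neg x)
    have he : f ∘ Neg.neg = f := funext fun y => hf.symm y
    rwa [he] at h
  have h2 := h1.unique (hf.hasDerivAt hx)
  simp only [score, hf.symm]
  rw [← h2]; ring

lemma countable_symm_jumpSet (hf : MemF1 f f') :
    (jumpSet f f' ∪ Neg.neg ⁻¹' jumpSet f f').Countable :=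
  hf.countable_jumpSet.union (hf.countable_jumpSet.preimage neg_injective)

lemma ae_score_neg (hf : MemF1 f f') : ∀ᵐ x, score f f' (-x) = -score f f' x := by
  filter_upwards [hf.countable_symm_jumpSet.ae_notMem volume] with x hx
  simp only [Set.mem_union, Set.mem_preimage, not_or] at hx
  exact hf.score_neg hx.1 hx.2

/-- The exceptional set is countable, so points of exact oddness are dense. Combined with
monotonicity they give inequalities valid at every point, jumps included. -/
lemma exists_between_score_neg (hf : MemF1 f f') {a b : ℝ} (hab : a < b) :
    ∃ c ∈ Set.Ioo a b, score f f' (-c) = -score f f' c := by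
  have h := (hf.countable_symm_jumpSet).dense_compl ℝ
  obtain ⟨c, hc, hc'⟩ := h.exists_between hab
  simp only [Set.mem_compl_iff, Set.mem_union, Set.mem_preimage, not_or] at hc
  exact ⟨c, hc', hf.score_neg hc.1 hc.2⟩

lemma neg_score_neg_le (hf : MemF1 f f') {a b : ℝ} (hab : a < b) :
    -score f f' (-a) ≤ score f f' b := by
  obtain ⟨c, hc, h⟩ := hf.exists_between_score_neg hab
  have h1 := hf.monotone_score hc.2.le
  have h2 := hf.monotone_score (neg_le_neg hc.1.le)
  linarith

lemma score_nonneg (hf : MemF1 f f') {z : ℝ} (hz : 0 < z) : 0 ≤ score f f' z := by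
  obtain ⟨c, hc, h⟩ := hf.exists_between_score_neg hz
  have h1 := hf.monotone_score hc.2.le
  have h2 := hf.monotone_score (show -c ≤ c by linarith [hc.1])
  linarith

/-- If the score vanished on the positive half-line, `f` would be a positive constant there, which
is not integrable. -/
lemma exists_score_pos (hf : MemF1 f f') : ∃ z, 0 < z ∧ 0 < score f f' z := by
  by_contra! h
  have h0 : ∀ z, 0 < z → f' z = 0 := fun z hz => by
    rw [hf.deriv_eq, le_antisymm (h z hz) (hf.score_nonneg hz)]; simp
  have hc : ∀ b, 0 < b → f b = f 0 := fun b hb => by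
    have h1 := hf.sub_eq_integral 0 b hb
    rw [intervalIntegral.integral_congr_ae (g := fun _ => 0)] at h1
    · simp at h1; linarith
    · exact ae_of_all _ fun x hx => h0 x (by rw [Set.uIoc_of_le hb.le] at hx; exact hx.1)
  have hi : IntegrableOn (fun _ : ℝ => f 0) (Set.Ioi 0) :=
    hf.integrable.integrableOn.congr_fun (fun x hx => hc x hx) measurableSet_Ioi
  rw [integrableOn_const_iff (hC := by simp)] at hi
  simp [(hf.pos 0).ne'] at hi

/-- A bound for the score on the unit ball, by monotonicity. -/
lemma abs_score_le (hf : MemF1 f f') {R z : ℝ} (hz : |z| ≤ R) :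
    |score f f' z| ≤ max |score f f' R| |score f f' (-R)| := by
  have h1 := hf.monotone_score (abs_le.1 hz).1
  have h2 := hf.monotone_score (abs_le.1 hz).2
  rcases le_total 0 (score f f' z) with h | h
  · rw [abs_of_nonneg h]; exact (h2.trans (le_abs_self _)).trans (le_max_left _ _)
  · rw [abs_of_nonpos h]
    exact ((neg_le_neg h1).trans (neg_le_abs _)).trans (le_max_right _ _)

/-- All weighted Fisher informations of order at most four are finite. -/
lemma integrable_of_le (hf : MemF1 f f') {p : ℝ → ℝ} (hp : Measurable p) {C : ℝ}
    (hC : ∀ z, |p z| ≤ C * (1 + (1 + z ^ 4) * score f f' z ^ 2)) :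
    Integrable (fun z => p z * f z) := by
  have hm := hf.measurable_score
  set M := max |score f f' 1| |score f f' (-1)|
  have hM : 0 ≤ M := (abs_nonneg _).trans (le_max_left _ _)
  have hC0 : 0 ≤ C := by
    have h := (abs_nonneg _).trans (hC 0)
    by_contra hneg
    push Not at hneg
    nlinarith [sq_nonneg (score f f' 0)]
  have hb : Integrable (fun z => C * ((1 + M ^ 2) * f z + 2 * (z ^ 4 * score f f' z ^ 2 * f z))) :=
    ((hf.integrable.const_mul _).add (hf.integrable_infoSkew.const_mul 2)).const_mul C
  refine hb.mono' (hp.mul hf.continuous.measurable).aestronglyMeasurable (ae_of_all _ fun z => ?_)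
  rw [Real.norm_eq_abs, abs_mul, abs_of_pos (hf.pos z)]
  -- Inside the unit ball the monotone score is bounded by `M`; outside, the weight `z ^ 4` is at
  -- least one.
  have h1 : score f f' z ^ 2 ≤ M ^ 2 + z ^ 4 * score f f' z ^ 2 := by
    rcases le_total |z| 1 with h | h
    · have h2 := hf.abs_score_le h
      have h3 : score f f' z ^ 2 ≤ M ^ 2 := by
        rw [← sq_abs]; exact pow_le_pow_left₀ (abs_nonneg _) h2 2
      nlinarith [sq_nonneg (z ^ 2 * score f f' z)]
    · have h2 : 1 ≤ z ^ 4 := by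
        have := one_le_pow₀ h (n := 4)
        rwa [Even.pow_abs (by decide)] at this
      nlinarith [sq_nonneg (score f f' z), sq_nonneg M]
  have h2 : |p z| ≤ C * (1 + M ^ 2 + 2 * (z ^ 4 * score f f' z ^ 2)) :=
    (hC z).trans (mul_le_mul_of_nonneg_left (by nlinarith) hC0)
  calc |p z| * f z ≤ C * (1 + M ^ 2 + 2 * (z ^ 4 * score f f' z ^ 2)) * f z :=
        mul_le_mul_of_nonneg_right h2 (hf.pos z).le
    _ = _ := by ring

lemma integrable_infoLoc (hf : MemF1 f f') : Integrable (fun z => score f f' z ^ 2 * f z) :=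
  hf.integrable_of_le (C := 1) (hf.measurable_score.pow_const 2) fun z => by
    rw [abs_of_nonneg (sq_nonneg _)]
    have : 0 ≤ z ^ 4 * score f f' z ^ 2 := by positivity
    nlinarith

lemma integrable_infoScale (hf : MemF1 f f') :
    Integrable (fun z => z ^ 2 * score f f' z ^ 2 * f z) :=
  hf.integrable_of_le (C := 1) (by have := hf.measurable_score; fun_prop) fun z => by
    rw [abs_of_nonneg (by positivity)]
    have : z ^ 2 ≤ 1 + z ^ 4 := by nlinarith [sq_nonneg (z ^ 2 - 1)]
    nlinarith [sq_nonneg (score f f' z)]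

lemma integrable_mul_score (hf : MemF1 f f') :
    Integrable (fun z => z * score f f' z * f z) :=
  hf.integrable_of_le (C := 1) (by have := hf.measurable_score; fun_prop) fun z => by
    have h1 : |z * score f f' z| ≤ 1 + (z * score f f' z) ^ 2 := by
      rw [abs_le]; constructor <;> nlinarith [sq_nonneg (z * score f f' z - 1),
        sq_nonneg (z * score f f' z + 1)]
    have : z ^ 2 ≤ 1 + z ^ 4 := by nlinarith [sq_nonneg (z ^ 2 - 1)]
    have h2 : z ^ 2 * score f f' z ^ 2 ≤ (1 + z ^ 4) * score f f' z ^ 2 :=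
      mul_le_mul_of_nonneg_right this (sq_nonneg _)
    rw [mul_pow] at h1
    linarith

/-- The integrand `f - z φ f` is the derivative of `z f`, so its integral over `[-x, x]` is `2 x f
x`. It remains to see that the limit of this boundary term is zero. -/
lemma integral_mul_score (hf : MemF1 f f') : ∫ z, z * score f f' z * f z = 1 := by
  have hint : ∀ x : ℝ, ∫ z in (-x)..x, (f z - z * score f f' z * f z) = 2 * x * f x := by
    intro x
    rw [integral_eq_of_hasDerivAt_off_countable (fun z => z * f z)
      (fun z => f z - z * score f f' z * f z) hf.countable_jumpSet
      (continuous_id.mul hf.continuous).continuousOn]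
    · rw [hf.symm]; ring
    · intro z hz
      have h := (hasDerivAt_id' z).fun_mul (hf.hasDerivAt hz.2)
      rw [hf.deriv_eq] at h
      exact h.congr_deriv (by ring)
    · exact (hf.integrable.sub hf.integrable_mul_score).intervalIntegrable
  have hlim := intervalIntegral_tendsto_integral (hf.integrable.sub hf.integrable_mul_score)
    tendsto_neg_atTop_atBot tendsto_id
  simp only [Pi.sub_apply, id, hint] at hlim
  rw [integral_sub hf.integrable hf.integrable_mul_score, hf.integral_eq_one] at hlim
  set L := 1 - ∫ z, z * score f f' z * f z with hL
  have hL0 : 0 ≤ L := ge_of_tendsto hlim (by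
    filter_upwards [eventually_ge_atTop 0] with x hx
    have := (hf.pos x).le
    positivity)
  suffices L = 0 by linarith
  by_contra hne
  have hLpos : 0 < L := lt_of_le_of_ne hL0 (Ne.symm hne)
  have hev := hlim.eventually (lt_mem_nhds (half_lt_self hLpos))
  obtain ⟨A, hA⟩ := (hev.and (eventually_ge_atTop 1)).exists_forall_of_atTop
  -- A positive limit `L` would give `2 x f x > L / 2` eventually, so that `x⁻¹ ≤ (4 / L) f x` would
  -- be integrable at infinity.
  refine not_integrableOn_Ioi_inv (a := A) ?_
  refine ((hf.integrable.const_mul (4 / L)).integrableOn (s := Set.Ioi A)).mono'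
    measurable_inv.aestronglyMeasurable ?_
  refine (ae_restrict_iff' measurableSet_Ioi).2 (ae_of_all _ fun x hx => ?_)
  obtain ⟨h1, h2⟩ := hA x (le_of_lt hx)
  have hx0 : 0 < x := by linarith
  rw [Real.norm_eq_abs, abs_of_pos (inv_pos.2 hx0), inv_eq_one_div, div_mul_eq_mul_div,
    div_le_div_iff₀ hx0 hLpos]
  linarith

/-- An integral against `f` of an almost everywhere odd function vanishes. -/
lemma integral_odd (hf : MemF1 f f') {p : ℝ → ℝ} (hp : ∀ᵐ z, p (-z) = -p z) :
    ∫ z, p z * f z = 0 := by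
  have h := integral_neg_eq_self (fun z => p z * f z) volume
  have h2 : ∫ z, p (-z) * f (-z) = ∫ z, -(p z * f z) :=
    integral_congr_ae (by filter_upwards [hp] with z hz; rw [hz, hf.symm]; ring)
  rw [integral_neg] at h2
  linarith

end MemF1

end EdgeworthFamily

/-! ### The score vector, its moments, and the information matrix. -/

namespace EdgeworthFamily

/-- The score vector at `(0, 1, 0)`. -/
noncomputable def scoreVec (f f' : ℝ → ℝ) (z : ℝ) : Fin 3 → ℝ :=
  ![score f f' z, z * score f f' z - 1, score f f' z * (z ^ 2 - kappa f f')]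

/-- The distribution with density `f`. -/
noncomputable def base (f : ℝ → ℝ) : Measure ℝ := volume.withDensity fun z => ENNReal.ofReal (f z)

namespace MemF1

variable {f f' : ℝ → ℝ}

lemma isProbabilityMeasure_base (hf : MemF1 f f') : IsProbabilityMeasure (base f) := by
  constructor
  rw [base, withDensity_apply _ MeasurableSet.univ, Measure.restrict_univ,
    ← ofReal_integral_eq_lintegral_ofReal hf.integrable (ae_of_all _ fun z => (hf.pos z).le),
    hf.integral_eq_one, ENNReal.ofReal_one]

lemma integral_base (hf : MemF1 f f') (h : ℝ → ℝ) : ∫ z, h z ∂(base f) = ∫ z, h z * f z := by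
  rw [base, integral_withDensity_eq_integral_toReal_smul
    hf.continuous.measurable.ennreal_ofReal (ae_of_all _ fun z => ENNReal.ofReal_lt_top)]
  refine integral_congr_ae (ae_of_all _ fun z => ?_)
  simp [ENNReal.toReal_ofReal (hf.pos z).le, mul_comm]

lemma integrable_base_iff (hf : MemF1 f f') {h : ℝ → ℝ} :
    Integrable h (base f) ↔ Integrable (fun z => h z * f z) := by
  rw [base, integrable_withDensity_iff hf.continuous.measurable.ennreal_ofReal
    (ae_of_all _ fun z => ENNReal.ofReal_lt_top)]
  simp [ENNReal.toReal_ofReal (hf.pos _).le]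

lemma measurable_scoreVec (hf : MemF1 f f') (i : Fin 3) :
    Measurable fun z => scoreVec f f' z i := by
  have := hf.measurable_score
  fin_cases i <;> simp [scoreVec] <;> fun_prop

/-- This is the domination that `integrable_of_le` asks for; it places all three scores in `L²`. -/
lemma scoreVec_sq_le (z : ℝ) (i : Fin 3) : scoreVec f f' z i ^ 2 ≤
    (4 + 2 * kappa f f' ^ 2) * (1 + (1 + z ^ 4) * score f f' z ^ 2) := by
  set p := score f f' z
  set k := kappa f f'
  have h2 : z ^ 2 * p ^ 2 ≤ (1 + z ^ 4) * p ^ 2 :=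
    mul_le_mul_of_nonneg_right (by nlinarith [sq_nonneg (z ^ 2 - 1)]) (sq_nonneg _)
  have h3 : 0 ≤ k ^ 2 * (1 + (1 + z ^ 4) * p ^ 2) := by positivity
  have h4 : 0 ≤ z ^ 4 * p ^ 2 := by positivity
  have h5 : 0 ≤ k ^ 2 * z ^ 4 * p ^ 2 := by positivity
  fin_cases i
  · simp only [scoreVec, Fin.zero_eta, Matrix.cons_val_zero]
    change p ^ 2 ≤ _
    nlinarith [sq_nonneg p]
  · simp only [scoreVec, Fin.mk_one, Matrix.cons_val_one, Matrix.cons_val_zero]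
    change (z * p - 1) ^ 2 ≤ _
    nlinarith [sq_nonneg (z * p + 1), sq_nonneg p]
  · simp only [scoreVec, Fin.reduceFinMk, Matrix.cons_val]
    change (p * (z ^ 2 - k)) ^ 2 ≤ _
    have : (p * (z ^ 2 - k)) ^ 2 ≤ 2 * (z ^ 4 * p ^ 2) + 2 * (k ^ 2 * p ^ 2) := by
      nlinarith [sq_nonneg (p * (z ^ 2 + k))]
    nlinarith [sq_nonneg p, sq_nonneg k]

lemma integrable_scoreVec_mul (hf : MemF1 f f') (i j : Fin 3) :
    Integrable (fun z => scoreVec f f' z i * scoreVec f f' z j) (base f) := by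
  rw [hf.integrable_base_iff]
  refine hf.integrable_of_le (C := 4 + 2 * kappa f f' ^ 2)
    ((hf.measurable_scoreVec i).mul (hf.measurable_scoreVec j)) fun z => ?_
  have h1 := scoreVec_sq_le (f := f) (f' := f') z i
  have h2 := scoreVec_sq_le (f := f) (f' := f') z j
  rw [abs_le]
  constructor <;> nlinarith [sq_nonneg (scoreVec f f' z i + scoreVec f f' z j),
    sq_nonneg (scoreVec f f' z i - scoreVec f f' z j)]

lemma memLp_scoreVec (hf : MemF1 f f') (i : Fin 3) :
    MemLp (fun z => scoreVec f f' z i) 2 (base f) := by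
  rw [memLp_two_iff_integrable_sq (hf.measurable_scoreVec i).aestronglyMeasurable]
  simpa only [sq] using hf.integrable_scoreVec_mul i i

lemma infoLoc_pos (hf : MemF1 f f') : 0 < infoLoc f f' := by
  obtain ⟨z₀, hz₀, hs⟩ := hf.exists_score_pos
  rw [infoLoc, integral_pos_iff_support_of_nonneg
    (fun z => mul_nonneg (sq_nonneg _) (hf.pos z).le) hf.integrable_infoLoc]
  refine lt_of_lt_of_le ?_ (measure_mono (s := Set.Ioi z₀) fun z hz => ?_)
  · simp
  · have : 0 < score f f' z := hs.trans_le (hf.monotone_score (le_of_lt hz))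
    exact (mul_pos (pow_pos this 2) (hf.pos z)).ne'

lemma infoScale_eq (hf : MemF1 f f') : infoScale f f' = kappa f f' * infoLoc f f' := by
  rw [kappa, div_mul_cancel₀ _ hf.infoLoc_pos.ne']

lemma kappa_nonneg (hf : MemF1 f f') : 0 ≤ kappa f f' :=
  div_nonneg (integral_nonneg fun z => by have := (hf.pos z).le; positivity) hf.infoLoc_pos.le

/-- The location and skewness scores are odd almost everywhere; the scale score is centered by
`integral_mul_score`. -/
lemma integral_scoreVec (hf : MemF1 f f') (i : Fin 3) :
    ∫ z, scoreVec f f' z i ∂(base f) = 0 := by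
  rw [hf.integral_base]
  fin_cases i
  · exact hf.integral_odd (by simpa [scoreVec] using hf.ae_score_neg)
  · simp only [scoreVec, Fin.mk_one, Matrix.cons_val_one, Matrix.cons_val_zero, sub_mul, one_mul]
    rw [integral_sub hf.integrable_mul_score hf.integrable, hf.integral_mul_score,
      hf.integral_eq_one, sub_self]
  · refine hf.integral_odd ?_
    filter_upwards [hf.ae_score_neg] with z hz
    simp [scoreVec, hz]

/-- Parity kills the correlations of the scale score with the other two. Location and skewness have
the same parity: they are uncorrelated because `κ = 𝓙 / 𝓘` is the constant that makes `∫ φ² (z² - κ)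
f` vanish. -/
lemma integral_scoreVec_mul (hf : MemF1 f f') (i j : Fin 3) :
    ∫ z, scoreVec f f' z i * scoreVec f f' z j ∂(base f) = infoMatrix f f' 1 i j := by
  have h01 : ∫ z, scoreVec f f' z 0 * scoreVec f f' z 1 ∂(base f) = 0 := by
    rw [hf.integral_base]
    refine hf.integral_odd ?_
    filter_upwards [hf.ae_score_neg] with z hz
    simp [scoreVec, hz]
  have h12 : ∫ z, scoreVec f f' z 1 * scoreVec f f' z 2 ∂(base f) = 0 := by
    rw [hf.integral_base]
    refine hf.integral_odd ?_
    filter_upwards [hf.ae_score_neg] with z hz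
    simp [scoreVec, hz]
  have h02 : ∫ z, scoreVec f f' z 0 * scoreVec f f' z 2 ∂(base f) = 0 := by
    rw [hf.integral_base]
    have : ∀ z, scoreVec f f' z 0 * scoreVec f f' z 2 * f z =
        z ^ 2 * score f f' z ^ 2 * f z - kappa f f' * (score f f' z ^ 2 * f z) := fun z => by
      simp [scoreVec]; ring
    simp_rw [this]
    rw [integral_sub hf.integrable_infoScale (hf.integrable_infoLoc.const_mul _),
      integral_const_mul]
    change infoScale f f' - kappa f f' * infoLoc f f' = 0
    rw [hf.infoScale_eq, sub_self]
  have h00 : ∫ z, scoreVec f f' z 0 * scoreVec f f' z 0 ∂(base f) = infoLoc f f' := by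
    rw [hf.integral_base]
    simp [scoreVec, infoLoc, sq]
  have h11 : ∫ z, scoreVec f f' z 1 * scoreVec f f' z 1 ∂(base f) = infoScale f f' - 1 := by
    rw [hf.integral_base]
    have : ∀ z, scoreVec f f' z 1 * scoreVec f f' z 1 * f z =
        z ^ 2 * score f f' z ^ 2 * f z - (2 * (z * score f f' z * f z) - f z) := fun z => by
      simp [scoreVec]; ring
    have hi : Integrable fun z => 2 * (z * score f f' z * f z) - f z :=
      (hf.integrable_mul_score.const_mul _).sub hf.integrable
    simp_rw [this]
    rw [integral_sub hf.integrable_infoScale hi, integral_sub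
      (hf.integrable_mul_score.const_mul _) hf.integrable, integral_const_mul,
      hf.integral_mul_score, hf.integral_eq_one, infoScale]
    ring
  have h22 : ∫ z, scoreVec f f' z 2 * scoreVec f f' z 2 ∂(base f) =
      infoSkew f f' - infoScale f f' ^ 2 / infoLoc f f' := by
    rw [hf.integral_base]
    have : ∀ z, scoreVec f f' z 2 * scoreVec f f' z 2 * f z =
        z ^ 4 * score f f' z ^ 2 * f z - (2 * kappa f f' * (z ^ 2 * score f f' z ^ 2 * f z)
          - kappa f f' ^ 2 * (score f f' z ^ 2 * f z)) := fun z => by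
      simp [scoreVec]; ring
    have hi : Integrable fun z => 2 * kappa f f' * (z ^ 2 * score f f' z ^ 2 * f z)
        - kappa f f' ^ 2 * (score f f' z ^ 2 * f z) :=
      (hf.integrable_infoScale.const_mul _).sub (hf.integrable_infoLoc.const_mul _)
    simp_rw [this]
    rw [integral_sub hf.integrable_infoSkew hi, integral_sub
      (hf.integrable_infoScale.const_mul _) (hf.integrable_infoLoc.const_mul _),
      integral_const_mul, integral_const_mul]
    change infoSkew f f' - (2 * kappa f f' * infoScale f f' - kappa f f' ^ 2 * infoLoc f f') = _
    rw [kappa]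
    have := hf.infoLoc_pos.ne'
    field_simp
    ring
  have hc : ∀ i j, ∫ z, scoreVec f f' z i * scoreVec f f' z j ∂(base f) =
      ∫ z, scoreVec f f' z j * scoreVec f f' z i ∂(base f) := fun i j => by
    simp_rw [mul_comm]
  fin_cases i <;> fin_cases j <;> simp [infoMatrix] <;>
    first | assumption | (rw [hc]; assumption)

/-- The second moments of the scores are positive. -/
lemma scoreVec_sq_pos (hf : MemF1 f f') (i : Fin 3) :
    0 < ∫ z, scoreVec f f' z i * scoreVec f f' z i ∂(base f) := by
  obtain ⟨z₀, hz₀, hs⟩ := hf.exists_score_pos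
  have hint := hf.integrable_base_iff.1 (hf.integrable_scoreVec_mul i i)
  rw [hf.integral_base]
  rw [integral_pos_iff_support_of_nonneg
    (fun z => mul_nonneg (mul_self_nonneg _) (hf.pos z).le) hint]
  have hpos : ∀ z, z₀ < z → 0 < score f f' z := fun z hz =>
    hs.trans_le (hf.monotone_score hz.le)
  -- Beyond `R` no score vanishes: `z > z₀` keeps `φ` positive, `z > 1 / φ(z₀)` makes `z φ(z) > 1`,
  -- and `z > 1 + κ` makes `z² > κ`.
  set R := max (max z₀ (1 / score f f' z₀)) (1 + kappa f f') with hR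
  refine lt_of_lt_of_le ?_ (measure_mono (s := Set.Ioi R) fun z hz => ?_)
  · simp
  have hz' : R < z := hz
  rw [hR, max_lt_iff, max_lt_iff] at hz'
  obtain ⟨⟨hz1, hz2⟩, hz3⟩ := hz'
  have hp := hpos z hz1
  have h0 := hf.kappa_nonneg
  have hi : scoreVec f f' z i ≠ 0 := by
    fin_cases i
    · simpa [scoreVec] using hp.ne'
    · simp only [scoreVec, Fin.mk_one, Matrix.cons_val_one, Matrix.cons_val_zero]
      rw [div_lt_iff₀ hs] at hz2
      have := mul_le_mul_of_nonneg_left (hf.monotone_score hz1.le) (hz₀.trans hz1).le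
      linarith
    · simp only [scoreVec, Fin.reduceFinMk, Matrix.cons_val]
      exact mul_ne_zero hp.ne' (by nlinarith)
  exact mul_ne_zero (mul_ne_zero hi hi) (hf.pos z).ne'

lemma posDef_infoMatrix (hf : MemF1 f f') {σ : ℝ} (hσ : 0 < σ) :
    (infoMatrix f f' σ).PosDef := by
  refine Matrix.PosDef.diagonal fun i => ?_
  have h := hf.scoreVec_sq_pos i
  rw [hf.integral_scoreVec_mul] at h
  have hs : 0 < (σ ^ 2)⁻¹ := by positivity
  fin_cases i <;> simp only [infoMatrix, Matrix.diagonal_apply_eq, Fin.zero_eta, Fin.mk_one,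
    Fin.reduceFinMk, Matrix.cons_val, one_pow, inv_one, one_mul] at h ⊢
  · exact mul_pos hs h
  · exact mul_pos hs h
  · exact h

end MemF1

end EdgeworthFamily

/-! ### Limit theorems in probability for triangular arrays of functions of an i.i.d. sample. -/

section IID

variable {E : Type*} [MeasurableSpace E] {P : Measure E} [IsProbabilityMeasure P]

/-- The law of an infinite sample from `P`. -/
noncomputable abbrev iidLaw (P : Measure E) [IsProbabilityMeasure P] : Measure (ℕ → E) :=
  Measure.infinitePi fun _ : ℕ => P

/-- Convergence to zero in probability of a sequence of real statistics. -/
def ProbZero {Ω : Type*} [MeasurableSpace Ω] (Q : Measure Ω) (T : ℕ → Ω → ℝ) : Prop :=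
  ∀ δ : ℝ, 0 < δ → Tendsto (fun n => Q {ω | δ ≤ |T n ω|}) atTop (𝓝 0)

namespace ProbZero

variable {Ω : Type*} [MeasurableSpace Ω] {Q : Measure Ω} {S T : ℕ → Ω → ℝ}

lemma add (hS : ProbZero Q S) (hT : ProbZero Q T) : ProbZero Q fun n ω => S n ω + T n ω := by
  intro δ hδ
  have h := (hS (δ / 2) (half_pos hδ)).add (hT (δ / 2) (half_pos hδ))
  rw [add_zero] at h
  refine tendsto_of_tendsto_of_tendsto_of_le_of_le tendsto_const_nhds h (fun _ => zero_le) fun n => ?_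
  refine (measure_mono fun ω hω => ?_).trans (measure_union_le _ _)
  by_contra hc
  simp only [Set.mem_union, Set.mem_ofPred_eq, not_or, not_le] at hc hω
  linarith [abs_add_le (S n ω) (T n ω)]

lemma mono (hS : ProbZero Q S) (h : ∀ᶠ n in atTop, ∀ ω, |T n ω| ≤ |S n ω|) : ProbZero Q T := by
  intro δ hδ
  refine tendsto_of_tendsto_of_tendsto_of_le_of_le' tendsto_const_nhds (hS δ hδ)
    (Eventually.of_forall fun _ => zero_le) ?_
  filter_upwards [h] with n hn
  exact measure_mono fun ω hω => le_trans hω (hn ω)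

lemma of_const {c : ℕ → ℝ} (hc : Tendsto c atTop (𝓝 0)) : ProbZero Q fun n _ => c n := by
  intro δ hδ
  refine tendsto_const_nhds.congr' ?_
  have h := hc.abs
  rw [abs_zero] at h
  filter_upwards [h.eventually (gt_mem_nhds hδ)] with n hn
  simp [not_le.2 hn]

lemma of_integral [IsFiniteMeasure Q] (hi : ∀ n, Integrable (T n) Q)
    (h : Tendsto (fun n => ∫ ω, |T n ω| ∂Q) atTop (𝓝 0)) : ProbZero Q T := by
  intro δ hδ
  have h2 := ENNReal.tendsto_ofReal (h.div_const δ)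
  rw [zero_div, ENNReal.ofReal_zero] at h2
  refine tendsto_of_tendsto_of_tendsto_of_le_of_le tendsto_const_nhds h2 (fun _ => zero_le) fun n => ?_
  have h3 := mul_meas_ge_le_integral_of_nonneg (μ := Q) (f := fun ω => |T n ω|)
    (ae_of_all _ fun _ => abs_nonneg _) (hi n).abs δ
  rw [← ofReal_measureReal]
  refine ENNReal.ofReal_le_ofReal ?_
  rwa [le_div_iff₀ hδ, mul_comm]

end ProbZero

lemma integrable_iid {h : E → ℝ} (hh : Integrable h P) (i : ℕ) :
    Integrable (fun ω : ℕ → E => h (ω i)) (iidLaw P) :=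
  (measurePreserving_eval_infinitePi (fun _ : ℕ => P) i).integrable_comp_of_integrable hh

lemma memLp_iid {h : E → ℝ} {p : ℝ≥0∞} (hh : MemLp h p P) (i : ℕ) :
    MemLp (fun ω : ℕ → E => h (ω i)) p (iidLaw P) :=
  hh.comp_measurePreserving (measurePreserving_eval_infinitePi (fun _ : ℕ => P) i)

lemma identDistrib_iid {h : E → ℝ} (hh : Measurable h) (i : ℕ) :
    IdentDistrib (fun ω : ℕ → E => h (ω i)) h (iidLaw P) P := by
  have hp := measurePreserving_eval_infinitePi (fun _ : ℕ => P) i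
  refine ⟨(hh.comp (measurable_pi_apply i)).aemeasurable, hh.aemeasurable, ?_⟩
  rw [show (fun ω : ℕ → E => h (ω i)) = h ∘ Function.eval i from rfl,
    ← Measure.map_map hh (measurable_pi_apply i), hp.map_eq]

lemma iIndepFun_iid {h : E → ℝ} (hh : Measurable h) :
    iIndepFun (fun (i : ℕ) (ω : ℕ → E) => h (ω i)) (iidLaw P) :=
  iIndepFun_infinitePi (X := fun _ => h) fun _ => hh

lemma integral_iid {h : E → ℝ} (hh : Measurable h) (i : ℕ) :
    ∫ ω, h (ω i) ∂(iidLaw P) = ∫ x, h x ∂P :=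
  (identDistrib_iid hh i).integral_eq

lemma integral_abs_sum_iid_le {h : E → ℝ} (hm : Measurable h) (hh : Integrable h P) (n : ℕ) :
    ∫ ω, |∑ i ∈ Finset.range n, h (ω i)| ∂(iidLaw P) ≤ n * ∫ x, |h x| ∂P := by
  calc ∫ ω, |∑ i ∈ Finset.range n, h (ω i)| ∂(iidLaw P)
      ≤ ∫ ω, ∑ i ∈ Finset.range n, |h (ω i)| ∂(iidLaw P) := by
        refine integral_mono (integrable_finsetSum _ fun i _ => integrable_iid hh i).abs
          (integrable_finsetSum _ fun i _ => (integrable_iid hh i).abs)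
          fun ω => Finset.abs_sum_le_sum_abs _ _
    _ = n * ∫ x, |h x| ∂P := by
        rw [integral_finsetSum _ fun i _ => (integrable_iid hh i).abs]
        simp_rw [integral_iid hm.abs]
        simp

lemma variance_sum_iid {h : E → ℝ} (hm : Measurable h) (hh : MemLp h 2 P) (n : ℕ) :
    Var[fun ω => ∑ i ∈ Finset.range n, h (ω i); iidLaw P] = n * Var[h; P] := by
  have := IndepFun.variance_sum (μ := iidLaw P) (X := fun (i : ℕ) (ω : ℕ → E) => h (ω i))
    (s := Finset.range n) (fun i _ => memLp_iid hh i)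
    (fun i _ j _ hij => (iIndepFun_iid hm).indepFun hij)
  rw [Finset.sum_fn] at this
  rw [this, Finset.sum_congr rfl fun i _ => (identDistrib_iid hm i).variance_eq]
  simp

/-- Centered sums of a triangular array of i.i.d. variables vanish in probability if `n` times the
second moments do. -/
lemma probZero_sum_sub_integral {D : ℕ → E → ℝ} (hm : ∀ n, Measurable (D n))
    (hD : ∀ n, MemLp (D n) 2 P) (h : Tendsto (fun n : ℕ => n * ∫ x, D n x ^ 2 ∂P) atTop (𝓝 0)) :
    ProbZero (iidLaw P) fun n ω => ∑ i ∈ Finset.range n, D n (ω i) - n * ∫ x, D n x ∂P := by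
  intro δ hδ
  have h2 := ENNReal.tendsto_ofReal (h.div_const (δ ^ 2))
  rw [zero_div, ENNReal.ofReal_zero] at h2
  refine tendsto_of_tendsto_of_tendsto_of_le_of_le tendsto_const_nhds h2 (fun _ => zero_le) fun n => ?_
  have h3 := meas_ge_le_variance_div_sq (μ := iidLaw P)
    (memLp_finsetSum (Finset.range n) fun i _ => memLp_iid (hD n) i) hδ
  rw [integral_finsetSum _ fun i _ => integrable_iid ((hD n).integrable (by norm_num)) i,
    variance_sum_iid (hm n) (hD n)] at h3
  simp_rw [integral_iid (hm n)] at h3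
  rw [Finset.sum_const, Finset.card_range, nsmul_eq_mul] at h3
  refine h3.trans (ENNReal.ofReal_le_ofReal ?_)
  gcongr
  exact variance_le_expectation_sq (hD n).1

/-- Weak law of large numbers, in mean. -/
lemma tendsto_integral_abs_mean_sub {h : E → ℝ} (hm : Measurable h) (hh : Integrable h P) :
    Tendsto (fun n : ℕ => ∫ ω, |(n : ℝ)⁻¹ * ∑ i ∈ Finset.range n, h (ω i) - ∫ x, h x ∂P|
      ∂(iidLaw P)) atTop (𝓝 0) := by
  have hs := strong_law_Lp (μ := iidLaw P) (p := 1) le_rfl ENNReal.one_ne_top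
    (fun (i : ℕ) (ω : ℕ → E) => h (ω i)) (memLp_one_iff_integrable.2 (integrable_iid hh 0))
    (fun i j hij => (iIndepFun_iid hm).indepFun hij)
    (fun i => (identDistrib_iid hm i).trans (identDistrib_iid hm 0).symm)
  have ht := (ENNReal.tendsto_toReal ENNReal.zero_ne_top).comp hs
  rw [ENNReal.toReal_zero] at ht
  refine ht.congr fun n => ?_
  simp only [Function.comp, smul_eq_mul, integral_iid hm]
  rw [eLpNorm_one_eq_lintegral_enorm, integral_eq_lintegral_of_nonneg_ae
    (ae_of_all _ fun _ => abs_nonneg _)]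
  · congr 1
    refine lintegral_congr fun ω => ?_
    simp [← Real.norm_eq_abs]
  · exact ((((integrable_finsetSum _ fun i _ => integrable_iid hh i).const_mul _).sub
      (integrable_const _)).abs).aestronglyMeasurable

/-- The maximum of a triangular array of i.i.d. variables vanishes in probability, if the variables
are dominated in mean square by square integrable variables. -/
lemma tendsto_measure_exists_lt_abs {W D : ℕ → E → ℝ} {L : E → ℝ} (hmD : ∀ n, Measurable (D n))
    (hD : ∀ n, MemLp (D n) 2 P) (hmL : Measurable L) (hL : MemLp L 2 P)
    (h : Tendsto (fun n : ℕ => n * ∫ x, D n x ^ 2 ∂P) atTop (𝓝 0))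
    (hW : ∀ n x, |W n x| ≤ |D n x| + (√(n : ℝ))⁻¹ * L x) {η : ℝ} (hη : 0 < η) :
    Tendsto (fun n => iidLaw P {ω | ∃ i < n, η < |W n (ω i)|}) atTop (𝓝 0) := by
  have hη2 := half_pos hη
  -- Dominated convergence for the truncated second moment of `L`. By Chebyshev's inequality it
  -- makes `n` times the probability of `L ≥ η √n / 2` vanish, which is what the union bound over
  -- `n` observations needs.
  have hLlim : Tendsto (fun n : ℕ => ∫ x, Set.indicator {x | η / 2 * √(n : ℝ) ≤ L x}
      (fun x => L x ^ 2) x ∂P) atTop (𝓝 0) := by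
    have := tendsto_integral_of_dominated_convergence (μ := P)
      (F := fun (n : ℕ) x => Set.indicator {x | η / 2 * √(n : ℝ) ≤ L x} (fun x => L x ^ 2) x)
      (f := fun _ => 0) (fun x => L x ^ 2)
      (fun n => ((hmL.pow_const 2).indicator
        (measurableSet_le measurable_const hmL)).aestronglyMeasurable) hL.integrable_sq
      (fun n => ae_of_all _ fun x => by
        rw [Real.norm_eq_abs, Set.indicator_apply]
        split_ifs
        · rw [abs_of_nonneg (sq_nonneg _)]
        · simpa using sq_nonneg (L x))
      (ae_of_all _ fun x => by
        refine tendsto_const_nhds.congr' ?_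
        have : Tendsto (fun n : ℕ => η / 2 * √(n : ℝ)) atTop atTop :=
          (Real.tendsto_sqrt_atTop.comp tendsto_natCast_atTop_atTop).const_mul_atTop hη2
        filter_upwards [this.eventually_gt_atTop (L x)] with n hn
        rw [Set.indicator_of_notMem]
        simpa using hn)
    simpa using this
  have hsum := (h.div_const ((η / 2) ^ 2)).add (hLlim.div_const ((η / 2) ^ 2))
  have h2 := ENNReal.tendsto_ofReal hsum
  rw [zero_div, add_zero, ENNReal.ofReal_zero] at h2
  refine tendsto_of_tendsto_of_tendsto_of_le_of_le' tendsto_const_nhds h2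
    (Eventually.of_forall fun _ => zero_le) ?_
  filter_upwards [eventually_gt_atTop 0] with n hn
  have hn' : (0 : ℝ) < n := by exact_mod_cast hn
  have hsn : 0 < √(n : ℝ) := Real.sqrt_pos.2 hn'
  have hP1 : P.real {x | η / 2 ≤ |D n x|} ≤ (∫ x, D n x ^ 2 ∂P) / (η / 2) ^ 2 := by
    rw [le_div_iff₀ (by positivity), mul_comm]
    have h3 := mul_meas_ge_le_integral_of_nonneg (μ := P) (f := fun x => D n x ^ 2)
      (ae_of_all _ fun _ => sq_nonneg _) (hD n).integrable_sq ((η / 2) ^ 2)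
    refine le_trans (le_of_eq ?_) h3
    congr 2
    ext x
    simp only [Set.mem_ofPred_eq]
    rw [sq_le_sq, abs_of_pos hη2]
  have hms : MeasurableSet {x | η / 2 * √(n : ℝ) ≤ L x} := measurableSet_le measurable_const hmL
  have hP2 : n * P.real {x | η / 2 * √(n : ℝ) ≤ L x} ≤
      (∫ x, Set.indicator {x | η / 2 * √(n : ℝ) ≤ L x} (fun x => L x ^ 2) x ∂P) / (η / 2) ^ 2 := by
    rw [le_div_iff₀ (by positivity)]
    have h3 : ∫ x, Set.indicator {x | η / 2 * √(n : ℝ) ≤ L x} (fun _ => (η / 2 * √(n : ℝ)) ^ 2) x ∂P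
        ≤ ∫ x, Set.indicator {x | η / 2 * √(n : ℝ) ≤ L x} (fun x => L x ^ 2) x ∂P := by
      refine integral_mono ((integrable_const _).indicator hms) (hL.integrable_sq.indicator hms)
        fun x => ?_
      simp only [Set.indicator_apply, Set.mem_ofPred_eq]
      split_ifs with hx
      · exact pow_le_pow_left₀ (by positivity) hx 2
      · exact le_rfl
    rw [integral_indicator_const _ hms, smul_eq_mul, mul_pow, Real.sq_sqrt hn'.le] at h3
    linarith
  rw [← ofReal_measureReal]
  refine ENNReal.ofReal_le_ofReal ?_
  have hsub : {ω : ℕ → E | ∃ i < n, η < |W n (ω i)|} ⊆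
      ⋃ i ∈ Finset.range n, (fun ω : ℕ → E => ω i) ⁻¹'
        ({x | η / 2 ≤ |D n x|} ∪ {x | η / 2 * √(n : ℝ) ≤ L x}) := by
    rintro ω ⟨i, hi, hlt⟩
    simp only [Set.mem_iUnion, Finset.mem_range]
    refine ⟨i, hi, ?_⟩
    by_contra hc
    simp only [Set.mem_preimage, Set.mem_union, Set.mem_ofPred_eq, not_or, not_le] at hc
    have h4 : (√(n : ℝ))⁻¹ * L (ω i) < η / 2 := by
      rw [inv_mul_lt_iff₀ hsn]; linarith [hc.2]
    linarith [hW n (ω i), hc.1]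
  have hmu : MeasurableSet ({x | η / 2 ≤ |D n x|} ∪ {x | η / 2 * √(n : ℝ) ≤ L x}) :=
    (measurableSet_le measurable_const (hmD n).abs).union hms
  calc (iidLaw P).real {ω : ℕ → E | ∃ i < n, η < |W n (ω i)|}
      ≤ ∑ i ∈ Finset.range n, (iidLaw P).real ((fun ω : ℕ → E => ω i) ⁻¹'
        ({x | η / 2 ≤ |D n x|} ∪ {x | η / 2 * √(n : ℝ) ≤ L x})) :=
        (measureReal_mono hsub (measure_ne_top _ _)).trans (measureReal_biUnion_finset_le _ _)
    _ = n * P.real ({x | η / 2 ≤ |D n x|} ∪ {x | η / 2 * √(n : ℝ) ≤ L x}) := by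
        rw [Finset.sum_congr rfl fun i _ =>
          (measurePreserving_eval_infinitePi (fun _ : ℕ => P) i).measureReal_preimage
            hmu.nullMeasurableSet]
        simp
    _ ≤ n * (P.real {x | η / 2 ≤ |D n x|} + P.real {x | η / 2 * √(n : ℝ) ≤ L x}) := by
        gcongr
        exact measureReal_union_le _ _
    _ ≤ _ := by
        rw [mul_add, mul_div_assoc]
        gcongr

end IID

/-! ### Le Cam's expansion of the log-likelihood ratio. -/

section LAN

variable {E : Type*} [MeasurableSpace E] {P : Measure E}

/-- Taylor's formula for `log (1 + x / 2)` to second order. The cubic error is written as `|x| * x ^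
2` so that, summed over a sample, it is at most the maximum times the sum of squares. -/
lemma abs_two_mul_log_sub_le {x : ℝ} (hx : |x| ≤ 1) :
    |2 * Real.log (1 + x / 2) - x + x ^ 2 / 4| ≤ |x| * x ^ 2 := by
  have h1 : |-(x / 2)| = |x| / 2 := by rw [abs_neg, abs_div, abs_two]
  have h := Real.abs_log_sub_add_sum_range_le (x := -(x / 2)) (by rw [h1]; linarith) 2
  rw [h1] at h
  simp only [Finset.sum_range_succ, Finset.sum_range_zero] at h
  have h2 : (|x| / 2) ^ (2 + 1) / (1 - |x| / 2) ≤ |x| ^ 3 / 4 := by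
    rw [div_le_iff₀ (by linarith)]
    have : 0 ≤ |x| ^ 3 := by positivity
    nlinarith
  have h3 : |2 * Real.log (1 + x / 2) - x + x ^ 2 / 4| =
      2 * |0 + (-(x / 2)) ^ (0 + 1) / ((0 : ℕ) + 1) + (-(x / 2)) ^ (1 + 1) / ((1 : ℕ) + 1)
        + Real.log (1 - -(x / 2))| := by
    rw [← abs_two, ← abs_mul, abs_two]
    congr 1
    rw [sub_neg_eq_add]
    push_cast
    ring
  rw [h3, ← sq_abs x]
  have : 0 ≤ |x| ^ 3 := by positivity
  nlinarith [h.trans h2]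

/-- If `n` times the mean square of `W n - (√n)⁻¹ ℓ n` vanishes, then `n` times the mean distance
between the squares vanishes. -/
lemma tendsto_integral_abs_sq_sub {W ℓ : ℕ → E → ℝ} (hW : ∀ n, MemLp (W n) 2 P)
    (hℓ : ∀ n, MemLp (ℓ n) 2 P) {K : ℝ} (hK : ∀ n, ∫ x, ℓ n x ^ 2 ∂P ≤ K)
    (h : Tendsto (fun n : ℕ => (n : ℝ) * ∫ x, (W n x - (√(n : ℝ))⁻¹ * ℓ n x) ^ 2 ∂P) atTop (𝓝 0)) :
    Tendsto (fun n : ℕ => (n : ℝ) * ∫ x, |W n x ^ 2 - ((√(n : ℝ))⁻¹ * ℓ n x) ^ 2| ∂P) atTop (𝓝 0) := by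
  have hK0 : 0 ≤ K := (integral_nonneg fun x => sq_nonneg _).trans (hK 0)
  have key : ∀ η : ℝ, 0 < η → ∀ n : ℕ, 0 < n →
      n * ∫ x, |W n x ^ 2 - ((√(n : ℝ))⁻¹ * ℓ n x) ^ 2| ∂P ≤
        (1 + η⁻¹) * (n * ∫ x, (W n x - (√(n : ℝ))⁻¹ * ℓ n x) ^ 2 ∂P) + η * K := by
    intro η hη n hn
    have hn' : (0 : ℝ) < n := by exact_mod_cast hn
    set a := (√(n : ℝ))⁻¹ with ha
    have ha2 : n * a ^ 2 = 1 := by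
      rw [ha, inv_pow, Real.sq_sqrt hn'.le, mul_inv_cancel₀ hn'.ne']
    have hL : MemLp (fun x => a * ℓ n x) 2 P := (hℓ n).const_mul a
    have hD : MemLp (fun x => W n x - a * ℓ n x) 2 P := (hW n).sub hL
    -- With `D = W - aℓ` and `b = aℓ`, one has `W² - b² = D² + 2Db`. The weighted inequality `2|Db|
    -- ≤ η⁻¹D² + ηb²` leaves `η` free, to be chosen small after `K` is known.
    have hpt : ∀ x, |W n x ^ 2 - (a * ℓ n x) ^ 2| ≤
        (1 + η⁻¹) * (W n x - a * ℓ n x) ^ 2 + η * a ^ 2 * ℓ n x ^ 2 := by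
      intro x
      set D := W n x - a * ℓ n x
      set b := a * ℓ n x
      have hWx : W n x = D + b := by simp [D, b]
      have e1 : η * a ^ 2 * ℓ n x ^ 2 = η * b ^ 2 := by simp [b]; ring
      have e2 : 2 * |D * b| ≤ η⁻¹ * D ^ 2 + η * b ^ 2 := by
        have h1 : η⁻¹ * D ^ 2 + η * b ^ 2 - 2 * |D * b| = η⁻¹ * (|D| - η * |b|) ^ 2 := by
          rw [abs_mul, ← sq_abs D, ← sq_abs b]; field_simp; ring
        have : 0 ≤ η⁻¹ * (|D| - η * |b|) ^ 2 := by positivity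
        linarith
      rw [hWx, e1]
      have e3 : (D + b) ^ 2 - b ^ 2 = D ^ 2 + 2 * (D * b) := by ring
      rw [e3]
      refine (abs_add_le _ _).trans ?_
      rw [abs_mul 2, abs_two, abs_of_nonneg (sq_nonneg D)]
      linarith
    have hint := integral_mono (μ := P) (((hW n).integrable_sq.sub hL.integrable_sq).abs)
      ((hD.integrable_sq.const_mul (1 + η⁻¹)).add ((hℓ n).integrable_sq.const_mul (η * a ^ 2))) hpt
    simp only [Pi.add_apply, Pi.sub_apply] at hint
    rw [integral_add (hD.integrable_sq.const_mul (1 + η⁻¹))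
      ((hℓ n).integrable_sq.const_mul (η * a ^ 2)), integral_const_mul, integral_const_mul] at hint
    calc _ ≤ n * ((1 + η⁻¹) * ∫ x, (W n x - a * ℓ n x) ^ 2 ∂P
          + η * a ^ 2 * ∫ x, ℓ n x ^ 2 ∂P) := mul_le_mul_of_nonneg_left hint hn'.le
      _ = (1 + η⁻¹) * (n * ∫ x, (W n x - a * ℓ n x) ^ 2 ∂P)
          + η * (n * a ^ 2) * ∫ x, ℓ n x ^ 2 ∂P := by ring
      _ ≤ _ := by
        rw [ha2, mul_one]
        gcongr
        exact hK n
  rw [Metric.tendsto_atTop]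
  intro ε hε
  set η := ε / (2 * (K + 1)) with hη
  have hηp : 0 < η := by positivity
  have h2 := h.const_mul (1 + η⁻¹)
  rw [mul_zero] at h2
  obtain ⟨N, hN⟩ := (Metric.tendsto_atTop.1 h2) (ε / 2) (half_pos hε)
  refine ⟨max N 1, fun n hn => ?_⟩
  have h3 := hN n (le_of_max_le_left hn)
  have h4 := key η hηp n (lt_of_lt_of_le one_pos (le_of_max_le_right hn))
  rw [Real.dist_0_eq_abs] at h3 ⊢
  rw [abs_of_nonneg (mul_nonneg (Nat.cast_nonneg _) (integral_nonneg fun x => abs_nonneg _))]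
  have h5 : η * K ≤ ε / 2 := by
    rw [hη, div_mul_eq_mul_div, div_le_iff₀ (by positivity)]
    nlinarith
  linarith [le_abs_self ((1 + η⁻¹) * (n * ∫ x, (W n x - (√(n : ℝ))⁻¹ * ℓ n x) ^ 2 ∂P))]

/-- **Local asymptotic normality from differentiability in quadratic mean** (Le Cam). Here `w n` is
the square root of the likelihood ratio of one observation. -/
theorem log_likelihood_expansion [IsProbabilityMeasure P] {ι : Type*} [Fintype ι] {g : E → ι → ℝ}
    (hgm : ∀ j, Measurable fun x => g x j) (hg : ∀ j, MemLp (fun x => g x j) 2 P)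
    (hg0 : ∀ j, ∫ x, g x j ∂P = 0) {h : ℕ → ι → ℝ} {C : ℝ} (hC : ∀ n j, |h n j| ≤ C)
    {w : ℕ → E → ℝ} (hwm : ∀ n, Measurable (w n)) (hw : ∀ n, MemLp (w n) 2 P)
    (hmass : Tendsto (fun n : ℕ => (n : ℝ) * (∫ x, w n x ^ 2 ∂P - 1)) atTop (𝓝 0))
    (hdqm : Tendsto (fun n : ℕ => (n : ℝ) * ∫ x, (2 * (w n x - 1)
      - (√(n : ℝ))⁻¹ * ∑ j, h n j * g x j) ^ 2 ∂P) atTop (𝓝 0)) {δ : ℝ} (hδ : 0 < δ) :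
    Tendsto (fun n => iidLaw P {ω | ¬((∀ i < n, 0 < w n (ω i)) ∧
      |∑ i ∈ Finset.range n, 2 * Real.log (w n (ω i))
        - ((√(n : ℝ))⁻¹ * ∑ i ∈ Finset.range n, ∑ j, h n j * g (ω i) j
          - 1 / 2 * ∑ j, ∑ k, h n j * h n k * ∫ x, g x j * g x k ∂P)| < δ)}) atTop (𝓝 0) := by
  set ℓ : ℕ → E → ℝ := fun n x => ∑ j, h n j * g x j with hℓdef
  set W : ℕ → E → ℝ := fun n x => 2 * (w n x - 1) with hWdef
  set D : ℕ → E → ℝ := fun n x => W n x - (√(n : ℝ))⁻¹ * ℓ n x with hDdef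
  set I : ℕ → ℝ := fun n => ∑ j, ∑ k, h n j * h n k * ∫ x, g x j * g x k ∂P with hIdef
  set L : E → ℝ := fun x => ∑ j, C * |g x j| with hLdef
  have hint : ∀ j k, Integrable (fun x => g x j * g x k) P := fun j k => (hg j).integrable_mul (hg k)
  have hℓm : ∀ n, Measurable (ℓ n) := fun n =>
    Finset.measurable_sum _ fun j _ => (hgm j).const_mul _
  have hℓ2 : ∀ n, MemLp (ℓ n) 2 P := fun n =>
    memLp_finsetSum _ fun j _ => (hg j).const_mul _
  have hWm : ∀ n, Measurable (W n) := fun n => ((hwm n).sub_const 1).const_mul 2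
  have hW2 : ∀ n, MemLp (W n) 2 P := fun n =>
    ((hw n).sub (memLp_const 1)).const_mul 2
  have hDm : ∀ n, Measurable (D n) := fun n => (hWm n).sub ((hℓm n).const_mul _)
  have hD2 : ∀ n, MemLp (D n) 2 P := fun n => (hW2 n).sub ((hℓ2 n).const_mul _)
  have hLm : Measurable L := Finset.measurable_sum _ fun j _ => (hgm j).abs.const_mul _
  have hL2 : MemLp L 2 P := memLp_finsetSum _ fun j _ => (hg j).abs.const_mul _
  have hℓL : ∀ n x, |ℓ n x| ≤ L x := fun n x =>
    (Finset.abs_sum_le_sum_abs _ _).trans (Finset.sum_le_sum fun j _ => by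
      rw [abs_mul]; exact mul_le_mul_of_nonneg_right (hC n j) (abs_nonneg _))
  have hsq : ∀ n x, ℓ n x ^ 2 = ∑ j, ∑ k, h n j * h n k * (g x j * g x k) := fun n x => by
    simp only [hℓdef, sq, Finset.sum_mul_sum]
    exact Finset.sum_congr rfl fun j _ => Finset.sum_congr rfl fun k _ => by ring
  have hI : ∀ n, ∫ x, ℓ n x ^ 2 ∂P = I n := fun n => by
    simp_rw [hsq]
    rw [integral_finsetSum _ fun j _ => integrable_finsetSum _ fun k _ => (hint j k).const_mul _]
    refine Finset.sum_congr rfl fun j _ => ?_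
    rw [integral_finsetSum _ fun k _ => (hint j k).const_mul _]
    exact Finset.sum_congr rfl fun k _ => integral_const_mul _ _
  set K := ∫ x, L x ^ 2 ∂P with hKdef
  have hK0 : 0 ≤ K := integral_nonneg fun x => sq_nonneg _
  have hℓK : ∀ n, ∫ x, ℓ n x ^ 2 ∂P ≤ K := fun n =>
    integral_mono (hℓ2 n).integrable_sq hL2.integrable_sq fun x => by
      have := hℓL n x
      exact sq_le_sq' (by linarith [neg_abs_le (ℓ n x)]) ((le_abs_self _).trans this)
  have hb := tendsto_integral_abs_sq_sub hW2 hℓ2 hℓK hdqm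
  have hsqrt : ∀ n : ℕ, 0 < n → n * ((√(n : ℝ))⁻¹) ^ 2 = 1 := fun n hn => by
    have hn' : (0 : ℝ) < n := by exact_mod_cast hn
    rw [inv_pow, Real.sq_sqrt hn'.le, mul_inv_cancel₀ hn'.ne']
  -- the mean of the remainder
  have hℓ0 : ∀ n, ∫ x, ℓ n x ∂P = 0 := fun n => by
    rw [hℓdef]
    simp only
    rw [integral_finsetSum _ fun j _ => ((hg j).integrable (by norm_num)).const_mul _]
    simp [integral_const_mul, hg0]
  have hmean : ∀ n, ∫ x, D n x ∂P = (∫ x, w n x ^ 2 ∂P - 1) - 1 / 4 * ∫ x, W n x ^ 2 ∂P := fun n => by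
    have e1 : ∫ x, D n x ∂P = ∫ x, W n x ∂P := by
      calc ∫ x, D n x ∂P = ∫ x, W n x ∂P - ∫ x, (√(n : ℝ))⁻¹ * ℓ n x ∂P :=
            integral_sub ((hW2 n).integrable (by norm_num))
              (((hℓ2 n).integrable (by norm_num)).const_mul _)
        _ = ∫ x, W n x ∂P := by rw [integral_const_mul (√(n : ℝ))⁻¹ (ℓ n), hℓ0, mul_zero, sub_zero]
    -- An exact identity for `W = 2 (w - 1)`. It converts the mean of `W`, a first-order quantity,
    -- into the mass defect and a second moment.
    have e2 : ∀ x, W n x = (w n x ^ 2 - 1) - 1 / 4 * W n x ^ 2 := fun x => by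
      simp only [hWdef]; ring
    rw [e1]
    calc ∫ x, W n x ∂P = ∫ x, ((w n x ^ 2 - 1) - 1 / 4 * W n x ^ 2) ∂P :=
          integral_congr_ae (ae_of_all _ e2)
      _ = _ := by
        have hi : Integrable (fun x => w n x ^ 2 - 1) P :=
          (hw n).integrable_sq.sub (integrable_const 1)
        rw [integral_sub hi ((hW2 n).integrable_sq.const_mul _),
          integral_sub (hw n).integrable_sq (integrable_const 1), integral_const_mul]
        simp
  have hWI : Tendsto (fun n : ℕ => (n : ℝ) * ∫ x, W n x ^ 2 ∂P - I n) atTop (𝓝 0) := by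
    refine squeeze_zero_norm' ?_ hb
    filter_upwards [eventually_gt_atTop 0] with n hn
    have e : n * ∫ x, W n x ^ 2 ∂P - I n =
        n * ∫ x, (W n x ^ 2 - ((√(n : ℝ))⁻¹ * ℓ n x) ^ 2) ∂P := by
      simp_rw [mul_pow]
      rw [integral_sub (hW2 n).integrable_sq ((hℓ2 n).integrable_sq.const_mul _),
        integral_const_mul, mul_sub, ← mul_assoc, hsqrt n hn, one_mul, hI]
    rw [e, Real.norm_eq_abs, abs_mul, Nat.abs_cast]
    gcongr
    exact abs_integral_le_integral_abs
  -- The total mean of the remainders is thus asymptotically `-I / 4`. This is one half of the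
  -- quadratic term; the other half comes from `-W² / 4` in the logarithm.
  have hconst : Tendsto (fun n : ℕ => (n : ℝ) * ∫ x, D n x ∂P + 1 / 4 * I n) atTop (𝓝 0) := by
    have := hmass.sub (hWI.const_mul (1 / 4))
    simp only [mul_zero, sub_zero] at this
    refine this.congr fun n => ?_
    rw [hmean]; ring
  have hT : ProbZero (iidLaw P) fun n ω =>
      ∑ i ∈ Finset.range n, D n (ω i) + 1 / 4 * I n := by
    refine ((probZero_sum_sub_integral hDm hD2 hdqm).add (ProbZero.of_const hconst)).mono
      (Eventually.of_forall fun n ω => le_of_eq ?_)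
    congr 1; ring
  -- the sum of squares
  have hV1 : ProbZero (iidLaw P) fun n ω =>
      ∑ i ∈ Finset.range n, (W n (ω i) ^ 2 - ((√(n : ℝ))⁻¹ * ℓ n (ω i)) ^ 2) := by
    have hi : ∀ n, Integrable (fun x => W n x ^ 2 - ((√(n : ℝ))⁻¹ * ℓ n x) ^ 2) P := fun n =>
      (hW2 n).integrable_sq.sub ((hℓ2 n).const_mul _).integrable_sq
    refine ProbZero.of_integral (fun n => integrable_finsetSum _ fun i _ => integrable_iid (hi n) i) ?_
    exact squeeze_zero (fun n => integral_nonneg fun ω => abs_nonneg _)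
      (fun n => integral_abs_sum_iid_le (((hWm n).pow_const 2).sub
        (((hℓm n).const_mul _).pow_const 2)) (hi n) n) hb
  -- As `ℓ n` changes with `n`, the law of large numbers is applied to the fixed products `g j * g
  -- k`, and the coefficients are bounded by `C ^ 2`.
  have hV2 : ProbZero (iidLaw P) fun n ω =>
      ∑ j, ∑ k, C ^ 2 * |(n : ℝ)⁻¹ * ∑ i ∈ Finset.range n, g (ω i) j * g (ω i) k
        - ∫ x, g x j * g x k ∂P| := by
    have hi : ∀ (n : ℕ) j k, Integrable (fun ω : ℕ → E => C ^ 2 * |(n : ℝ)⁻¹ *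
        ∑ i ∈ Finset.range n, g (ω i) j * g (ω i) k - ∫ x, g x j * g x k ∂P|) (iidLaw P) :=
      fun n j k => ((((integrable_finsetSum _ fun i _ =>
        integrable_iid (hint j k) i).const_mul _).sub (integrable_const _)).abs).const_mul _
    refine ProbZero.of_integral (fun n => integrable_finsetSum _ fun j _ =>
      integrable_finsetSum _ fun k _ => hi n j k) ?_
    have e : ∀ n : ℕ, ∫ ω, abs (∑ j, ∑ k, C ^ 2 * |(n : ℝ)⁻¹ * ∑ i ∈ Finset.range n,
        g (ω i) j * g (ω i) k - ∫ x, g x j * g x k ∂P|) ∂(iidLaw P) =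
        ∑ j, ∑ k, C ^ 2 * ∫ ω, |(n : ℝ)⁻¹ * ∑ i ∈ Finset.range n,
        g (ω i) j * g (ω i) k - ∫ x, g x j * g x k ∂P| ∂(iidLaw P) := fun n => by
      rw [integral_congr_ae (ae_of_all _ fun ω => abs_of_nonneg (Finset.sum_nonneg fun j _ =>
        Finset.sum_nonneg fun k _ => by positivity)),
        integral_finsetSum _ fun j _ => integrable_finsetSum _ fun k _ => hi n j k]
      refine Finset.sum_congr rfl fun j _ => ?_
      rw [integral_finsetSum _ fun k _ => hi n j k]
      exact Finset.sum_congr rfl fun k _ => integral_const_mul _ _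
    simp_rw [e]
    have : Tendsto (fun n : ℕ => ∑ j, ∑ k, C ^ 2 * ∫ ω, |(n : ℝ)⁻¹ * ∑ i ∈ Finset.range n,
        g (ω i) j * g (ω i) k - ∫ x, g x j * g x k ∂P| ∂(iidLaw P)) atTop
        (𝓝 (∑ _j : ι, ∑ _k : ι, C ^ 2 * 0)) :=
      tendsto_finsetSum _ fun j _ => tendsto_finsetSum _ fun k _ =>
        (tendsto_integral_abs_mean_sub ((hgm j).mul (hgm k)) (hint j k)).const_mul _
    simpa using this
  have hV : ProbZero (iidLaw P) fun n ω => ∑ i ∈ Finset.range n, W n (ω i) ^ 2 - I n := by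
    refine (hV1.add (hV2.mono (T := fun n ω => ((√(n : ℝ))⁻¹) ^ 2 *
      ∑ i ∈ Finset.range n, ℓ n (ω i) ^ 2 - I n) (Eventually.of_forall fun n ω => ?_))).mono
      (Eventually.of_forall fun n ω => le_of_eq ?_)
    · have e : ((√(n : ℝ))⁻¹) ^ 2 * ∑ i ∈ Finset.range n, ℓ n (ω i) ^ 2 - I n =
          ∑ j, ∑ k, h n j * h n k * ((n : ℝ)⁻¹ * ∑ i ∈ Finset.range n, g (ω i) j * g (ω i) k
            - ∫ x, g x j * g x k ∂P) := by
        simp_rw [hsq, hIdef, inv_pow, Real.sq_sqrt (Nat.cast_nonneg n)]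
        rw [Finset.sum_comm, Finset.mul_sum, ← Finset.sum_sub_distrib]
        refine Finset.sum_congr rfl fun j _ => ?_
        rw [Finset.sum_comm, Finset.mul_sum, ← Finset.sum_sub_distrib]
        refine Finset.sum_congr rfl fun k _ => ?_
        rw [← Finset.mul_sum]; ring
      rw [e]
      refine le_trans ?_ (le_abs_self _)
      refine (Finset.abs_sum_le_sum_abs _ _).trans (Finset.sum_le_sum fun j _ => ?_)
      refine (Finset.abs_sum_le_sum_abs _ _).trans (Finset.sum_le_sum fun k _ => ?_)
      rw [abs_mul, abs_mul, sq]
      have hC0 : 0 ≤ C := (abs_nonneg _).trans (hC n j)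
      gcongr
      · exact hC n j
      · exact hC n k
    · rw [Finset.sum_sub_distrib, Finset.mul_sum]
      simp_rw [mul_pow]
      congr 1; ring
  -- conclusion
  set η := min 1 (δ / (4 * (K + 1))) with hη
  have hηp : 0 < η := lt_min one_pos (by positivity)
  -- On the good event `|W| ≤ η` and the squares sum to at most `K + 1`, so the cubic remainder is
  -- at most `δ / 4`. The bound `η ≤ 1` also makes the logarithmic expansion valid and every `w`
  -- positive.
  have hηK : η * (K + 1) ≤ δ / 4 := by
    calc η * (K + 1) ≤ δ / (4 * (K + 1)) * (K + 1) :=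
          mul_le_mul_of_nonneg_right (min_le_right _ _) (by positivity)
      _ = δ / 4 := by field_simp
  have hmax := tendsto_measure_exists_lt_abs hDm hD2 hLm hL2 hdqm (W := W) (fun n x => by
    have h1 : W n x = D n x + (√(n : ℝ))⁻¹ * ℓ n x := by simp [hDdef]
    rw [h1]
    refine (abs_add_le _ _).trans (add_le_add_right ?_ _)
    rw [abs_mul, abs_of_nonneg (inv_nonneg.2 (Real.sqrt_nonneg _))]
    exact mul_le_mul_of_nonneg_left (hℓL n x) (inv_nonneg.2 (Real.sqrt_nonneg _))) hηp
  have hlim := (hmax.add (hT (δ / 4) (by positivity))).add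
    ((hV 1 one_pos).add (hV δ hδ))
  simp only [add_zero] at hlim
  refine tendsto_of_tendsto_of_tendsto_of_le_of_le tendsto_const_nhds hlim (fun _ => zero_le)
    fun n => ?_
  refine (measure_mono (t := ({ω : ℕ → E | ∃ i < n, η < |W n (ω i)|} ∪
    {ω | δ / 4 ≤ |∑ i ∈ Finset.range n, D n (ω i) + 1 / 4 * I n|}) ∪
    ({ω | 1 ≤ |∑ i ∈ Finset.range n, W n (ω i) ^ 2 - I n|} ∪
      {ω | δ ≤ |∑ i ∈ Finset.range n, W n (ω i) ^ 2 - I n|})) ?_).trans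
    ((measure_union_le _ _).trans (add_le_add (measure_union_le _ _) (measure_union_le _ _)))
  intro ω hω
  by_contra hc
  simp only [Set.mem_union, Set.mem_ofPred_eq, not_or, not_le, not_exists, not_and, not_lt] at hc
  obtain ⟨⟨hc1, hc2⟩, hc3, hc4⟩ := hc
  refine hω ⟨fun i hi => ?_, ?_⟩
  · have h1 := (hc1 i hi).trans (min_le_left _ _)
    have h2 := (abs_le.1 h1).1
    simp only [hWdef] at h2
    linarith
  have hwW : ∀ i, w n (ω i) = 1 + W n (ω i) / 2 := fun i => by simp only [hWdef]; ring
  have hlog : |∑ i ∈ Finset.range n, (2 * Real.log (w n (ω i)) - W n (ω i) + W n (ω i) ^ 2 / 4)| ≤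
      η * ∑ i ∈ Finset.range n, W n (ω i) ^ 2 := by
    rw [Finset.mul_sum]
    refine (Finset.abs_sum_le_sum_abs _ _).trans (Finset.sum_le_sum fun i hi => ?_)
    have h1 := hc1 i (Finset.mem_range.1 hi)
    rw [hwW]
    exact (abs_two_mul_log_sub_le (h1.trans (min_le_left _ _))).trans
      (mul_le_mul_of_nonneg_right h1 (sq_nonneg _))
  have hIK : I n ≤ K := (hI n).symm.le.trans (hℓK n)
  have hbound : η * ∑ i ∈ Finset.range n, W n (ω i) ^ 2 ≤ δ / 4 := by
    refine le_trans (mul_le_mul_of_nonneg_left ?_ hηp.le) hηK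
    linarith [(abs_lt.1 hc3).2]
  have hdecomp : ∑ i ∈ Finset.range n, 2 * Real.log (w n (ω i))
        - ((√(n : ℝ))⁻¹ * ∑ i ∈ Finset.range n, ℓ n (ω i) - 1 / 2 * I n) =
      ∑ i ∈ Finset.range n, (2 * Real.log (w n (ω i)) - W n (ω i) + W n (ω i) ^ 2 / 4)
      + (∑ i ∈ Finset.range n, D n (ω i) + 1 / 4 * I n)
      - 1 / 4 * (∑ i ∈ Finset.range n, W n (ω i) ^ 2 - I n) := by
    simp only [hDdef, Finset.sum_sub_distrib, Finset.sum_add_distrib, ← Finset.mul_sum,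
      ← Finset.sum_div]
    ring
  rw [hdecomp, abs_lt]
  have a1 := abs_le.1 (hlog.trans hbound)
  have a2 := abs_lt.1 hc2
  have a3 := abs_lt.1 hc4
  constructor <;> linarith [a1.1, a1.2, a2.1, a2.2, a3.1, a3.2]

end LAN

/-! ### The location-scale group on square integrable functions. -/

section LocationScale

lemma eLpNorm_two_sq {α : Type*} [MeasurableSpace α] (μ : Measure α) (h : α → ℝ) :
    eLpNorm h 2 μ ^ 2 = ∫⁻ x, ‖h x‖ₑ ^ 2 ∂μ := by
  have := eLpNorm_nnreal_pow_eq_lintegral (μ := μ) (f := h) (p := 2) two_ne_zero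
  simpa only [NNReal.coe_ofNat, ENNReal.coe_ofNat, ENNReal.rpow_ofNat] using this

lemma eLpNorm_two_le_iff {α : Type*} [MeasurableSpace α] {μ : Measure α} {h : α → ℝ} {c : ℝ≥0∞} :
    eLpNorm h 2 μ ≤ c ↔ ∫⁻ x, ‖h x‖ₑ ^ 2 ∂μ ≤ c ^ 2 := by
  rw [← eLpNorm_two_sq]
  exact (ENNReal.pow_le_pow_left_iff two_ne_zero).symm

lemma lintegral_comp_affine {F : ℝ → ℝ≥0∞} (hF : Measurable F) (m : ℝ) {s : ℝ} (hs : 0 < s) :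
    ∫⁻ z, F ((z - m) / s) = ENNReal.ofReal s * ∫⁻ z, F z := by
  rw [lintegral_sub_right_eq_self (μ := volume) (fun z => F (z / s)) m]
  have h := Real.map_volume_mul_left (inv_ne_zero hs.ne')
  calc ∫⁻ z, F (z / s) = ∫⁻ z, F (s⁻¹ * z) := by simp_rw [div_eq_inv_mul]
    _ = ∫⁻ z, F z ∂(Measure.map (fun z => s⁻¹ * z) volume) :=
        (lintegral_map hF (measurable_const_mul _)).symm
    _ = _ := by rw [h, lintegral_smul_measure, inv_inv, abs_of_pos hs, smul_eq_mul]

/-- The location-scale group, acting isometrically on square integrable functions. -/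
noncomputable def locScale (m s : ℝ) (h : ℝ → ℝ) (z : ℝ) : ℝ := (√s)⁻¹ * h ((z - m) / s)

lemma measurable_locScale {h : ℝ → ℝ} (hh : Measurable h) (m s : ℝ) :
    Measurable (locScale m s h) :=
  (hh.comp ((measurable_id.sub_const m).div_const s)).const_mul _

lemma eLpNorm_locScale {h : ℝ → ℝ} (hh : Measurable h) (m : ℝ) {s : ℝ} (hs : 0 < s) :
    eLpNorm (locScale m s h) 2 volume = eLpNorm h 2 volume := by
  have key : eLpNorm (locScale m s h) 2 volume ^ 2 = eLpNorm h 2 volume ^ 2 := by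
    simp_rw [eLpNorm_two_sq, locScale, enorm_mul, mul_pow]
    have hm : Measurable fun z => ‖h z‖ₑ ^ 2 := hh.enorm.pow_const 2
    rw [lintegral_const_mul _ (show Measurable fun z => ‖h ((z - m) / s)‖ₑ ^ 2 from
      hm.comp ((measurable_id.sub_const m).div_const s)),
      lintegral_comp_affine hm m hs, ← mul_assoc]
    have : ‖(√s)⁻¹‖ₑ ^ 2 * ENNReal.ofReal s = 1 := by
      rw [Real.enorm_eq_ofReal (by positivity), ← ENNReal.ofReal_pow (by positivity),
        ← ENNReal.ofReal_mul (by positivity), inv_pow, Real.sq_sqrt hs.le,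
        inv_mul_cancel₀ hs.ne', ENNReal.ofReal_one]
    rw [this, one_mul]
  exact (ENNReal.pow_right_strictMono two_ne_zero).injective key

lemma memLp_locScale {h : ℝ → ℝ} (hh : Measurable h) (h2 : MemLp h 2 volume) (m : ℝ) {s : ℝ}
    (hs : 0 < s) : MemLp (locScale m s h) 2 volume :=
  ⟨(measurable_locScale hh m s).aestronglyMeasurable, by
    rw [eLpNorm_locScale hh m hs]; exact h2.2⟩

lemma eventually_locScale_near (c : ℝ) (hc : 0 < c) :
    ∀ᶠ p : ℝ × ℝ in 𝓝 (0, 1), |p.1| < c ∧ |p.2 - 1| < c := by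
  have h1 : Tendsto (fun p : ℝ × ℝ => |p.1|) (𝓝 (0, 1)) (𝓝 0) := by
    have : Continuous fun p : ℝ × ℝ => |p.1| := by fun_prop
    simpa using this.tendsto (0, 1)
  have h2 : Tendsto (fun p : ℝ × ℝ => |p.2 - 1|) (𝓝 (0, 1)) (𝓝 0) := by
    have : Continuous fun p : ℝ × ℝ => |p.2 - 1| := by fun_prop
    simpa using this.tendsto (0, 1)
  exact (h1.eventually (gt_mem_nhds hc)).and (h2.eventually (gt_mem_nhds hc))

lemma tendsto_eLpNorm_locScale_sub_of_continuous {g : ℝ → ℝ} (hg : Continuous g)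
    (hc : HasCompactSupport g) :
    Tendsto (fun p : ℝ × ℝ => eLpNorm (fun z => locScale p.1 p.2 g z - g z) 2 volume)
      (𝓝 (0, 1)) (𝓝 0) := by
  obtain ⟨M, hM⟩ := hc.exists_bound_of_continuous hg
  obtain ⟨R, hR⟩ := hc.isCompact.isBounded.exists_norm_le
  have hM0 : 0 ≤ M := (norm_nonneg _).trans (hM 0)
  have hout : ∀ z, |R| < |z| → g z = 0 := fun z hz => by
    by_contra hne
    have := hR z (subset_tsupport g hne)
    rw [Real.norm_eq_abs] at this
    linarith [le_abs_self R]
  have hlim : Tendsto (fun p : ℝ × ℝ => ∫⁻ z, ‖locScale p.1 p.2 g z - g z‖ₑ ^ 2)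
      (𝓝 (0, 1)) (𝓝 (∫⁻ _ : ℝ, 0)) := by
    -- For `|m| < 1/2` and `|s - 1| < 1/2` the transported function vanishes outside `|z| ≤ 2|R| +
    -- 1`, and `(√s)⁻¹ ≤ 2`. This gives the common support and the bound `2M + M`.
    refine tendsto_lintegral_filter_of_dominated_convergence
      (Set.indicator (Set.Icc (-(2 * |R| + 1)) (2 * |R| + 1))
        fun _ => ENNReal.ofReal (3 * M) ^ 2) ?_ ?_ ?_ ?_
    · exact Eventually.of_forall fun p =>
        ((measurable_locScale hg.measurable _ _).sub hg.measurable).enorm.pow_const 2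
    · filter_upwards [eventually_locScale_near (1 / 2) (by norm_num)] with p hp
      obtain ⟨hp1, hp2⟩ := hp
      rw [abs_lt] at hp2
      refine ae_of_all _ fun z => ?_
      by_cases hz : z ∈ Set.Icc (-(2 * |R| + 1)) (2 * |R| + 1)
      · rw [Set.indicator_of_mem hz]
        refine pow_le_pow_left' ?_ 2
        rw [Real.enorm_eq_ofReal_abs]
        refine ENNReal.ofReal_le_ofReal ?_
        have h1 : |locScale p.1 p.2 g z| ≤ 2 * M := by
          rw [locScale, abs_mul, abs_of_nonneg (by positivity)]
          refine mul_le_mul ?_ (hM _) (abs_nonneg _) zero_le_two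
          rw [inv_le_comm₀ (Real.sqrt_pos.2 (by linarith)) two_pos]
          refine Real.le_sqrt_of_sq_le ?_
          norm_num; linarith
        have h2 : |g z| ≤ M := hM z
        linarith [abs_sub (locScale p.1 p.2 g z) (g z)]
      · rw [Set.indicator_of_notMem hz]
        have hz' : 2 * |R| + 1 < |z| := by
          rw [Set.mem_Icc, ← abs_le, not_le] at hz
          exact hz
        have h1 : g z = 0 := hout z (by linarith [abs_nonneg R])
        have h2 : g ((z - p.1) / p.2) = 0 := by
          refine hout _ ?_
          rw [abs_div, abs_of_pos (show 0 < p.2 by linarith), lt_div_iff₀ (by linarith)]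
          have := abs_sub_abs_le_abs_sub z p.1
          nlinarith [abs_nonneg R]
        simp [locScale, h1, h2]
    · rw [lintegral_indicator measurableSet_Icc, setLIntegral_const]
      exact ENNReal.mul_ne_top (by finiteness) (by simp)
    · refine ae_of_all _ fun z => ?_
      have hct : ContinuousAt (fun p : ℝ × ℝ => ‖locScale p.1 p.2 g z - g z‖ₑ ^ 2) (0, 1) := by
        have : ContinuousAt (fun p : ℝ × ℝ => locScale p.1 p.2 g z) (0, 1) := by
          simp only [locScale]
          refine ContinuousAt.mul (ContinuousAt.inv₀ (by fun_prop) (by simp)) ?_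
          exact hg.continuousAt.comp (ContinuousAt.div (by fun_prop) (by fun_prop) one_ne_zero)
        exact (ENNReal.continuous_pow 2).continuousAt.comp (this.sub continuousAt_const).enorm
      have := hct.tendsto
      simpa [locScale] using this
  rw [lintegral_zero] at hlim
  rw [ENNReal.tendsto_nhds_zero] at hlim ⊢
  intro ε hε
  filter_upwards [hlim (ε ^ 2) (by positivity)] with p hp
  exact eLpNorm_two_le_iff.2 hp

/-- Strong continuity of the location-scale group. -/
lemma tendsto_eLpNorm_locScale_sub {h : ℝ → ℝ} (hh : Measurable h) (h2 : MemLp h 2 volume) :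
    Tendsto (fun p : ℝ × ℝ => eLpNorm (fun z => locScale p.1 p.2 h z - h z) 2 volume)
      (𝓝 (0, 1)) (𝓝 0) := by
  rw [ENNReal.tendsto_nhds_zero]
  intro ε hε
  obtain ⟨g, hgc, hgε, hg, hg2⟩ := h2.exists_hasCompactSupport_eLpNorm_sub_le
    (by simp) (ε := ε / 3) (ENNReal.div_pos hε.ne' (by simp)).ne'
  have hlim := ENNReal.tendsto_nhds_zero.1 (tendsto_eLpNorm_locScale_sub_of_continuous hg hgc)
    (ε / 3) (ENNReal.div_pos hε.ne' (by simp))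
  filter_upwards [hlim, eventually_locScale_near 1 one_pos] with p hp hp'
  have hs : 0 < p.2 := by linarith [(abs_lt.1 hp'.2).1]
  have hm := (hh.sub hg.measurable)
  -- An `ε / 3` argument: `h` is replaced by a continuous compactly supported `g`, and the isometry
  -- keeps the transported approximation error below `ε / 3` for every `p`.
  have e : (fun z => locScale p.1 p.2 h z - h z) = locScale p.1 p.2 (h - g)
      + ((fun z => locScale p.1 p.2 g z - g z) - (h - g)) := by
    funext z
    simp only [locScale, Pi.add_apply, Pi.sub_apply]; ring
  rw [e]
  have hmg := ((measurable_locScale hg.measurable p.1 p.2).sub hg.measurable)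
  calc _ ≤ eLpNorm (locScale p.1 p.2 (h - g)) 2 volume
        + (eLpNorm (fun z => locScale p.1 p.2 g z - g z) 2 volume + eLpNorm (h - g) 2 volume) :=
      (eLpNorm_add_le (measurable_locScale hm _ _).aestronglyMeasurable
        (hmg.sub hm).aestronglyMeasurable (by norm_num)).trans
        (add_le_add le_rfl (eLpNorm_sub_le hmg.aestronglyMeasurable hm.aestronglyMeasurable
          (by norm_num)))
    _ ≤ ε / 3 + (ε / 3 + ε / 3) := by
      rw [eLpNorm_locScale hm _ hs]
      exact add_le_add hgε (add_le_add hp hgε)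
    _ = ε := by rw [← add_assoc, ENNReal.add_thirds]

/-- Differentiating the transported `√f` in the location or the scale produces an extra factor
`s⁻¹`, which tends to one and does not affect strong continuity. -/
lemma tendsto_eLpNorm_inv_mul_locScale_sub {h : ℝ → ℝ} (hh : Measurable h)
    (h2 : MemLp h 2 volume) :
    Tendsto (fun p : ℝ × ℝ => eLpNorm (fun z => p.2⁻¹ * locScale p.1 p.2 h z - h z) 2 volume)
      (𝓝 (0, 1)) (𝓝 0) := by
  have hinv : ContinuousAt (fun p : ℝ × ℝ => p.2⁻¹) (0, 1) :=
    ContinuousAt.inv₀ (by fun_prop) one_ne_zero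
  have h1 : Tendsto (fun p : ℝ × ℝ => ‖p.2⁻¹‖ₑ) (𝓝 (0, 1)) (𝓝 1) := by
    simpa using hinv.enorm.tendsto
  have h3 : Tendsto (fun p : ℝ × ℝ => ‖p.2⁻¹ - 1‖ₑ) (𝓝 (0, 1)) (𝓝 0) := by
    simpa using (hinv.sub (continuousAt_const (y := (1 : ℝ)))).enorm.tendsto
  have hsum := (ENNReal.Tendsto.mul h1 (Or.inl one_ne_zero) (tendsto_eLpNorm_locScale_sub hh h2)
    (Or.inr ENNReal.one_ne_top)).add
    (ENNReal.Tendsto.mul_const h3 (Or.inr h2.2.ne) (b := eLpNorm h 2 volume))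
  simp only [mul_zero, zero_mul, add_zero] at hsum
  refine tendsto_of_tendsto_of_tendsto_of_le_of_le tendsto_const_nhds hsum (fun _ => zero_le)
    fun p => ?_
  have e : (fun z => p.2⁻¹ * locScale p.1 p.2 h z - h z) =
      p.2⁻¹ • (fun z => locScale p.1 p.2 h z - h z) + (p.2⁻¹ - 1) • h := by
    funext z
    simp only [Pi.add_apply, Pi.smul_apply, smul_eq_mul]; ring
  simp only
  rw [e, ← eLpNorm_const_smul, ← eLpNorm_const_smul]
  exact eLpNorm_add_le ((((measurable_locScale hh _ _).sub hh).const_smul _).aestronglyMeasurable)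
    (hh.const_smul _).aestronglyMeasurable (by norm_num)

/-- Minkowski's inequality for an average over the unit interval. -/
lemma eLpNorm_le_of_eq_integral {R : ℝ → ℝ} {G : ℝ → ℝ → ℝ}
    (hG : Measurable (Function.uncurry G)) (hR : ∀ᵐ z, R z = ∫ u in (0 : ℝ)..1, G u z)
    {c : ℝ≥0∞} (hc : ∀ u ∈ Set.Ioc (0 : ℝ) 1, eLpNorm (G u) 2 volume ≤ c) :
    eLpNorm R 2 volume ≤ c := by
  -- Unit mass of the interval allows the `L¹` norm in `u` to be bounded by the `L²` norm; Tonelli's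
  -- theorem then exchanges the integrals.
  have hprob : IsProbabilityMeasure (volume.restrict (Set.Ioc (0 : ℝ) 1)) := ⟨by simp⟩
  rw [eLpNorm_two_le_iff]
  have hGz : ∀ z, Measurable fun u => G u z := fun z =>
    hG.comp (measurable_id.prodMk measurable_const)
  calc ∫⁻ z, ‖R z‖ₑ ^ 2 ≤ ∫⁻ z, ∫⁻ u in Set.Ioc (0 : ℝ) 1, ‖G u z‖ₑ ^ 2 := by
        refine lintegral_mono_ae ?_
        filter_upwards [hR] with z hz
        rw [← eLpNorm_two_sq (volume.restrict (Set.Ioc (0 : ℝ) 1)) (fun u => G u z)]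
        refine pow_le_pow_left' ?_ 2
        rw [hz, intervalIntegral.integral_of_le zero_le_one]
        refine (enorm_integral_le_lintegral_enorm _).trans ?_
        rw [← eLpNorm_one_eq_lintegral_enorm]
        exact eLpNorm_le_eLpNorm_of_exponent_le (by norm_num) (hGz z).aestronglyMeasurable
    _ = ∫⁻ u in Set.Ioc (0 : ℝ) 1, ∫⁻ z, ‖G u z‖ₑ ^ 2 :=
        lintegral_lintegral_swap
          ((hG.comp measurable_swap).enorm.pow_const 2).aemeasurable
    _ ≤ ∫⁻ u in Set.Ioc (0 : ℝ) 1, c ^ 2 := by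
        refine setLIntegral_mono' measurableSet_Ioc fun u hu => ?_
        exact eLpNorm_two_le_iff.1 (hc u hu)
    _ = c ^ 2 := by simp

end LocationScale

/-! ### Differentiability in quadratic mean of the location-scale family. -/

namespace EdgeworthFamily

/-- Half the score times the square root of the density: the derivative in quadratic mean of the
square root of the density. -/
noncomputable def rootScore (f f' : ℝ → ℝ) (i : Fin 3) (z : ℝ) : ℝ :=
  1 / 2 * scoreVec f f' z i * √(f z)

namespace MemF1

variable {f f' : ℝ → ℝ}

lemma measurable_rootScore (hf : MemF1 f f') (i : Fin 3) : Measurable (rootScore f f' i) :=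
  ((hf.measurable_scoreVec i).const_mul _).mul hf.continuous.measurable.sqrt

lemma memLp_rootScore (hf : MemF1 f f') (i : Fin 3) : MemLp (rootScore f f' i) 2 volume := by
  rw [memLp_two_iff_integrable_sq (hf.measurable_rootScore i).aestronglyMeasurable]
  have h := (hf.integrable_base_iff.1 (hf.integrable_scoreVec_mul i i)).const_mul (1 / 4)
  refine h.congr (ae_of_all _ fun z => ?_)
  simp only [rootScore, mul_pow, Real.sq_sqrt (hf.pos z).le]
  ring

lemma hasDerivAt_sqrt (hf : MemF1 f f') {x : ℝ} (hx : x ∉ jumpSet f f') :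
    HasDerivAt (fun z => √(f z)) (-(1 / 2) * score f f' x * √(f x)) x := by
  refine ((hf.hasDerivAt hx).sqrt (hf.pos x).ne').congr_deriv ?_
  have h := Real.sqrt_pos.2 (hf.pos x)
  rw [hf.deriv_eq, div_eq_iff (by positivity)]
  nth_rewrite 1 [← Real.mul_self_sqrt (hf.pos x).le]
  ring

/-- Fundamental theorem of calculus along the segment from `(0, 1)` to `(m, s)`. -/
lemma locScale_sqrt_sub (hf : MemF1 f f') {m s z : ℝ} (hs : 0 < s) (hz : z ∉ jumpSet f f') :
    IntervalIntegrable (fun u : ℝ =>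
      m * ((1 + u * (s - 1))⁻¹ * locScale (u * m) (1 + u * (s - 1)) (rootScore f f' 0) z)
      + (s - 1) * ((1 + u * (s - 1))⁻¹
        * locScale (u * m) (1 + u * (s - 1)) (rootScore f f' 1) z)) volume 0 1 ∧
    locScale m s (fun z => √(f z)) z - √(f z) = ∫ u in (0 : ℝ)..1,
      (m * ((1 + u * (s - 1))⁻¹ * locScale (u * m) (1 + u * (s - 1)) (rootScore f f' 0) z)
      + (s - 1) * ((1 + u * (s - 1))⁻¹
        * locScale (u * m) (1 + u * (s - 1)) (rootScore f f' 1) z)) := by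
  set D := jumpSet f f' with hD
  set S : ℝ → ℝ := fun u => 1 + u * (s - 1) with hS
  set w : ℝ → ℝ := fun u => (z - u * m) / S u with hw
  have hSpos : ∀ u ∈ Set.Icc (0 : ℝ) 1, 0 < S u := fun u hu => by
    have : S u = (1 - u) + u * s := by simp only [hS]; ring
    rw [this]
    rcases eq_or_lt_of_le hu.1 with h | h
    · rw [← h]; norm_num
    · have := mul_pos h hs
      linarith [hu.2]
  have hScont : Continuous S := by fun_prop
  have hwcont : ContinuousOn w (Set.Icc 0 1) :=
    ContinuousOn.div (by fun_prop) hScont.continuousOn fun u hu => (hSpos u hu).ne'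
  have hScont' : ContinuousOn (fun u => (S u)⁻¹) (Set.Icc 0 1) :=
    hScont.continuousOn.inv₀ fun u hu => (hSpos u hu).ne'
  have hrcont : ContinuousOn (fun u => (√(S u))⁻¹) (Set.Icc 0 1) :=
    hScont.sqrt.continuousOn.inv₀ fun u hu => (Real.sqrt_pos.2 (hSpos u hu)).ne'
  have hgcont : ContinuousOn (fun u => √(f (w u))) (Set.Icc 0 1) :=
    hf.continuous.sqrt.comp_continuousOn hwcont
  set F : ℝ → ℝ := fun u => (√(S u))⁻¹ * √(f (w u)) with hF
  -- The derivative along the segment is `c₁ + φ(w) c₂`. The functions `c₁` and `c₂` are continuous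
  -- on the unit interval, so the only possible discontinuities come from the bounded factor `φ(w)`.
  set c₁ : ℝ → ℝ := fun u => -(1 / 2) * (s - 1) * ((S u)⁻¹ * (√(S u))⁻¹ * √(f (w u))) with hc₁
  set c₂ : ℝ → ℝ := fun u =>
    (m + (s - 1) * w u) * (1 / 2) * ((S u)⁻¹ * (√(S u))⁻¹ * √(f (w u))) with hc₂
  -- The equation `w u = d` is linear in `u`. It has at most one solution unless `m + d (s - 1) =
  -- 0`, and then it would force `z = d`, contrary to `z` not being a jump.
  have hcount : {u | w u ∈ D ∧ u ∈ Set.Ioo (0 : ℝ) 1}.Countable := by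
    have : {u | w u ∈ D ∧ u ∈ Set.Ioo (0 : ℝ) 1} ⊆ ⋃ d ∈ D, {u | u * (m + d * (s - 1)) = z - d} := by
      rintro u ⟨hu, hu'⟩
      simp only [Set.mem_iUnion]
      refine ⟨w u, hu, ?_⟩
      have h1 : w u * S u = z - u * m := div_mul_cancel₀ _ (hSpos u ⟨hu'.1.le, hu'.2.le⟩).ne'
      simp only [hS] at h1
      simp only [Set.mem_ofPred_eq]
      linear_combination h1
    refine Set.Countable.mono this (hf.countable_jumpSet.biUnion fun d hd => ?_)
    refine Set.Subsingleton.countable fun u hu v hv => ?_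
    have hu' : u * (m + d * (s - 1)) = z - d := hu
    have hv' : v * (m + d * (s - 1)) = z - d := hv
    have hne : m + d * (s - 1) ≠ 0 := fun h0 => by
      rw [h0, mul_zero] at hu'
      exact hz (by rwa [sub_eq_zero.1 hu'.symm])
    exact mul_right_cancel₀ hne (hu'.trans hv'.symm)
  have hderiv : ∀ u ∈ Set.Ioo (0 : ℝ) 1, w u ∉ D →
      HasDerivAt F (c₁ u + score f f' (w u) * c₂ u) u := by
    intro u hu hwu
    have hp := hSpos u ⟨hu.1.le, hu.2.le⟩
    have hSd : HasDerivAt S (s - 1) u := by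
      exact (((hasDerivAt_id u).mul_const (s - 1)).const_add 1).congr_deriv (by simp)
    have hnd : HasDerivAt (fun u => z - u * m) (-m) u := by
      exact (((hasDerivAt_id u).mul_const m).const_sub z).congr_deriv (by simp)
    have hwd : HasDerivAt w ((-m * S u - (z - u * m) * (s - 1)) / S u ^ 2) u :=
      hnd.fun_div hSd hp.ne'
    have hgd := (hf.hasDerivAt_sqrt hwu).comp u hwd
    have hrd := (hSd.sqrt hp.ne').fun_inv (Real.sqrt_pos.2 hp).ne'
    refine (hrd.fun_mul hgd).congr_deriv ?_
    have hwS : z - u * m = w u * S u := (div_mul_cancel₀ _ hp.ne').symm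
    have hr := Real.sqrt_pos.2 hp
    have hrr : √(S u) ^ 2 = S u := Real.sq_sqrt hp.le
    simp only [hc₁, hc₂, Function.comp]
    rw [hwS, ← hrr]
    rw [Real.sqrt_sq hr.le]
    field_simp
    ring
  have hint : IntervalIntegrable (fun u => c₁ u + score f f' (w u) * c₂ u) volume 0 1 := by
    have hwm : Measurable w := by
      simp only [hw, hS]; fun_prop
    have hsc : IntervalIntegrable (fun u => score f f' (w u)) volume 0 1 := by
      obtain ⟨R, hR⟩ := isCompact_Icc.exists_bound_of_continuousOn hwcont
      rw [intervalIntegrable_iff_integrableOn_Icc_of_le zero_le_one]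
      refine Measure.integrableOn_of_bounded (M := max |score f f' R| |score f f' (-R)|) (by simp)
        (hf.measurable_score.comp hwm).aestronglyMeasurable ?_
      refine (ae_restrict_iff' measurableSet_Icc).2 (ae_of_all _ fun u hu => ?_)
      exact hf.abs_score_le (hR u hu)
    have h01 : Set.uIcc (0 : ℝ) 1 = Set.Icc 0 1 := Set.uIcc_of_le zero_le_one
    refine IntervalIntegrable.add (ContinuousOn.intervalIntegrable ?_)
      (hsc.mul_continuousOn ?_)
    · rw [h01]
      exact continuousOn_const.mul ((hScont'.mul hrcont).mul hgcont)
    · rw [h01]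
      exact ((continuousOn_const.add (continuousOn_const.mul hwcont)).mul continuousOn_const).mul
        ((hScont'.mul hrcont).mul hgcont)
  have hFTC := integral_eq_of_hasDerivAt_off_countable F
    (fun u => c₁ u + score f f' (w u) * c₂ u) (a := 0) (b := 1) hcount
    (by rw [Set.uIcc_of_le zero_le_one]; exact hrcont.mul hgcont)
    (by
      rw [min_eq_left zero_le_one, max_eq_right zero_le_one]
      exact fun u hu => hderiv u hu.1 fun h => hu.2 ⟨h, hu.1⟩) hint
  have hF1 : F 1 = locScale m s (fun z => √(f z)) z := by
    simp [hF, hS, hw, locScale]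
  have hF0 : F 0 = √(f z) := by simp [hF, hS, hw]
  rw [hF1, hF0] at hFTC
  have heq : (fun u => c₁ u + score f f' (w u) * c₂ u) = fun u : ℝ =>
      m * ((1 + u * (s - 1))⁻¹ * locScale (u * m) (1 + u * (s - 1)) (rootScore f f' 0) z)
      + (s - 1) * ((1 + u * (s - 1))⁻¹
        * locScale (u * m) (1 + u * (s - 1)) (rootScore f f' 1) z) := by
    funext u
    simp only [hc₁, hc₂, locScale, rootScore, scoreVec, hw, hS, Matrix.cons_val_zero,
      Matrix.cons_val_one]
    ring
  rw [heq] at hint hFTC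
  exact ⟨hint, hFTC.symm⟩

/-- Differentiability in quadratic mean of the location-scale family. -/
lemma eventually_eLpNorm_locScale_sqrt_le (hf : MemF1 f f') {ε : ℝ≥0∞} (hε : 0 < ε) :
    ∀ᶠ p : ℝ × ℝ in 𝓝 (0, 1),
      eLpNorm (fun z => locScale p.1 p.2 (fun z => √(f z)) z - √(f z)
        - (p.1 * rootScore f f' 0 z + (p.2 - 1) * rootScore f f' 1 z)) 2 volume
        ≤ ε * (‖p.1‖ₑ + ‖p.2 - 1‖ₑ) := by
  have hm := hf.measurable_rootScore
  have h0 := ENNReal.tendsto_nhds_zero.1 (tendsto_eLpNorm_inv_mul_locScale_sub (hm 0)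
    (hf.memLp_rootScore 0)) ε hε
  have h1 := ENNReal.tendsto_nhds_zero.1 (tendsto_eLpNorm_inv_mul_locScale_sub (hm 1)
    (hf.memLp_rootScore 1)) ε hε
  obtain ⟨δ, hδ, hball⟩ := Metric.eventually_nhds_iff.1 (h0.and h1)
  filter_upwards [Metric.ball_mem_nhds ((0 : ℝ), (1 : ℝ)) (lt_min hδ one_pos)] with p hp
  rw [Metric.mem_ball, Prod.dist_eq, max_lt_iff, lt_min_iff, lt_min_iff, Real.dist_eq, Real.dist_eq,
    sub_zero] at hp
  obtain ⟨⟨hp1, -⟩, hp2, hp3⟩ := hp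
  have hs : 0 < p.2 := by linarith [(abs_lt.1 hp3).1]
  -- The linearization error is the average over `u` of the derivative at `u` minus the derivative
  -- at `0`, and each such difference is small by strong continuity.
  refine eLpNorm_le_of_eq_integral (G := fun u z =>
    p.1 * ((1 + u * (p.2 - 1))⁻¹ * locScale (u * p.1) (1 + u * (p.2 - 1)) (rootScore f f' 0) z
      - rootScore f f' 0 z)
    + (p.2 - 1) * ((1 + u * (p.2 - 1))⁻¹ * locScale (u * p.1) (1 + u * (p.2 - 1))
      (rootScore f f' 1) z - rootScore f f' 1 z)) ?_ ?_ ?_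
  · have hm0 := hm 0
    have hm1 := hm 1
    simp only [Function.uncurry_def, locScale]
    fun_prop
  · filter_upwards [hf.countable_jumpSet.ae_notMem volume] with z hz
    obtain ⟨hi, he⟩ := hf.locScale_sqrt_sub (m := p.1) hs hz
    have hc := intervalIntegral.integral_sub hi (intervalIntegrable_const
      (c := p.1 * rootScore f f' 0 z + (p.2 - 1) * rootScore f f' 1 z))
    rw [intervalIntegral.integral_const, sub_zero, one_smul, ← he] at hc
    rw [← hc]
    refine intervalIntegral.integral_congr fun u _ => ?_
    ring
  · intro u hu
    have hd : dist (u * p.1, 1 + u * (p.2 - 1)) ((0 : ℝ), (1 : ℝ)) < δ := by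
      rw [Prod.dist_eq, max_lt_iff, Real.dist_eq, Real.dist_eq, sub_zero, add_sub_cancel_left,
        abs_mul, abs_mul, abs_of_pos hu.1]
      constructor
      · exact (mul_le_of_le_one_left (abs_nonneg _) hu.2).trans_lt hp1
      · exact (mul_le_of_le_one_left (abs_nonneg _) hu.2).trans_lt hp2
    obtain ⟨e0, e1⟩ := hball hd
    have hmm : ∀ i, Measurable fun z => (1 + u * (p.2 - 1))⁻¹ * locScale (u * p.1)
        (1 + u * (p.2 - 1)) (rootScore f f' i) z - rootScore f f' i z := fun i =>
      ((measurable_locScale (hm i) _ _).const_mul _).sub (hm i)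
    refine (eLpNorm_add_le ((hmm 0).const_mul p.1).aestronglyMeasurable
      ((hmm 1).const_mul (p.2 - 1)).aestronglyMeasurable (by norm_num)).trans ?_
    rw [mul_add, mul_comm ε, mul_comm ε]
    refine add_le_add ?_ ?_
    · refine (eLpNorm_const_smul_le (c := p.1)).trans (mul_le_mul_right e0 _)
    · refine (eLpNorm_const_smul_le (c := p.2 - 1)).trans (mul_le_mul_right e1 _)

end MemF1

end EdgeworthFamily

/-! ### The standardized density, its truncation point, and the mass beyond it. -/

namespace EdgeworthFamily

variable {f f' : ℝ → ℝ}

lemma density_eq_std {θ σ : ℝ} (hσ : 0 < σ) (ξ x : ℝ) :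
    density f f' θ σ ξ x = σ⁻¹ * density f f' 0 1 ξ ((x - θ) / σ) := by
  have h1 : |x - θ| ≤ σ * |zStar f f' ξ| ↔ |(x - θ) / σ| ≤ |zStar f f' ξ| := by
    rw [abs_div, abs_of_pos hσ, div_le_iff₀ hσ, mul_comm]
  have h2 : σ * |zStar f f' ξ| < x - θ ↔ |zStar f f' ξ| < (x - θ) / σ := by
    rw [lt_div_iff₀ hσ, mul_comm]
  have h3 : x - θ < -(σ * |zStar f f' ξ|) ↔ (x - θ) / σ < -|zStar f f' ξ| := by
    rw [div_lt_iff₀ hσ, neg_mul, mul_comm]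
  simp only [density, h1, h2, h3, sub_zero, div_one, one_mul, inv_one, mul_one]
  ring

namespace MemF1

lemma measurable_density (hf : MemF1 f f') (θ σ ξ : ℝ) : Measurable (density f f' θ σ ξ) := by
  have h1 := hf.measurable_deriv
  have h2 := hf.continuous.measurable
  refine Measurable.add (Measurable.sub (by fun_prop) (Measurable.mul (by fun_prop) ?_))
    (Measurable.mul (by fun_prop) (Measurable.sub ?_ ?_))
  · exact Measurable.ite (measurableSet_le (by fun_prop) (by fun_prop)) measurable_const
      measurable_const
  · exact Measurable.ite (measurableSet_lt (by fun_prop) (by fun_prop)) measurable_const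
      measurable_const
  · exact Measurable.ite (measurableSet_lt (by fun_prop) (by fun_prop)) measurable_const
      measurable_const

lemma density_of_abs_le (hf : MemF1 f f') {ξ z : ℝ} (hz : |z| ≤ |zStar f f' ξ|) :
    density f f' 0 1 ξ z = f z * (1 + ξ * scoreVec f f' z 2) := by
  obtain ⟨h1, h2⟩ := abs_le.1 hz
  simp [density, hz, not_lt.2 h1, not_lt.2 h2, hf.deriv_eq, scoreVec]
  ring

lemma density_zero (z : ℝ) : density f f' 0 1 0 z = f z := by
  simp [density]

lemma density_of_lt_abs {ξ z : ℝ} (hξ : ξ ≠ 0) (hz : |zStar f f' ξ| < |z|) :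
    density f f' 0 1 ξ z = 2 * f z ∨ density f f' 0 1 ξ z = 0 := by
  rcases lt_or_gt_of_ne hξ with h | h <;> rcases lt_abs.1 hz with h' | h'
  · have : ¬ z < -|zStar f f' ξ| := by linarith [abs_nonneg (zStar f f' ξ)]
    right; simp [density, not_le.2 hz, h', this, Real.sign_of_neg h]
  · have h2 : z < -|zStar f f' ξ| := by linarith
    have : ¬ |zStar f f' ξ| < z := by linarith [abs_nonneg (zStar f f' ξ)]
    left; simp [density, not_le.2 hz, h2, this, Real.sign_of_neg h]; ring
  · have : ¬ z < -|zStar f f' ξ| := by linarith [abs_nonneg (zStar f f' ξ)]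
    left; simp [density, not_le.2 hz, h', this, Real.sign_of_pos h]; ring
  · have h2 : z < -|zStar f f' ξ| := by linarith
    have : ¬ |zStar f f' ξ| < z := by linarith [abs_nonneg (zStar f f' ξ)]
    right; simp [density, not_le.2 hz, h2, this, Real.sign_of_pos h]

/-- At, or just beyond, the truncation point the skewness correction exceeds the density. -/
lemma exists_one_le_of_zStar (hf : MemF1 f f') {ξ : ℝ} (hξ : ξ ≠ 0) :
    ∃ y, |y| ≤ |zStar f f' ξ| + 1 ∧ 1 ≤ |ξ| * |score f f' y| * |y ^ 2 - kappa f f'| := by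
  have key : ∀ y, f y ≤ |ξ| * |f' y| * |y ^ 2 - kappa f f'| →
      1 ≤ |ξ| * |score f f' y| * |y ^ 2 - kappa f f'| := fun y hy => by
    rw [hf.deriv_eq, abs_mul, abs_neg, abs_of_pos (hf.pos y)] at hy
    refine le_of_mul_le_mul_right ?_ (hf.pos y)
    linarith
  by_cases h : ∃! z : ℝ, f z = ξ * f' z * (z ^ 2 - kappa f f')
  · refine ⟨zStar f f' ξ, by linarith, key _ (le_of_eq ?_)⟩
    have hz : f (zStar f f' ξ) = ξ * f' (zStar f f' ξ) * (zStar f f' ξ ^ 2 - kappa f f') := by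
      rw [zStar, dif_pos h]
      exact h.choose_spec.1
    rw [← abs_mul, ← abs_mul, ← hz, abs_of_pos (hf.pos _)]
  · set S := {y : ℝ | √(kappa f f') ≤ y ∧ f y ≤ |ξ| * |f' y| * (y ^ 2 - kappa f f')} with hS
    have hz : zStar f f' ξ = sInf S := by rw [zStar, dif_neg h]
    have hne : S.Nonempty := by
      obtain ⟨z₀, hz₀, hs⟩ := hf.exists_score_pos
      have hk := hf.kappa_nonneg
      -- Since `φ(y) ≥ φ(z₀) > 0` for larger `y`, it suffices that `y² - κ` be at least `a` for the
      -- correction to exceed the density at `y`.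
      set a := (|ξ| * score f f' z₀)⁻¹ with ha
      have ha0 : 0 < a := inv_pos.2 (mul_pos (abs_pos.2 hξ) hs)
      set y := z₀ + √(kappa f f') + a + 1 with hy
      have hsq := Real.sqrt_nonneg (kappa f f')
      have h1 : score f f' z₀ ≤ score f f' y := hf.monotone_score (by linarith)
      have h2 : a ≤ y ^ 2 - kappa f f' := by
        have := Real.sq_sqrt hk
        nlinarith
      refine ⟨y, by linarith, ?_⟩
      rw [hf.deriv_eq, abs_mul, abs_neg, abs_of_pos (hf.pos y), abs_of_nonneg (hs.le.trans h1)]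
      have h3 : 1 ≤ |ξ| * score f f' y * (y ^ 2 - kappa f f') := by
        calc 1 = |ξ| * score f f' z₀ * a :=
              (mul_inv_cancel₀ (mul_pos (abs_pos.2 hξ) hs).ne').symm
          _ ≤ _ := by
            have := hs.le.trans h1
            gcongr
      nlinarith [hf.pos y]
    -- The infimum need not be attained, so a point of the set within distance one of it is taken;
    -- hence the `+ 1` in the conclusion.
    obtain ⟨y, hyS, hy⟩ := exists_lt_of_csInf_lt hne (lt_add_one (sInf S))
    have hy0 : 0 ≤ y := (Real.sqrt_nonneg _).trans hyS.1
    refine ⟨y, ?_, key y (hyS.2.trans ?_)⟩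
    · rw [abs_of_nonneg hy0, hz]
      linarith [le_abs_self (sInf S)]
    · exact mul_le_mul_of_nonneg_left (le_abs_self _) (by positivity)

/-- Monotonicity and approximate oddness bound `|φ|` on `[-(B + 1), B + 1]` by its value at `B + 2`.
One unit comes from `exists_one_le_of_zStar`, the other from the strict inequality in
`neg_score_neg_le`. -/
lemma one_le_of_zStar_le (hf : MemF1 f f') {ξ B : ℝ} (hξ : ξ ≠ 0) (hB : |zStar f f' ξ| ≤ B) :
    1 ≤ |ξ| * score f f' (B + 2) * ((B + 2) ^ 2 + kappa f f') := by
  obtain ⟨y, hy, h1⟩ := hf.exists_one_le_of_zStar hξ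
  obtain ⟨hy1, hy2⟩ := abs_le.1 hy
  have hB0 := (abs_nonneg _).trans hB
  have hk := hf.kappa_nonneg
  have h2 : |score f f' y| ≤ score f f' (B + 2) := by
    refine abs_le'.2 ⟨hf.monotone_score (by linarith), ?_⟩
    have := hf.neg_score_neg_le (a := -y) (b := B + 2) (by linarith)
    rwa [neg_neg] at this
  have h3 : |y ^ 2 - kappa f f'| ≤ (B + 2) ^ 2 + kappa f f' := by
    have : y ^ 2 ≤ (B + 2) ^ 2 := sq_le_sq' (by linarith) (by linarith)
    rw [abs_le]; constructor <;> nlinarith [sq_nonneg y]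
  refine h1.trans ?_
  have := (abs_nonneg _).trans h2
  gcongr

/-- If the truncation point stayed below `B`, then `one_le_of_zStar_le` would keep `|ξ|` away from
zero. -/
lemma tendsto_zStar (hf : MemF1 f f') :
    Tendsto (fun ξ => |zStar f f' ξ|) (𝓝[≠] 0) atTop := by
  rw [tendsto_atTop]
  intro B
  have hlim : Tendsto (fun ξ : ℝ => |ξ| * score f f' (B + 2) * ((B + 2) ^ 2 + kappa f f'))
      (𝓝[≠] 0) (𝓝 0) := by
    have : Continuous fun ξ : ℝ => |ξ| * score f f' (B + 2) * ((B + 2) ^ 2 + kappa f f') := by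
      fun_prop
    have := this.tendsto 0
    simp only [abs_zero, zero_mul] at this
    exact this.mono_left nhdsWithin_le_nhds
  filter_upwards [hlim.eventually (gt_mem_nhds one_pos), self_mem_nhdsWithin] with ξ h1 h2
  by_contra hc
  exact absurd (hf.one_le_of_zStar_le h2 (not_le.1 hc).le) (not_le.2 h1)

/-- The mass beyond the truncation point is `o(ξ²)`. -/
lemma eventually_setIntegral_tail_le (hf : MemF1 f f') {ε : ℝ} (hε : 0 < ε) :
    ∀ᶠ ξ in 𝓝[≠] (0 : ℝ), ∫ z in {z | |zStar f f' ξ| < |z|}, f z ≤ ε * ξ ^ 2 := by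
  obtain ⟨β, hβ, hO, ho⟩ := hf.tails
  obtain ⟨M, hM0, hM⟩ := hO.exists_pos
  have hk := hf.kappa_nonneg
  set k := kappa f f' with hkdef
  -- The constant `c` collects all factors of the final estimate, and `η`, the constant of the
  -- little-o bound on the score, is chosen so that `c * η ^ 2 = ε`.
  set c := 2 * M * 2 ^ β * (1 + k) ^ 2 with hc
  have hc0 : 0 < c := by positivity
  set η := √(ε / c) with hη
  have hη0 : 0 < η := Real.sqrt_pos.2 (by positivity)
  have hη2 : η ^ 2 = ε / c := Real.sq_sqrt (by positivity)
  have hev := (hM.bound.and (eventually_ge_atTop 2))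
  have hev2 := (tendsto_atTop_add_const_right atTop 2 tendsto_id).eventually (ho.bound hη0)
  filter_upwards [hf.tendsto_zStar.eventually (hev.and hev2), self_mem_nhdsWithin] with ξ hξ hne
  obtain ⟨⟨h1, h2⟩, h3⟩ := hξ
  have h4 := hf.one_le_of_zStar_le hne le_rfl
  set Y := |zStar f f' ξ| with hY
  simp only [id] at h3
  set R := Y + 2 with hR
  have hY0 : 0 < Y := by linarith
  have hR0 : 0 < R := by linarith
  have hsplit : ∫ z in {z | Y < |z|}, f z = 2 * ∫ z in Set.Ioi Y, f z := by
    have hset : {z : ℝ | Y < |z|} = Set.Ioi Y ∪ Set.Iio (-Y) := by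
      ext z; simp [lt_abs, lt_neg]
    rw [hset, setIntegral_union ?_ measurableSet_Iio hf.integrable.integrableOn
      hf.integrable.integrableOn, ← integral_Iic_eq_integral_Iio, ← integral_comp_neg_Ioi]
    · simp only [hf.symm]; ring
    · rw [Set.disjoint_left]
      intro z hz hz'
      simp only [Set.mem_Ioi, Set.mem_Iio] at hz hz'
      linarith
  have hRb : 0 < R ^ (β / 2) := Real.rpow_pos_of_pos hR0 _
  -- The exponents `β / 2 - 2` of the score bound and `2` of the polynomial factor add up to `β /
  -- 2`; the square of this inequality matches the tail order `R ^ (-β)`.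
  have h5 : 1 ≤ |ξ| * η * (1 + k) * R ^ (β / 2) := by
    have e1 : score f f' R ≤ η * R ^ (β / 2 - 2) := by
      rw [Real.norm_eq_abs, Real.norm_eq_abs, abs_of_pos (Real.rpow_pos_of_pos hR0 _)] at h3
      exact (le_abs_self _).trans h3
    have e2 : R ^ 2 + k ≤ (1 + k) * R ^ 2 := by
      have : 1 ≤ R ^ 2 := one_le_pow₀ (by linarith)
      nlinarith
    have e3 : R ^ (β / 2 - 2) * R ^ 2 = R ^ (β / 2) := by
      rw [← Real.rpow_natCast R 2, ← Real.rpow_add hR0]; norm_num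
    calc 1 ≤ |ξ| * score f f' R * (R ^ 2 + k) := h4
      _ ≤ |ξ| * (η * R ^ (β / 2 - 2)) * ((1 + k) * R ^ 2) := by
        gcongr
      _ = |ξ| * η * (1 + k) * (R ^ (β / 2 - 2) * R ^ 2) := by ring
      _ = _ := by rw [e3]
  have h6 : R ^ (-β) ≤ ξ ^ 2 * η ^ 2 * (1 + k) ^ 2 := by
    have e1 : R ^ β = (R ^ (β / 2)) ^ 2 := by
      rw [← Real.rpow_natCast, ← Real.rpow_mul hR0.le]; norm_num
    rw [Real.rpow_neg hR0.le, inv_le_iff_one_le_mul₀ (Real.rpow_pos_of_pos hR0 _), e1]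
    calc (1 : ℝ) ≤ (|ξ| * η * (1 + k) * R ^ (β / 2)) ^ 2 := one_le_pow₀ h5
      _ = _ := by rw [mul_pow, mul_pow, mul_pow, sq_abs]
  have h7 : Y ^ (-β) ≤ 2 ^ β * R ^ (-β) := by
    have : R / 2 ≤ Y := by linarith
    calc Y ^ (-β) ≤ (R / 2) ^ (-β) :=
          Real.rpow_le_rpow_of_nonpos (by positivity) this (by linarith)
      _ = _ := by
        rw [Real.div_rpow hR0.le zero_le_two, Real.rpow_neg zero_le_two, div_inv_eq_mul, mul_comm]
  rw [Real.norm_eq_abs, Real.norm_eq_abs, abs_of_pos (Real.rpow_pos_of_pos hY0 _)] at h1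
  calc ∫ z in {z | Y < |z|}, f z = 2 * ∫ z in Set.Ioi Y, f z := hsplit
    _ ≤ 2 * (M * (2 ^ β * (ξ ^ 2 * η ^ 2 * (1 + k) ^ 2))) := by
      refine mul_le_mul_of_nonneg_left ((le_abs_self _).trans (h1.trans ?_)) zero_le_two
      refine mul_le_mul_of_nonneg_left (h7.trans ?_) hM0.le
      gcongr
    _ = c * η ^ 2 * ξ ^ 2 := by rw [hc]; ring
    _ = ε * ξ ^ 2 := by rw [hη2, mul_div_cancel₀ _ hc0.ne']

end MemF1

/-- With `t = √(1 + x)` the error is exactly `-(t - 1)² / 2`. For `x < -1` the real square root is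
zero and the bound persists, so no positivity of the density is needed. The minimum gives both a
quadratic bound for small `x` and a linear one for domination. -/
lemma abs_sqrt_one_add_sub_le (x : ℝ) : |√(1 + x) - 1 - x / 2| ≤ |x| * min 1 |x| := by
  rcases le_or_gt (-1) x with h | h
  · set t := √(1 + x) with ht
    have ht0 : 0 ≤ t := Real.sqrt_nonneg _
    have hx : x = (t - 1) * (t + 1) := by
      have : t ^ 2 = 1 + x := Real.sq_sqrt (by linarith)
      linarith
    have e : t - 1 - x / 2 = -((t - 1) ^ 2 / 2) := by rw [hx]; ring
    have h1 : |x| = |t - 1| * (t + 1) := by rw [hx, abs_mul, abs_of_nonneg (by linarith : 0 ≤ t + 1)]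
    have h2 : |t - 1| ≤ |x| := by rw [h1]; nlinarith [abs_nonneg (t - 1)]
    have h3 : |t - 1| ≤ t + 1 := abs_le.2 ⟨by linarith, by linarith⟩
    rw [e, abs_neg, abs_of_nonneg (by positivity), ← sq_abs]
    rcases le_total 1 |x| with h' | h'
    · rw [min_eq_left h', h1]; nlinarith [abs_nonneg (t - 1)]
    · rw [min_eq_right h']; nlinarith [abs_nonneg (t - 1)]
  · rw [Real.sqrt_eq_zero_of_nonpos (by linarith), abs_of_neg (by linarith : x < 0),
      min_eq_left (by linarith), mul_one, abs_le]
    constructor <;> linarith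

end EdgeworthFamily

/-! ### Differentiability in quadratic mean in the skewness parameter. -/

namespace EdgeworthFamily

variable {f f' : ℝ → ℝ}

/-- A bound for the relative error of the skewness expansion. -/
noncomputable def skewError (f f' : ℝ → ℝ) (ξ z : ℝ) : ℝ :=
  scoreVec f f' z 2 ^ 2 * f z * (min 1 |ξ * scoreVec f f' z 2| ^ 2
    + Set.indicator {z | |zStar f f' ξ| < |z|} 1 z)

namespace MemF1

lemma measurableSet_tail (f f' : ℝ → ℝ) (ξ : ℝ) : MeasurableSet {z | |zStar f f' ξ| < |z|} :=
  measurableSet_lt measurable_const measurable_abs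

lemma measurable_skewError (hf : MemF1 f f') (ξ : ℝ) : Measurable (skewError f f' ξ) := by
  have h1 := hf.measurable_scoreVec 2
  have h2 := hf.continuous.measurable
  refine Measurable.mul (by fun_prop) (Measurable.add ?_ ?_)
  · exact (measurable_const.min (h1.const_mul ξ).abs).pow_const 2
  · exact measurable_one.indicator (measurableSet_tail f f' ξ)

lemma skewError_nonneg (hf : MemF1 f f') (ξ z : ℝ) : 0 ≤ skewError f f' ξ z :=
  mul_nonneg (mul_nonneg (sq_nonneg _) (hf.pos z).le)
    (add_nonneg (sq_nonneg _) (Set.indicator_nonneg (fun _ _ => zero_le_one) z))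

lemma integrable_scoreVec_sq (hf : MemF1 f f') (i : Fin 3) :
    Integrable fun z => scoreVec f f' z i ^ 2 * f z := by
  simpa only [sq] using hf.integrable_base_iff.1 (hf.integrable_scoreVec_mul i i)

lemma skewError_le (hf : MemF1 f f') (ξ z : ℝ) :
    skewError f f' ξ z ≤ 2 * (scoreVec f f' z 2 ^ 2 * f z) := by
  have h0 : 0 ≤ scoreVec f f' z 2 ^ 2 * f z := mul_nonneg (sq_nonneg _) (hf.pos z).le
  have h1 : min 1 |ξ * scoreVec f f' z 2| ^ 2 ≤ 1 :=
    pow_le_one₀ (le_min zero_le_one (abs_nonneg _)) (min_le_left _ _)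
  have h2 : Set.indicator {z | |zStar f f' ξ| < |z|} (1 : ℝ → ℝ) z ≤ 1 :=
    Set.indicator_le_self' (fun _ _ => zero_le_one) z
  rw [skewError, mul_comm 2]
  exact mul_le_mul_of_nonneg_left (by linarith) h0

lemma integrable_skewError (hf : MemF1 f f') (ξ : ℝ) : Integrable (skewError f f' ξ) :=
  ((hf.integrable_scoreVec_sq 2).const_mul 2).mono' (hf.measurable_skewError ξ).aestronglyMeasurable
    (ae_of_all _ fun z => by
      rw [Real.norm_eq_abs, abs_of_nonneg (hf.skewError_nonneg ξ z)]
      exact hf.skewError_le ξ z)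

/-- Dominated convergence: at fixed `z` the minimum tends to zero with `ξ`, and the truncation point
eventually passes `|z|`. -/
lemma tendsto_integral_skewError (hf : MemF1 f f') :
    Tendsto (fun ξ => ∫ z, skewError f f' ξ z) (𝓝[≠] 0) (𝓝 0) := by
  have := tendsto_integral_filter_of_dominated_convergence (μ := volume) (l := 𝓝[≠] (0 : ℝ))
    (F := fun ξ z => skewError f f' ξ z) (f := fun _ => 0)
    (fun z => 2 * (scoreVec f f' z 2 ^ 2 * f z))
    (Eventually.of_forall fun ξ => (hf.measurable_skewError ξ).aestronglyMeasurable)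
    (Eventually.of_forall fun ξ => ae_of_all _ fun z => by
      rw [Real.norm_eq_abs, abs_of_nonneg (hf.skewError_nonneg ξ z)]
      exact hf.skewError_le ξ z)
    ((hf.integrable_scoreVec_sq 2).const_mul 2)
    (ae_of_all _ fun z => by
      have hc : Continuous fun ξ : ℝ => scoreVec f f' z 2 ^ 2 * f z *
          (min 1 |ξ * scoreVec f f' z 2| ^ 2 + 0) := by fun_prop
      have h1 := (hc.tendsto 0).mono_left (nhdsWithin_le_nhds (s := {0}ᶜ))
      simp only [zero_mul, abs_zero, add_zero, min_eq_right zero_le_one] at h1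
      rw [zero_pow two_ne_zero, mul_zero] at h1
      refine h1.congr' ?_
      filter_upwards [hf.tendsto_zStar.eventually_ge_atTop |z|] with ξ hξ
      rw [skewError, Set.indicator_of_notMem (by simpa using hξ), add_zero])
  simpa using this

/-- Up to the truncation point this is the expansion of `√(1 + x)` at `x = ξ a`. Beyond it the roots
differ by at most `√f`, with no factor `ξ`, whence the separate tail term, to be controlled by
`eventually_setIntegral_tail_le`. -/
lemma sq_sqrt_density_sub_le (hf : MemF1 f f') {ξ : ℝ} (hξ : ξ ≠ 0) (z : ℝ) :
    (√(density f f' 0 1 ξ z) - √(f z) - ξ * rootScore f f' 2 z) ^ 2 ≤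
      ξ ^ 2 * skewError f f' ξ z + 2 * Set.indicator {z | |zStar f f' ξ| < |z|} f z := by
  set a := scoreVec f f' z 2 with ha
  have hf0 := (hf.pos z).le
  have hsq : √(f z) ^ 2 = f z := Real.sq_sqrt hf0
  rcases le_or_gt |z| |zStar f f' ξ| with h | h
  · rw [Set.indicator_of_notMem (by simpa using h), skewError,
      Set.indicator_of_notMem (by simpa using h), hf.density_of_abs_le h, Real.sqrt_mul hf0, ← ha]
    have e : √(f z) * √(1 + ξ * a) - √(f z) - ξ * rootScore f f' 2 z =
        √(f z) * (√(1 + ξ * a) - 1 - ξ * a / 2) := by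
      rw [rootScore, ← ha]; ring
    have h1 := pow_le_pow_left₀ (abs_nonneg _) (abs_sqrt_one_add_sub_le (ξ * a)) 2
    rw [sq_abs, mul_pow, sq_abs] at h1
    rw [e, mul_pow, hsq]
    calc f z * (√(1 + ξ * a) - 1 - ξ * a / 2) ^ 2
        ≤ f z * ((ξ * a) ^ 2 * min 1 |ξ * a| ^ 2) := mul_le_mul_of_nonneg_left h1 hf0
      _ = _ := by ring
  · rw [Set.indicator_of_mem (by exact h), skewError, Set.indicator_of_mem (by exact h), ← ha]
    have h1 : (√(density f f' 0 1 ξ z) - √(f z)) ^ 2 ≤ f z := by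
      rcases density_of_lt_abs hξ h with h' | h' <;> rw [h']
      · rw [Real.sqrt_mul zero_le_two]
        have : (√2 - 1) ^ 2 ≤ 1 := by
          have h2 : √2 ^ 2 = 2 := Real.sq_sqrt zero_le_two
          have h3 : 1 ≤ √2 := Real.one_le_sqrt.2 one_le_two
          nlinarith
        calc (√2 * √(f z) - √(f z)) ^ 2 = (√2 - 1) ^ 2 * √(f z) ^ 2 := by ring
          _ ≤ 1 * √(f z) ^ 2 := mul_le_mul_of_nonneg_right this (sq_nonneg _)
          _ = f z := by rw [one_mul, hsq]
      · rw [Real.sqrt_zero, zero_sub, neg_sq, hsq]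
    have h2 : (ξ * rootScore f f' 2 z) ^ 2 = 1 / 4 * (ξ ^ 2 * (a ^ 2 * f z)) := by
      rw [rootScore, ← ha]; linear_combination 1 / 4 * ξ ^ 2 * a ^ 2 * hsq
    have h3 : 0 ≤ ξ ^ 2 * (a ^ 2 * f z) := by positivity
    have h4 : 0 ≤ ξ ^ 2 * (a ^ 2 * f z) * min 1 |ξ * a| ^ 2 := by positivity
    simp only [Pi.one_apply]
    nlinarith [sq_nonneg (√(density f f' 0 1 ξ z) - √(f z) + ξ * rootScore f f' 2 z)]

/-- Differentiability in quadratic mean in the skewness parameter. -/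
lemma eventually_eLpNorm_sqrt_density_le (hf : MemF1 f f') {ε : ℝ} (hε : 0 < ε) :
    ∀ᶠ ξ in 𝓝 (0 : ℝ),
      eLpNorm (fun z => √(density f f' 0 1 ξ z) - √(f z) - ξ * rootScore f f' 2 z) 2 volume
        ≤ ENNReal.ofReal ε * ‖ξ‖ₑ := by
  have h1 := hf.tendsto_integral_skewError.eventually (gt_mem_nhds (show 0 < ε ^ 2 / 2 by positivity))
  have h2 := hf.eventually_setIntegral_tail_le (show 0 < ε ^ 2 / 4 by positivity)
  filter_upwards [eventually_nhdsWithin_iff.1 (h1.and h2)] with ξ hξ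
  rcases eq_or_ne ξ 0 with h0 | h0
  · simp [h0, density_zero]
  obtain ⟨h3, h4⟩ := hξ h0
  have hi2 : Integrable (Set.indicator {z | |zStar f f' ξ| < |z|} f) :=
    hf.integrable.indicator (measurableSet_tail f f' ξ)
  have hi : Integrable fun z => ξ ^ 2 * skewError f f' ξ z
      + 2 * Set.indicator {z | |zStar f f' ξ| < |z|} f z :=
    ((hf.integrable_skewError ξ).const_mul _).add (hi2.const_mul 2)
  rw [eLpNorm_two_le_iff]
  calc ∫⁻ z, ‖√(density f f' 0 1 ξ z) - √(f z) - ξ * rootScore f f' 2 z‖ₑ ^ 2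
      ≤ ∫⁻ z, ENNReal.ofReal (ξ ^ 2 * skewError f f' ξ z
        + 2 * Set.indicator {z | |zStar f f' ξ| < |z|} f z) := by
        refine lintegral_mono fun z => ?_
        rw [Real.enorm_eq_ofReal_abs, ← ENNReal.ofReal_pow (abs_nonneg _), sq_abs]
        exact ENNReal.ofReal_le_ofReal (hf.sq_sqrt_density_sub_le h0 z)
    _ = ENNReal.ofReal (∫ z, (ξ ^ 2 * skewError f f' ξ z
        + 2 * Set.indicator {z | |zStar f f' ξ| < |z|} f z)) :=
        (ofReal_integral_eq_lintegral_ofReal hi (ae_of_all _ fun z => by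
          have := hf.skewError_nonneg ξ z
          have := Set.indicator_nonneg (s := {z | |zStar f f' ξ| < |z|})
            (fun z _ => (hf.pos z).le) z
          positivity)).symm
    _ ≤ ENNReal.ofReal ((ε * |ξ|) ^ 2) := by
        refine ENNReal.ofReal_le_ofReal ?_
        rw [integral_add ((hf.integrable_skewError ξ).const_mul _) (hi2.const_mul 2),
          integral_const_mul, integral_const_mul,
          integral_indicator (measurableSet_tail f f' ξ), mul_pow, sq_abs]
        nlinarith [sq_nonneg ξ]
    _ = _ := by
        rw [ENNReal.ofReal_pow (by positivity), ENNReal.ofReal_mul hε.le, Real.enorm_eq_ofReal_abs]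

lemma integrable_density (hf : MemF1 f f') (ξ : ℝ) : Integrable (density f f' 0 1 ξ) := by
  rcases eq_or_ne ξ 0 with h0 | h0
  · rw [h0]; exact hf.integrable.congr (ae_of_all _ fun z => (density_zero z).symm)
  have hb : Integrable fun z => 2 * f z + |ξ| * (f z + scoreVec f f' z 2 ^ 2 * f z) :=
    (hf.integrable.const_mul 2).add ((hf.integrable.add (hf.integrable_scoreVec_sq 2)).const_mul _)
  refine hb.mono' (hf.measurable_density 0 1 ξ).aestronglyMeasurable (ae_of_all _ fun z => ?_)
  have hp := hf.pos z
  set a := scoreVec f f' z 2 with ha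
  have hn : 0 ≤ |ξ| * (f z + a ^ 2 * f z) := by positivity
  rw [Real.norm_eq_abs]
  rcases le_or_gt |z| |zStar f f' ξ| with h | h
  · rw [hf.density_of_abs_le h, ← ha, abs_mul, abs_of_pos hp]
    have h1 : |a| ≤ 1 + a ^ 2 := by rw [← sq_abs]; nlinarith [sq_nonneg (|a| - 1), abs_nonneg a]
    have h2 : |1 + ξ * a| ≤ 2 + |ξ| * (1 + a ^ 2) := by
      refine (abs_add_le _ _).trans ?_
      rw [abs_one, abs_mul]
      have := mul_le_mul_of_nonneg_left h1 (abs_nonneg ξ)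
      linarith
    nlinarith
  · rcases density_of_lt_abs h0 h with h' | h' <;> rw [h']
    · rw [abs_of_pos (by positivity)]; linarith
    · rw [abs_zero]; positivity

/-- Relative to `f`, the correction is odd almost everywhere: `φ(z)(z² - κ)` is odd, the truncation
is symmetric, and the two tail terms have opposite signs. Hence it has integral zero. -/
lemma integral_density (hf : MemF1 f f') (ξ : ℝ) : ∫ z, density f f' 0 1 ξ z = 1 := by
  have hodd : ∫ z, (density f f' 0 1 ξ z / f z - 1) * f z = 0 := by
    refine hf.integral_odd ?_
    filter_upwards [hf.ae_score_neg] with z hz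
    have hp := (hf.pos z).ne'
    have h1 : (if |zStar f f' ξ| < -z then (1 : ℝ) else 0) =
        if z < -|zStar f f' ξ| then 1 else 0 := by simp only [lt_neg]
    have h2 : (if -z < -|zStar f f' ξ| then (1 : ℝ) else 0) =
        if |zStar f f' ξ| < z then 1 else 0 := by simp only [neg_lt_neg_iff]
    simp only [density, sub_zero, div_one, one_mul, inv_one, mul_one, abs_neg, h1, h2,
      hf.deriv_eq, hf.symm, hz, neg_sq]
    field_simp
    ring
  have he : ∀ z, (density f f' 0 1 ξ z / f z - 1) * f z = density f f' 0 1 ξ z - f z := fun z => by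
    have hp := (hf.pos z).ne'
    field_simp
  simp_rw [he] at hodd
  rw [integral_sub (hf.integrable_density ξ) hf.integrable, hf.integral_eq_one] at hodd
  linarith

/-- The left side is the negative part of the density formula. It can be nonzero only before
truncation, where `1 + ξ a < 0` forces `|ξ a| > 1`; the minimum in `skewError` is then one, and `-(1
+ ξ a) ≤ (ξ a)²`. -/
lemma sq_sqrt_density_sub_density_le (hf : MemF1 f f') (ξ z : ℝ) :
    |√(density f f' 0 1 ξ z) ^ 2 - density f f' 0 1 ξ z| ≤ ξ ^ 2 * skewError f f' ξ z := by
  have hE := hf.skewError_nonneg ξ z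
  rcases le_or_gt 0 (density f f' 0 1 ξ z) with hq | hq
  · rw [Real.sq_sqrt hq, sub_self, abs_zero]; positivity
  rw [Real.sqrt_eq_zero_of_nonpos hq.le, zero_pow two_ne_zero, zero_sub, abs_neg, abs_of_neg hq]
  have hp := hf.pos z
  rcases eq_or_ne ξ 0 with h0 | h0
  · rw [h0, density_zero] at hq; linarith
  rcases le_or_gt |z| |zStar f f' ξ| with h | h
  · rw [hf.density_of_abs_le h] at hq ⊢
    rw [skewError, Set.indicator_of_notMem (by simpa using h)]
    set a := scoreVec f f' z 2
    have h1 : 1 + ξ * a < 0 := by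
      by_contra hc
      have := mul_nonneg hp.le (not_lt.1 hc)
      linarith
    rw [min_eq_left (by rw [abs_of_neg (by linarith)]; linarith)]
    have h2 : -(1 + ξ * a) ≤ (ξ * a) ^ 2 := by nlinarith
    nlinarith [mul_le_mul_of_nonneg_left h2 hp.le]
  · rcases density_of_lt_abs h0 h with h' | h' <;> rw [h'] at hq <;> linarith

lemma integrable_sq_sqrt_density (hf : MemF1 f f') (ξ : ℝ) :
    Integrable fun z => √(density f f' 0 1 ξ z) ^ 2 := by
  refine (hf.integrable_density ξ).abs.mono'
    ((hf.measurable_density 0 1 ξ).sqrt.pow_const 2).aestronglyMeasurable (ae_of_all _ fun z => ?_)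
  rw [Real.norm_eq_abs, abs_of_nonneg (sq_nonneg _), Real.sq_sqrt']
  exact max_le (le_abs_self _) (abs_nonneg _)

lemma eventually_abs_integral_sub_one_le (hf : MemF1 f f') {ε : ℝ} (hε : 0 < ε) :
    ∀ᶠ ξ in 𝓝 (0 : ℝ), |(∫ z, √(density f f' 0 1 ξ z) ^ 2) - 1| ≤ ε * ξ ^ 2 := by
  have h1 := hf.tendsto_integral_skewError.eventually (gt_mem_nhds hε)
  filter_upwards [eventually_nhdsWithin_iff.1 h1] with ξ hξ
  rcases eq_or_ne ξ 0 with h0 | h0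
  · simp [h0, density_zero, Real.sq_sqrt (hf.pos _).le, hf.integral_eq_one]
  have hi := hf.integrable_sq_sqrt_density ξ
  calc |(∫ z, √(density f f' 0 1 ξ z) ^ 2) - 1|
      = |∫ z, (√(density f f' 0 1 ξ z) ^ 2 - density f f' 0 1 ξ z)| := by
        rw [integral_sub hi (hf.integrable_density ξ), hf.integral_density]
    _ ≤ ∫ z, |√(density f f' 0 1 ξ z) ^ 2 - density f f' 0 1 ξ z| := abs_integral_le_integral_abs
    _ ≤ ∫ z, ξ ^ 2 * skewError f f' ξ z :=
        integral_mono (hi.sub (hf.integrable_density ξ)).abs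
          ((hf.integrable_skewError ξ).const_mul _) (hf.sq_sqrt_density_sub_density_le ξ)
    _ ≤ ε * ξ ^ 2 := by
        rw [integral_const_mul, mul_comm]
        exact mul_le_mul_of_nonneg_right (hξ h0).le (sq_nonneg _)

end MemF1

end EdgeworthFamily

/-! ### Joint differentiability in quadratic mean and the expansion at `(0, 1, 0)`. -/

namespace EdgeworthFamily

variable {f f' : ℝ → ℝ}

/-- The square root of the density with location `v 0`, scale `1 + v 1` and skewness `v 2`. -/
noncomputable def rootDensity (f f' : ℝ → ℝ) (v : Fin 3 → ℝ) : ℝ → ℝ :=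
  locScale (v 0) (1 + v 1) fun z => √(density f f' 0 1 (v 2) z)

/-- The square root of the likelihood ratio of one observation. -/
noncomputable def rootRatio (f f' : ℝ → ℝ) (v : Fin 3 → ℝ) (z : ℝ) : ℝ :=
  rootDensity f f' v z / √(f z)

namespace MemF1

lemma measurable_rootDensity (hf : MemF1 f f') (v : Fin 3 → ℝ) : Measurable (rootDensity f f' v) :=
  measurable_locScale (hf.measurable_density _ _ _).sqrt _ _

lemma measurable_rootRatio (hf : MemF1 f f') (v : Fin 3 → ℝ) : Measurable (rootRatio f f' v) :=
  (hf.measurable_rootDensity v).div hf.continuous.measurable.sqrt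

lemma rootRatio_sq_mul (hf : MemF1 f f') (v : Fin 3 → ℝ) (z : ℝ) :
    rootRatio f f' v z ^ 2 * f z = rootDensity f f' v z ^ 2 := by
  rw [rootRatio, div_pow, Real.sq_sqrt (hf.pos z).le, div_mul_cancel₀ _ (hf.pos z).ne']

lemma memLp_rootDensity (hf : MemF1 f f') {v : Fin 3 → ℝ} (hv : 0 < 1 + v 1) :
    MemLp (rootDensity f f' v) 2 volume := by
  refine memLp_locScale (hf.measurable_density _ _ _).sqrt ?_ _ hv
  rw [memLp_two_iff_integrable_sq (hf.measurable_density _ _ _).sqrt.aestronglyMeasurable]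
  exact hf.integrable_sq_sqrt_density _

lemma memLp_rootRatio (hf : MemF1 f f') {v : Fin 3 → ℝ} (hv : 0 < 1 + v 1) :
    MemLp (rootRatio f f' v) 2 (base f) := by
  rw [memLp_two_iff_integrable_sq (hf.measurable_rootRatio v).aestronglyMeasurable,
    hf.integrable_base_iff]
  simp_rw [hf.rootRatio_sq_mul]
  exact (hf.memLp_rootDensity hv).integrable_sq

/-- Location and scale preserve the mass, so the mass defect depends on the skewness alone. -/
lemma integral_rootRatio_sq (hf : MemF1 f f') {v : Fin 3 → ℝ} (hv : 0 < 1 + v 1) :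
    ∫ z, rootRatio f f' v z ^ 2 ∂(base f) = ∫ z, √(density f f' 0 1 (v 2) z) ^ 2 := by
  rw [hf.integral_base]
  simp_rw [hf.rootRatio_sq_mul, rootDensity, locScale, mul_pow]
  rw [integral_const_mul, integral_sub_right_eq_self
    (fun z => √(density f f' 0 1 (v 2) (z / (1 + v 1))) ^ 2) (v 0),
    Measure.integral_comp_div (fun z => √(density f f' 0 1 (v 2) z) ^ 2), abs_of_pos hv,
    smul_eq_mul, inv_pow, Real.sq_sqrt hv.le, inv_mul_cancel_left₀ hv.ne']

/-- **Differentiability in quadratic mean** of the family at `(0, 1, 0)`. -/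
lemma eventually_eLpNorm_rootDensity_sub_le (hf : MemF1 f f') {ε : ℝ} (hε : 0 < ε) :
    ∀ᶠ v in 𝓝 (0 : Fin 3 → ℝ),
      eLpNorm (fun z => rootDensity f f' v z - √(f z) - ∑ i, v i * rootScore f f' i z) 2 volume
        ≤ ENNReal.ofReal ε * ∑ i, ‖v i‖ₑ := by
  have hε2 : 0 < ENNReal.ofReal (ε / 2) := ENNReal.ofReal_pos.2 (half_pos hε)
  have hv2 : Tendsto (fun v : Fin 3 → ℝ => v 2) (𝓝 0) (𝓝 0) := (continuous_apply 2).tendsto 0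
  have hvp : Tendsto (fun v : Fin 3 → ℝ => (v 0, 1 + v 1)) (𝓝 0) (𝓝 (0, 1)) := by
    have : Continuous fun v : Fin 3 → ℝ => (v 0, 1 + v 1) := by fun_prop
    simpa using this.tendsto 0
  have hR := hf.measurable_rootScore 2
  filter_upwards [hv2.eventually (hf.eventually_eLpNorm_sqrt_density_le (half_pos hε)),
    hvp.eventually (ENNReal.tendsto_nhds_zero.1 (tendsto_eLpNorm_locScale_sub hR
      (hf.memLp_rootScore 2)) _ hε2),
    hvp.eventually (hf.eventually_eLpNorm_locScale_sqrt_le (ENNReal.ofReal_pos.2 hε)),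
    hvp.eventually (eventually_locScale_near 1 one_pos)] with v h1 h2 h3 h4
  have hs : 0 < 1 + v 1 := by linarith [(abs_lt.1 h4.2).1]
  set E : ℝ → ℝ := fun z => √(density f f' 0 1 (v 2) z) - √(f z) - v 2 * rootScore f f' 2 z
  have hg : Measurable fun z => √(f z) := hf.continuous.measurable.sqrt
  have hE : Measurable E :=
    ((hf.measurable_density _ _ _).sqrt.sub hg).sub (hR.const_mul _)
  set A : ℝ → ℝ := fun z => locScale (v 0) (1 + v 1) (rootScore f f' 2) z - rootScore f f' 2 z
  have hA : Measurable A := (measurable_locScale hR _ _).sub hR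
  set B : ℝ → ℝ := fun z => locScale (v 0) (1 + v 1) (fun z => √(f z)) z - √(f z)
    - (v 0 * rootScore f f' 0 z + (1 + v 1 - 1) * rootScore f f' 1 z)
  have hB : Measurable B := ((measurable_locScale hg _ _).sub hg).sub
    (((hf.measurable_rootScore 0).const_mul _).add ((hf.measurable_rootScore 1).const_mul _))
  -- Here `E` is the skewness error, transported isometrically, `A` is the displacement of the
  -- skewness derivative by the group, which is small by strong continuity, and `B` is the
  -- location-scale error.
  have e : (fun z => rootDensity f f' v z - √(f z) - ∑ i, v i * rootScore f f' i z) =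
      locScale (v 0) (1 + v 1) E + (v 2 • A + B) := by
    funext z
    simp only [rootDensity, locScale, E, A, B, Fin.sum_univ_three, Pi.add_apply, Pi.smul_apply,
      smul_eq_mul]
    ring
  rw [e]
  have hE' := (measurable_locScale hE (v 0) (1 + v 1)).aestronglyMeasurable (μ := volume)
  have hA' := (hA.const_smul (v 2)).aestronglyMeasurable (μ := volume)
  have hB' := hB.aestronglyMeasurable (μ := volume)
  have h3' : eLpNorm B 2 volume ≤ ENNReal.ofReal ε * (‖v 0‖ₑ + ‖v 1‖ₑ) := by
    simpa only [add_sub_cancel_left] using h3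
  have hhalf : ENNReal.ofReal ε = ENNReal.ofReal (ε / 2) + ENNReal.ofReal (ε / 2) := by
    rw [← ENNReal.ofReal_add (by positivity) (by positivity), add_halves]
  calc _ ≤ eLpNorm (locScale (v 0) (1 + v 1) E) 2 volume
        + (eLpNorm (v 2 • A) 2 volume + eLpNorm B 2 volume) :=
      (eLpNorm_add_le hE' (hA'.add hB') (by norm_num)).trans
        (add_le_add le_rfl (eLpNorm_add_le hA' hB' (by norm_num)))
    _ ≤ ENNReal.ofReal (ε / 2) * ‖v 2‖ₑ + (‖v 2‖ₑ * ENNReal.ofReal (ε / 2)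
        + ENNReal.ofReal ε * (‖v 0‖ₑ + ‖v 1‖ₑ)) := by
      rw [eLpNorm_locScale hE _ hs]
      refine add_le_add h1 (add_le_add ?_ h3')
      rw [eLpNorm_const_smul]
      exact mul_le_mul_right h2 _
    _ = _ := by
      rw [Fin.sum_univ_three, mul_add (ENNReal.ofReal ε) (‖v 0‖ₑ + ‖v 1‖ₑ),
        mul_comm ‖v 2‖ₑ, ← add_assoc, ← add_mul, ← hhalf, add_comm]

/-- Multiplication by `√f` passes from `L²` of the base law to `L²` of Lebesgue measure and turns
each score into twice the corresponding `rootScore`; hence the factor `4`. -/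
lemma integral_rootRatio_sub (hf : MemF1 f f') (v : Fin 3 → ℝ) :
    ∫ z, (2 * (rootRatio f f' v z - 1) - ∑ i, v i * scoreVec f f' z i) ^ 2 ∂(base f) =
      4 * (eLpNorm (fun z => rootDensity f f' v z - √(f z)
        - ∑ i, v i * rootScore f f' i z) 2 volume ^ 2).toReal := by
  have hm : Measurable fun z => rootDensity f f' v z - √(f z) - ∑ i, v i * rootScore f f' i z :=
    ((hf.measurable_rootDensity v).sub hf.continuous.measurable.sqrt).sub
      (Finset.measurable_sum _ fun i _ => (hf.measurable_rootScore i).const_mul _)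
  rw [hf.integral_base, eLpNorm_two_sq]
  have e : ∀ z, (2 * (rootRatio f f' v z - 1) - ∑ i, v i * scoreVec f f' z i) ^ 2 * f z =
      4 * (rootDensity f f' v z - √(f z) - ∑ i, v i * rootScore f f' i z) ^ 2 := fun z => by
    have hp := Real.sqrt_pos.2 (hf.pos z)
    have hz : f z = √(f z) ^ 2 := (Real.sq_sqrt (hf.pos z).le).symm
    simp only [rootRatio, rootScore, Fin.sum_univ_three]
    generalize √(f z) = t at *
    rw [hz]
    field_simp
    ring
  simp_rw [e]
  rw [integral_const_mul, integral_eq_lintegral_of_nonneg_ae (ae_of_all _ fun z => sq_nonneg _)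
    (hm.pow_const 2).aestronglyMeasurable]
  congr 2
  refine lintegral_congr fun z => ?_
  rw [Real.enorm_eq_ofReal_abs, ← ENNReal.ofReal_pow (abs_nonneg _), sq_abs]

variable {h : ℕ → Fin 3 → ℝ} {C : ℝ}

lemma tendsto_inv_sqrt_smul (hC : ∀ n j, |h n j| ≤ C) :
    Tendsto (fun n : ℕ => (√(n : ℝ))⁻¹ • h n) atTop (𝓝 0) := by
  rw [tendsto_pi_nhds]
  intro j
  have h1 : Tendsto (fun n : ℕ => (√(n : ℝ))⁻¹) atTop (𝓝 0) :=
    tendsto_inv_atTop_zero.comp (Real.tendsto_sqrt_atTop.comp tendsto_natCast_atTop_atTop)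
  have h2 := h1.mul_const C
  rw [zero_mul] at h2
  refine squeeze_zero_norm (fun n => ?_) h2
  rw [Pi.smul_apply, smul_eq_mul, Real.norm_eq_abs, abs_mul,
    abs_of_nonneg (inv_nonneg.2 (Real.sqrt_nonneg _))]
  exact mul_le_mul_of_nonneg_left (hC n j) (inv_nonneg.2 (Real.sqrt_nonneg _))

lemma mul_sq_inv_sqrt {n : ℕ} (hn : 0 < n) : (n : ℝ) * ((√(n : ℝ))⁻¹) ^ 2 = 1 := by
  have hn' : (0 : ℝ) < n := by exact_mod_cast hn
  rw [inv_pow, Real.sq_sqrt hn'.le, mul_inv_cancel₀ hn'.ne']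

/-- The log-likelihood expansion under local alternatives to `(0, 1, 0)`. -/
theorem tendsto_measure_expansion (hf : MemF1 f f') [IsProbabilityMeasure (base f)]
    (hC : ∀ n j, |h n j| ≤ C) (hs : ∀ n : ℕ, 0 < 1 + (√(n : ℝ))⁻¹ * h n 1) {δ : ℝ} (hδ : 0 < δ) :
    Tendsto (fun n : ℕ => iidLaw (base f) {ω | ¬((∀ i < n,
        0 < rootRatio f f' ((√(n : ℝ))⁻¹ • h n) (ω i)) ∧
      |∑ i ∈ Finset.range n, 2 * Real.log (rootRatio f f' ((√(n : ℝ))⁻¹ • h n) (ω i))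
        - ((√(n : ℝ))⁻¹ * ∑ i ∈ Finset.range n, ∑ j, h n j * scoreVec f f' (ω i) j
          - 1 / 2 * ∑ j, ∑ k, h n j * h n k *
            ∫ x, scoreVec f f' x j * scoreVec f f' x k ∂(base f))| < δ)}) atTop (𝓝 0) := by
  have hlim := tendsto_inv_sqrt_smul hC
  have hC0 : 0 ≤ C := (abs_nonneg _).trans (hC 0 0)
  refine log_likelihood_expansion (g := scoreVec f f') hf.measurable_scoreVec hf.memLp_scoreVec
    hf.integral_scoreVec hC (fun n => hf.measurable_rootRatio _)
    (fun n => hf.memLp_rootRatio (by simpa using hs n)) ?_ ?_ hδ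
  · rw [Metric.tendsto_nhds]
    intro ε hε
    have hv2 : Tendsto (fun n : ℕ => ((√(n : ℝ))⁻¹ • h n) 2) atTop (𝓝 0) :=
      (tendsto_pi_nhds.1 hlim) 2
    have hε' : 0 < ε / (2 * (C ^ 2 + 1)) := by positivity
    filter_upwards [hv2.eventually (hf.eventually_abs_integral_sub_one_le hε'),
      eventually_gt_atTop 0] with n h1 hn
    rw [hf.integral_rootRatio_sq (by simpa using hs n), Real.dist_0_eq_abs, abs_mul, Nat.abs_cast]
    calc _ ≤ n * (ε / (2 * (C ^ 2 + 1)) * ((√(n : ℝ))⁻¹ • h n) 2 ^ 2) :=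
          mul_le_mul_of_nonneg_left h1 (Nat.cast_nonneg n)
      _ = ε / (2 * (C ^ 2 + 1)) * (n * ((√(n : ℝ))⁻¹) ^ 2) * h n 2 ^ 2 := by
          rw [Pi.smul_apply, smul_eq_mul]; ring
      _ = ε / (2 * (C ^ 2 + 1)) * h n 2 ^ 2 := by rw [mul_sq_inv_sqrt hn, mul_one]
      _ ≤ ε / (2 * (C ^ 2 + 1)) * (C ^ 2 + 1) := by
          gcongr
          have := pow_le_pow_left₀ (abs_nonneg _) (hC n 2) 2
          rw [sq_abs] at this
          linarith
      _ = ε / 2 := by field_simp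
      _ < ε := half_lt_self hε
  · rw [Metric.tendsto_nhds]
    intro ε hε
    -- The number `36` is `4 * 3²`: the factor `4` of `integral_rootRatio_sub` and the square of the
    -- three coordinates, each bounded by `C / √n`.
    set η := √(ε / (2 * (36 * C ^ 2 + 1))) with hη
    have hη0 : 0 < η := Real.sqrt_pos.2 (by positivity)
    have hη2 : η ^ 2 = ε / (2 * (36 * C ^ 2 + 1)) := Real.sq_sqrt (by positivity)
    filter_upwards [hlim.eventually (hf.eventually_eLpNorm_rootDensity_sub_le hη0),
      eventually_gt_atTop 0] with n h1 hn
    have hr := inv_nonneg.2 (Real.sqrt_nonneg (n : ℝ))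
    set r := (√(n : ℝ))⁻¹ with hrdef
    have e : ∀ z, r * ∑ j, h n j * scoreVec f f' z j = ∑ j, (r • h n) j * scoreVec f f' z j :=
      fun z => by
        rw [Finset.mul_sum]
        exact Finset.sum_congr rfl fun j _ => by rw [Pi.smul_apply, smul_eq_mul, mul_assoc]
    simp_rw [e]
    rw [hf.integral_rootRatio_sub, Real.dist_0_eq_abs, abs_of_nonneg (by positivity)]
    have hsum : ∑ i, ‖(r • h n) i‖ₑ ≤ ENNReal.ofReal (3 * (r * C)) := by
      calc ∑ i, ‖(r • h n) i‖ₑ ≤ ∑ _i : Fin 3, ENNReal.ofReal (r * C) := by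
            refine Finset.sum_le_sum fun i _ => ?_
            rw [Real.enorm_eq_ofReal_abs, Pi.smul_apply, smul_eq_mul, abs_mul, abs_of_nonneg hr]
            exact ENNReal.ofReal_le_ofReal (mul_le_mul_of_nonneg_left (hC n i) hr)
        _ = _ := by
            rw [Finset.sum_const, Finset.card_fin, nsmul_eq_mul,
              ENNReal.ofReal_mul (p := 3) (by norm_num), ENNReal.ofReal_ofNat, Nat.cast_ofNat]
    have h2 := h1.trans (mul_le_mul_right hsum _)
    rw [← ENNReal.ofReal_mul hη0.le] at h2
    have h3 := ENNReal.toReal_mono (by finiteness) (pow_le_pow_left' h2 2)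
    rw [← ENNReal.ofReal_pow (by positivity), ENNReal.toReal_ofReal (by positivity)] at h3
    calc _ ≤ n * (4 * (η * (3 * (r * C))) ^ 2) :=
          mul_le_mul_of_nonneg_left (mul_le_mul_of_nonneg_left h3 (by norm_num)) (Nat.cast_nonneg n)
      _ = η ^ 2 * (36 * C ^ 2) * (n * r ^ 2) := by ring
      _ = η ^ 2 * (36 * C ^ 2) := by rw [mul_sq_inv_sqrt hn, mul_one]
      _ ≤ η ^ 2 * (36 * C ^ 2 + 1) := by gcongr; linarith
      _ = ε / 2 := by rw [hη2]; field_simp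
      _ < ε := half_lt_self hε

end MemF1

end EdgeworthFamily

/-! ### Product densities, the standardized sample, and the likelihood ratio. -/

lemma pi_withDensity {ι E : Type*} [Fintype ι] [MeasurableSpace E] {μ : Measure E}
    [IsProbabilityMeasure μ] {ρ : E → ℝ≥0∞} (hρ : Measurable ρ) [SigmaFinite (μ.withDensity ρ)] :
    Measure.pi (fun _ : ι => μ.withDensity ρ) =
      (Measure.pi fun _ : ι => μ).withDensity fun x => ∏ i, ρ (x i) := by
  refine Measure.pi_eq fun s hs => ?_
  have hm : ∀ i, Measurable (Set.indicator (s i) ρ) := fun i => hρ.indicator (hs i)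
  -- It suffices to compare the measures on boxes; there the integrand is a product of functions of
  -- separate coordinates, and independence factors its integral.
  have hind : iIndepFun (fun (i : ι) (x : ι → E) => Set.indicator (s i) ρ (x i))
      (Measure.pi fun _ : ι => μ) :=
    iIndepFun_pi (X := fun i => Set.indicator (s i) ρ) fun i => (hm i).aemeasurable
  rw [withDensity_apply _ (MeasurableSet.univ_pi hs),
    ← lintegral_indicator (MeasurableSet.univ_pi hs)]
  calc ∫⁻ x, Set.indicator (Set.univ.pi s) (fun x => ∏ i, ρ (x i)) x ∂(Measure.pi fun _ : ι => μ)
      = ∫⁻ x, ∏ i, Set.indicator (s i) ρ (x i) ∂(Measure.pi fun _ : ι => μ) := by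
        refine lintegral_congr fun x => ?_
        by_cases hx : x ∈ Set.univ.pi s
        · rw [Set.indicator_of_mem hx]
          exact Finset.prod_congr rfl fun i _ => (Set.indicator_of_mem (hx i trivial) ρ).symm
        · rw [Set.indicator_of_notMem hx]
          simp only [Set.mem_univ_pi, not_forall] at hx
          obtain ⟨i, hi⟩ := hx
          exact (Finset.prod_eq_zero (Finset.mem_univ i) (Set.indicator_of_notMem hi ρ)).symm
    _ = ∏ i, ∫⁻ x, Set.indicator (s i) ρ (x i) ∂(Measure.pi fun _ : ι => μ) :=
        lintegral_prod_eq_prod_lintegral_of_indepFun Finset.univ _ hind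
          fun i => (hm i).comp (measurable_pi_apply i)
    _ = ∏ i, μ.withDensity ρ (s i) := by
        refine Finset.prod_congr rfl fun i _ => ?_
        rw [(measurePreserving_eval (fun _ : ι => μ) i).lintegral_comp (hm i),
          lintegral_indicator (hs i), withDensity_apply _ (hs i)]

namespace EdgeworthFamily

variable {f f' : ℝ → ℝ}

/-- The first `n` observations with location `θ` and scale `σ`, from a standardized sample. -/
def affineSample (n : ℕ) (θ σ : ℝ) (ω : ℕ → ℝ) : Fin n → ℝ := fun i => θ + σ * ω i

lemma measurable_affineSample (n : ℕ) (θ σ : ℝ) : Measurable (affineSample n θ σ) :=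
  by unfold affineSample; fun_prop

namespace MemF1

lemma density_null {θ σ : ℝ} (hσ : 0 < σ) (x : ℝ) :
    density f f' θ σ 0 x = σ⁻¹ * f ((x - θ) / σ) := by
  rw [density_eq_std hσ, density_zero]

lemma map_base (hf : MemF1 f f') (θ : ℝ) {σ : ℝ} (hσ : 0 < σ) :
    (base f).map (fun z => θ + σ * z) =
      volume.withDensity fun x => ENNReal.ofReal (density f f' θ σ 0 x) := by
  have hT : Measurable fun z : ℝ => θ + σ * z := by fun_prop
  have hfm := hf.continuous.measurable.ennreal_ofReal
  ext s hs
  rw [Measure.map_apply hT hs, base, withDensity_apply _ (hT hs), withDensity_apply _ hs,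
    ← lintegral_indicator (hT hs), ← lintegral_indicator hs]
  set F : ℝ → ℝ≥0∞ := Set.indicator ((fun z : ℝ => θ + σ * z) ⁻¹' s) fun z => ENNReal.ofReal (f z)
  have hF : Measurable F := hfm.indicator (hT hs)
  have e : ∀ x, Set.indicator s (fun x => ENNReal.ofReal (density f f' θ σ 0 x)) x =
      ENNReal.ofReal σ⁻¹ * F ((x - θ) / σ) := fun x => by
    have hx : θ + σ * ((x - θ) / σ) = x := by field_simp; ring
    have hmem : (x - θ) / σ ∈ (fun z : ℝ => θ + σ * z) ⁻¹' s ↔ x ∈ s := by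
      rw [Set.mem_preimage, hx]
    by_cases h : x ∈ s
    · simp only [F]
      rw [Set.indicator_of_mem h, Set.indicator_of_mem (hmem.2 h), density_null hσ,
        ENNReal.ofReal_mul (by positivity)]
    · simp only [F]
      rw [Set.indicator_of_notMem h, Set.indicator_of_notMem (fun hc => h (hmem.1 hc)), mul_zero]
  simp_rw [e]
  rw [lintegral_const_mul _ (show Measurable fun x => F ((x - θ) / σ) from
    hF.comp (by fun_prop)), lintegral_comp_affine hF θ hσ, ← mul_assoc,
    ← ENNReal.ofReal_mul (by positivity), inv_mul_cancel₀ hσ.ne', ENNReal.ofReal_one, one_mul]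

/-- All null laws, for every sample size and every `θ`, `σ`, are images of the same infinite
product. This lets moving null parameters be handled on one fixed probability space. -/
lemma law_null (hf : MemF1 f f') [IsProbabilityMeasure (base f)] (n : ℕ) (θ : ℝ) {σ : ℝ}
    (hσ : 0 < σ) : law f f' n θ σ 0 = (iidLaw (base f)).map (affineSample n θ σ) := by
  have hT : Measurable fun z : ℝ => θ + σ * z := by fun_prop
  have h1 : (iidLaw (base f)).map (fun (ω : ℕ → ℝ) (i : Fin n) => ω i) =
      Measure.pi fun _ : Fin n => base f := by
    rw [iidLaw, Measure.map_infinitePi_infinitePi_of_inj Fin.val_injective,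
      Measure.infinitePi_eq_pi]
  have := fun i : Fin n => Measure.isProbabilityMeasure_map (μ := base f) hT.aemeasurable
  have h2 := Measure.pi_map_pi (ι := Fin n) (μ := fun _ => base f) (f := fun _ z => θ + σ * z)
    fun _ => hT.aemeasurable
  rw [law]
  simp_rw [← hf.map_base θ hσ]
  rw [← h2, ← h1, Measure.map_map (by fun_prop) (by fun_prop)]
  rfl

lemma isProbabilityMeasure_law (hf : MemF1 f f') (n : ℕ) (θ : ℝ) {σ : ℝ} (hσ : 0 < σ) :
    IsProbabilityMeasure (law f f' n θ σ 0) := by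
  have := hf.isProbabilityMeasure_base
  rw [hf.law_null n θ hσ]
  exact Measure.isProbabilityMeasure_map (measurable_affineSample n θ σ).aemeasurable

/-- The density of the alternative with respect to the null. -/
lemma ofReal_density_eq (hf : MemF1 f f') {θ σ : ℝ} (hσ : 0 < σ) {v : Fin 3 → ℝ}
    (hv : 0 < 1 + v 1) (x : ℝ) :
    ENNReal.ofReal (density f f' (θ + σ * v 0) (σ * (1 + v 1)) (v 2) x) =
      ENNReal.ofReal (density f f' θ σ 0 x)
        * ENNReal.ofReal (rootRatio f f' v ((x - θ) / σ) ^ 2) := by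
  have hp := hf.pos ((x - θ) / σ)
  have hw : (x - (θ + σ * v 0)) / (σ * (1 + v 1)) = ((x - θ) / σ - v 0) / (1 + v 1) := by
    field_simp
    ring
  rw [density_eq_std (mul_pos hσ hv), density_null hσ, ← ENNReal.ofReal_mul (by positivity), hw,
    mul_assoc, mul_comm (f _), hf.rootRatio_sq_mul, rootDensity, locScale, mul_pow, inv_pow,
    Real.sq_sqrt hv.le, Real.sq_sqrt', mul_inv, mul_assoc]
  rw [ENNReal.ofReal_mul (by positivity), ENNReal.ofReal_mul (by positivity),
    ENNReal.ofReal_mul (by positivity), ENNReal.ofReal_mul (by positivity)]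
  congr 2
  rcases le_total 0 (density f f' 0 1 (v 2) (((x - θ) / σ - v 0) / (1 + v 1))) with h | h
  · rw [max_eq_left h]
  · rw [max_eq_right h, ENNReal.ofReal_of_nonpos h, ENNReal.ofReal_zero]

/-- Positivity of `f` makes the alternative absolutely continuous with respect to the null, so the
Radon-Nikodym derivative is the product of the squared root ratios. Null sets are the only
ambiguity. -/
lemma logLR_ae (hf : MemF1 f f') (n : ℕ) {θ σ : ℝ} (hσ : 0 < σ) {v : Fin 3 → ℝ}
    (hv : 0 < 1 + v 1) :
    ∀ᵐ x ∂(law f f' n θ σ 0),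
      logLR (law f f' n (θ + σ * v 0) (σ * (1 + v 1)) (v 2)) (law f f' n θ σ 0) x =
        ENNReal.log (∏ i, ENNReal.ofReal (rootRatio f f' v ((x i - θ) / σ) ^ 2)) := by
  set ν := volume.withDensity fun x => ENNReal.ofReal (density f f' θ σ 0 x) with hν
  set ρ : ℝ → ℝ≥0∞ := fun x => ENNReal.ofReal (rootRatio f f' v ((x - θ) / σ) ^ 2) with hρdef
  have hρ : Measurable ρ := by
    have := hf.measurable_rootRatio v
    simp only [hρdef]; fun_prop
  have : IsProbabilityMeasure (base f) := hf.isProbabilityMeasure_base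
  have : IsProbabilityMeasure ν := by
    rw [hν, ← hf.map_base θ hσ]
    exact Measure.isProbabilityMeasure_map (by fun_prop)
  have halt : (volume.withDensity fun x => ENNReal.ofReal
      (density f f' (θ + σ * v 0) (σ * (1 + v 1)) (v 2) x)) = ν.withDensity ρ := by
    rw [hν, ← withDensity_mul _ (hf.measurable_density _ _ _).ennreal_ofReal hρ]
    congr 1
    funext x
    exact hf.ofReal_density_eq hσ hv x
  have hsf : SigmaFinite (ν.withDensity ρ) := SigmaFinite.withDensity_ofReal _
  have hprod : Measurable fun x : Fin n → ℝ => ∏ i, ρ (x i) :=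
    Finset.measurable_prod _ fun i _ => hρ.comp (measurable_pi_apply i)
  simp only [logLR, law, halt, pi_withDensity hρ]
  filter_upwards [Measure.rnDeriv_withDensity (Measure.pi fun _ : Fin n => ν) hprod] with x hx
  rw [hx]

lemma log_prod_sq {ι : Type*} [Fintype ι] {w : ι → ℝ} (hw : ∀ i, 0 < w i) :
    ENNReal.log (∏ i, ENNReal.ofReal (w i ^ 2)) = ((∑ i, 2 * Real.log (w i) : ℝ) : EReal) := by
  rw [← ENNReal.ofReal_prod_of_nonneg fun i _ => sq_nonneg _, ENNReal.log_ofReal_of_pos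
    (Finset.prod_pos fun i _ => pow_pos (hw i) 2), Real.log_prod fun i _ => (pow_pos (hw i) 2).ne']
  congr 1
  exact Finset.sum_congr rfl fun i _ => by rw [Real.log_pow]; norm_num

/-- The law of a standardized statistic controls the error of an expansion of the log-likelihood
ratio. -/
lemma law_logLR_sub_le (hf : MemF1 f f') [IsProbabilityMeasure (base f)] (n : ℕ) {θ σ : ℝ}
    (hσ : 0 < σ) {v : Fin 3 → ℝ} (hv : 0 < 1 + v 1) {c : (Fin n → ℝ) → ℝ} (hc : Measurable c)
    {ε : ℝ≥0∞} {δ : ℝ} (hδε : ENNReal.ofReal δ ≤ ε) :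
    law f f' n θ σ 0 {x | ε ≤ (logLR (law f f' n (θ + σ * v 0) (σ * (1 + v 1)) (v 2))
      (law f f' n θ σ 0) x - (c x : EReal)).abs} ≤
    iidLaw (base f) {ω | ¬((∀ i < n, 0 < rootRatio f f' v (ω i)) ∧
      |∑ i ∈ Finset.range n, 2 * Real.log (rootRatio f f' v (ω i))
        - c (affineSample n θ σ ω)| < δ)} := by
  have hr := hf.measurable_rootRatio v
  set G : Set (Fin n → ℝ) := {x | ¬((∀ i, 0 < rootRatio f f' v ((x i - θ) / σ)) ∧
    |∑ i, 2 * Real.log (rootRatio f f' v ((x i - θ) / σ)) - c x| < δ)} with hG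
  have hGm : MeasurableSet G := by
    have hri : ∀ i, Measurable fun x : Fin n → ℝ => rootRatio f f' v ((x i - θ) / σ) := fun i => by
      fun_prop
    have hpos : MeasurableSet {x : Fin n → ℝ | ∀ i, 0 < rootRatio f f' v ((x i - θ) / σ)} := by
      have e : {x : Fin n → ℝ | ∀ i, 0 < rootRatio f f' v ((x i - θ) / σ)} =
          ⋂ i, {x | 0 < rootRatio f f' v ((x i - θ) / σ)} := by ext; simp
      rw [e]
      exact MeasurableSet.iInter fun i => measurableSet_lt measurable_const (hri i)
    refine (hpos.inter ?_).compl
    · refine measurableSet_lt ((Finset.measurable_sum _ fun i _ =>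
        (hri i).log.const_mul 2).sub hc).abs measurable_const
  calc _ ≤ law f f' n θ σ 0 G := by
        refine measure_mono_ae ?_
        filter_upwards [hf.logLR_ae n (θ := θ) hσ hv] with x hx hmem
        -- Positivity of every root ratio excludes the value `-∞`, and the extended distance becomes
        -- an ordinary absolute value.
        rintro ⟨h1, h2⟩
        have hmem' : ε ≤ (logLR (law f f' n (θ + σ * v 0) (σ * (1 + v 1)) (v 2))
          (law f f' n θ σ 0) x - (c x : EReal)).abs := hmem
        rw [hx, log_prod_sq h1, ← EReal.coe_sub, EReal.abs_def] at hmem'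
        have := hδε.trans hmem'
        rw [ENNReal.ofReal_le_ofReal_iff (abs_nonneg _)] at this
        linarith
    _ = _ := by
        rw [hf.law_null n θ hσ, Measure.map_apply (measurable_affineSample n θ σ) hGm]
        congr 1
        ext ω
        have hz : ∀ i : Fin n, (affineSample n θ σ ω i - θ) / σ = ω i := fun i => by
          simp only [affineSample]; field_simp; ring
        simp only [hG, Set.mem_preimage, Set.mem_ofPred_eq, hz]
        rw [Fin.sum_univ_eq_sum_range (fun i => 2 * Real.log (rootRatio f f' v (ω i)))]
        simp only [Fin.forall_iff]

end MemF1

end EdgeworthFamily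

/-! ### The multivariate central limit theorem. -/

section CLT

variable {E : Type*} [MeasurableSpace E] {P : Measure E} [IsProbabilityMeasure P]

lemma measurable_inv_sqrt_smul_sum {ι : Type*} [Fintype ι] {g : E → EuclideanSpace ℝ ι}
    (hgm : Measurable g) (n : ℕ) :
    Measurable fun ω : ℕ → E => (√(n : ℝ))⁻¹ • ∑ i ∈ Finset.range n, g (ω i) := by
  have h : Measurable fun ω : ℕ → E => ∑ i ∈ Finset.range n, g (ω i) :=
    Finset.measurable_sum _ fun i _ => hgm.comp (measurable_pi_apply i)
  exact (measurable_const_smul (√(n : ℝ))⁻¹).comp h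

/-- Central limit theorem for sums of i.i.d. centered random vectors. -/
theorem tendstoInDistribution_iid {ι : Type*} [Fintype ι] [DecidableEq ι]
    {g : E → EuclideanSpace ℝ ι} (hgm : Measurable g) (hg : ∀ j, MemLp (fun x => g x j) 2 P)
    (hg0 : ∀ j, ∫ x, g x j ∂P = 0) {S : Matrix ι ι ℝ} (hS : S.PosSemidef)
    (hcov : ∀ j k, ∫ x, g x j * g x k ∂P = S j k) :
    TendstoInDistribution (fun (n : ℕ) (ω : ℕ → E) =>
      (√(n : ℝ))⁻¹ • ∑ i ∈ Finset.range n, g (ω i)) atTop id (fun _ => iidLaw P)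
      (multivariateGaussian 0 S) where
  forall_aemeasurable n := (measurable_inv_sqrt_smul_sum hgm n).aemeasurable
  aemeasurable_limit := aemeasurable_id
  tendsto := by
    refine ProbabilityMeasure.tendsto_iff_tendsto_charFun.2 fun t => ?_
    -- The Cramér-Wold device: the characteristic function of the vector sum at `t` is that of the
    -- normalized sum of the projections `X` at `1`.
    set X : E → ℝ := fun x => inner ℝ (g x) t with hX
    have hXe : ∀ x, X x = ∑ j, t j * g x j := fun x => by
      simp [hX, PiLp.inner_apply]
    have hXm : Measurable X := by fun_prop
    have hX2 : MemLp X 2 P := by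
      have : X = fun x => ∑ j, t j * g x j := funext hXe
      rw [this]
      exact memLp_finsetSum _ fun j _ => (hg j).const_mul _
    have hX0 : ∫ x, X x ∂P = 0 := by
      simp_rw [hXe]
      rw [integral_finsetSum _ fun j _ => ((hg j).integrable (by norm_num)).const_mul _]
      simp [integral_const_mul, hg0]
    have hvar : Var[X; P] = t.ofLp ⬝ᵥ S *ᵥ t.ofLp := by
      have hint : ∀ j k, Integrable (fun x => g x j * g x k) P :=
        fun j k => (hg j).integrable_mul (hg k)
      rw [variance_eq_sub hX2, hX0]
      simp only [Pi.pow_apply, hXe]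
      have e : ∀ x, (∑ j, t j * g x j) ^ 2 = ∑ j, ∑ k, t j * t k * (g x j * g x k) := fun x => by
        rw [sq, Finset.sum_mul_sum]
        exact Finset.sum_congr rfl fun j _ => Finset.sum_congr rfl fun k _ => by ring
      simp_rw [e]
      rw [integral_finsetSum _ fun j _ => integrable_finsetSum _ fun k _ => (hint j k).const_mul _]
      simp only [dotProduct, Matrix.mulVec, Finset.mul_sum]
      rw [zero_pow two_ne_zero, sub_zero]
      refine Finset.sum_congr rfl fun j _ => ?_
      rw [integral_finsetSum _ fun k _ => (hint j k).const_mul _]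
      refine Finset.sum_congr rfl fun k _ => ?_
      rw [integral_const_mul, hcov]; ring
    have hid := fun i => identDistrib_iid (P := P) hXm i
    have hclt := tendstoInDistribution_inv_sqrt_mul_sum_sub (P := iidLaw P)
      (X := fun (i : ℕ) (ω : ℕ → E) => X (ω i)) HasLaw.id (memLp_iid hX2 0) (iIndepFun_iid hXm)
      (fun i => (hid i).trans (hid 0).symm)
    have h1 := ProbabilityMeasure.tendsto_iff_tendsto_charFun.1 hclt.tendsto 1
    simp only [ProbabilityMeasure.coe_mk, Measure.map_id] at h1 ⊢
    rw [charFun_gaussianReal, (hid 0).variance_eq, hvar] at h1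
    rw [charFun_multivariateGaussian hS]
    have hnn : 0 ≤ t.ofLp ⬝ᵥ S *ᵥ t.ofLp := by rw [← hvar]; exact variance_nonneg _ _
    convert h1 using 2 with n
    · have hTm : Measurable fun ω : ℕ → E => (√(n : ℝ))⁻¹ *
          (∑ i ∈ Finset.range n, X (ω i) - n * ∫ ω, X (ω 0) ∂(iidLaw P)) :=
        ((Finset.measurable_sum _ fun i _ =>
          hXm.comp (measurable_pi_apply i)).sub_const _).const_mul _
      rw [charFun_apply, charFun_apply, integral_map (measurable_inv_sqrt_smul_sum hgm n).aemeasurable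
        (by fun_prop),
        integral_map hTm.aemeasurable (by fun_prop)]
      refine integral_congr_ae (ae_of_all _ fun ω => ?_)
      simp only [integral_iid hXm, hX0, mul_zero, sub_zero]
      congr 3
      rw [real_inner_smul_left, sum_inner]
      simp [hX]
    · congr 1
      simp [Real.coe_toNNReal _ hnn]

end CLT

/-! ### Asymptotic normality and the expansion along moving null parameters. -/

namespace EdgeworthFamily

variable {f f' : ℝ → ℝ}

/-- The factors that turn the standardized scores into the scores at scale `σ`. -/
noncomputable def scoreScale (σ : ℝ) : Fin 3 → ℝ := ![σ⁻¹, σ⁻¹, 1]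

lemma infoMatrix_eq_scoreScale_mul (σ : ℝ) (i j : Fin 3) :
    infoMatrix f f' σ i j = scoreScale σ i * scoreScale σ j * infoMatrix f f' 1 i j := by
  fin_cases i <;> fin_cases j <;> simp [infoMatrix, scoreScale, sq]

lemma tendsto_scoreScale {s : ℕ → ℝ} {σ : ℝ} (hσ : 0 < σ) (hs : Tendsto s atTop (𝓝 σ))
    (j : Fin 3) : Tendsto (fun n => scoreScale (s n) j) atTop (𝓝 (scoreScale σ j)) := by
  have h := hs.inv₀ hσ.ne'
  fin_cases j
  · exact h
  · exact h
  · exact tendsto_const_nhds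

lemma centralSeq_affineSample (n : ℕ) (θ : ℝ) {σ : ℝ} (hσ : 0 < σ) (ω : ℕ → ℝ) :
    centralSeq f f' n θ σ (affineSample n θ σ ω) = WithLp.toLp 2 fun j =>
      (√(n : ℝ))⁻¹ * ∑ i ∈ Finset.range n, scoreScale σ j * scoreVec f f' (ω i) j := by
  have hz : ∀ i : Fin n, (affineSample n θ σ ω i - θ) / σ = ω i := fun i => by
    simp only [affineSample]; field_simp; ring
  ext j
  simp only [← Fin.sum_univ_eq_sum_range (fun i => scoreScale σ j * scoreVec f f' (ω i) j)]
  fin_cases j <;> simp [centralSeq, hz, scoreScale, scoreVec, mul_comm]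

lemma dotProduct_centralSeq_affineSample (t : Fin 3 → ℝ) (n : ℕ) (θ : ℝ) {σ : ℝ} (hσ : 0 < σ)
    (ω : ℕ → ℝ) :
    t ⬝ᵥ (centralSeq f f' n θ σ (affineSample n θ σ ω)).ofLp =
      (√(n : ℝ))⁻¹ * ∑ i ∈ Finset.range n, ∑ j, (scoreScale σ j * t j) * scoreVec f f' (ω i) j := by
  rw [centralSeq_affineSample n θ hσ, Finset.sum_comm, Finset.mul_sum, dotProduct]
  refine Finset.sum_congr rfl fun j _ => ?_
  simp only [Finset.mul_sum]
  exact Finset.sum_congr rfl fun i _ => by ring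

lemma dotProduct_infoMatrix (t : Fin 3 → ℝ) (σ : ℝ) :
    t ⬝ᵥ (infoMatrix f f' σ *ᵥ t) =
      ∑ j, ∑ k, (scoreScale σ j * t j) * (scoreScale σ k * t k) * infoMatrix f f' 1 j k := by
  simp only [dotProduct, Matrix.mulVec, Finset.mul_sum]
  refine Finset.sum_congr rfl fun j _ => Finset.sum_congr rfl fun k _ => ?_
  rw [infoMatrix_eq_scoreScale_mul]
  ring

lemma tendsto_dotProduct_infoMatrix_sub {s : ℕ → ℝ} {σ C : ℝ} {τ : ℕ → Fin 3 → ℝ} (hσ : 0 < σ)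
    (hs : Tendsto s atTop (𝓝 σ)) (hC : ∀ n i, |τ n i| ≤ C) :
    Tendsto (fun n => τ n ⬝ᵥ (infoMatrix f f' (s n) *ᵥ τ n) - τ n ⬝ᵥ (infoMatrix f f' σ *ᵥ τ n))
      atTop (𝓝 0) := by
  have h0 : 0 ≤ C := (abs_nonneg _).trans (hC 0 0)
  have hM : ∀ j k, Tendsto (fun n => infoMatrix f f' (s n) j k - infoMatrix f f' σ j k)
      atTop (𝓝 0) := fun j k => by
    have := (((tendsto_scoreScale hσ hs j).mul (tendsto_scoreScale hσ hs k)).mul_const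
      (infoMatrix f f' 1 j k)).sub_const (infoMatrix f f' σ j k)
    simpa only [← infoMatrix_eq_scoreScale_mul, sub_self] using this
  have e : ∀ n, τ n ⬝ᵥ (infoMatrix f f' (s n) *ᵥ τ n) - τ n ⬝ᵥ (infoMatrix f f' σ *ᵥ τ n) =
      ∑ j, ∑ k, τ n j * τ n k * (infoMatrix f f' (s n) j k - infoMatrix f f' σ j k) := fun n => by
    simp only [dotProduct, Matrix.mulVec, Finset.mul_sum, ← Finset.sum_sub_distrib]
    exact Finset.sum_congr rfl fun j _ => Finset.sum_congr rfl fun k _ => by ring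
  simp_rw [e]
  rw [show (0 : ℝ) = ∑ _j : Fin 3, ∑ _k : Fin 3, (0 : ℝ) by simp]
  refine tendsto_finsetSum _ fun j _ => tendsto_finsetSum _ fun k _ => ?_
  refine squeeze_zero_norm (a := fun n => C * C * |infoMatrix f f' (s n) j k - infoMatrix f f' σ j k|)
    (fun n => ?_) ?_
  · rw [Real.norm_eq_abs, abs_mul, abs_mul]
    gcongr
    · exact hC n j
    · exact hC n k
  · simpa using (hM j k).abs.const_mul (C * C)

namespace MemF1

lemma measurable_centralSeq (hf : MemF1 f f') (n : ℕ) (θ σ : ℝ) :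
    Measurable (centralSeq f f' n θ σ) := by
  have h := hf.measurable_score
  refine (WithLp.measurable_toLp 2 _).comp (measurable_pi_iff.2 fun j => ?_)
  fin_cases j <;> simp <;> fun_prop

/-- Asymptotic normality of the central sequence. -/
theorem tendstoInDistribution_centralSeq (hf : MemF1 f f') {θn σn : ℕ → ℝ} {σ : ℝ} (hσ : 0 < σ)
    (hn : ∀ n, 0 < σn n) (hlim : Tendsto σn atTop (𝓝 σ))
    [h : ∀ n, IsProbabilityMeasure (law f f' n (θn n) (σn n) 0)] :
    TendstoInDistribution (fun n => centralSeq f f' n (θn n) (σn n)) atTop id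
      (fun n => law f f' n (θn n) (σn n) 0) (multivariateGaussian 0 (infoMatrix f f' σ)) := by
  have := hf.isProbabilityMeasure_base
  have hm : Measurable fun z => (WithLp.toLp 2 fun j => scoreScale σ j * scoreVec f f' z j :
      EuclideanSpace ℝ (Fin 3)) :=
    (WithLp.measurable_toLp 2 _).comp
      (measurable_pi_iff.2 fun j => (hf.measurable_scoreVec j).const_mul _)
  have hclt := tendstoInDistribution_iid (P := base f) (S := infoMatrix f f' σ) hm
    (fun j => (hf.memLp_scoreVec j).const_mul _)
    (fun j => by simp only [integral_const_mul, hf.integral_scoreVec, mul_zero])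
    (hf.posDef_infoMatrix hσ).posSemidef
    (fun j k => by
      simp_rw [mul_mul_mul_comm (scoreScale σ j)]
      rw [integral_const_mul, hf.integral_scoreVec_mul, ← infoMatrix_eq_scoreScale_mul])
  -- Slutsky's argument: the central sequence at `σn` is the one at `σ` with the first two
  -- coordinates multiplied by `σ / σn`, which tends to one. The continuous map performs this
  -- rescaling.
  have hg : Continuous fun p : EuclideanSpace ℝ (Fin 3) × ℝ =>
      (WithLp.toLp 2 fun j => (![p.2, p.2, 1] : Fin 3 → ℝ) j * p.1 j :
        EuclideanSpace ℝ (Fin 3)) := by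
    refine (PiLp.continuous_toLp 2 _).comp (continuous_pi fun j => ?_)
    fin_cases j <;> simp <;> fun_prop
  have hc : Tendsto (fun n => σ * (σn n)⁻¹) atTop (𝓝 1) := by
    have := (hlim.inv₀ hσ.ne').const_mul σ
    rwa [mul_inv_cancel₀ hσ.ne'] at this
  have hY : TendstoInMeasure (iidLaw (base f)) (fun n (_ : ℕ → ℝ) => σ * (σn n)⁻¹) atTop
      fun _ => (1 : ℝ) :=
    tendstoInMeasure_of_tendsto_ae (fun _ => aestronglyMeasurable_const) (ae_of_all _ fun _ => hc)
  have hsl := hclt.continuous_comp_prodMk_of_tendstoInMeasure_const hg hY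
    fun _ => aemeasurable_const
  have hid : (fun x : EuclideanSpace ℝ (Fin 3) => (WithLp.toLp 2 fun j =>
      (![(1 : ℝ), 1, 1] : Fin 3 → ℝ) j * (id x) j : EuclideanSpace ℝ (Fin 3))) = id := by
    funext x
    ext j
    fin_cases j <;> simp
  have hX : ∀ n (ω : ℕ → ℝ), (WithLp.toLp 2 fun j => (![σ * (σn n)⁻¹, σ * (σn n)⁻¹, 1] : Fin 3 → ℝ) j
      * ((√(n : ℝ))⁻¹ • ∑ i ∈ Finset.range n, (WithLp.toLp 2 fun j => scoreScale σ j *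
        scoreVec f f' (ω i) j : EuclideanSpace ℝ (Fin 3))) j : EuclideanSpace ℝ (Fin 3)) =
      centralSeq f f' n (θn n) (σn n) (affineSample n (θn n) (σn n) ω) := fun n ω => by
    have h1 := (hn n).ne'
    rw [centralSeq_affineSample n (θn n) (hn n)]
    ext j
    simp only [PiLp.smul_apply, WithLp.ofLp_sum, Finset.sum_apply, smul_eq_mul, ← Finset.mul_sum]
    fin_cases j <;> simp [scoreScale] <;> field_simp
  simp only [hX, hid] at hsl
  refine ⟨fun n => (hf.measurable_centralSeq n _ _).aemeasurable, aemeasurable_id, ?_⟩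
  refine hsl.tendsto.congr fun n => Subtype.ext ?_
  change (iidLaw (base f)).map _ = (law f f' n (θn n) (σn n) 0).map _
  rw [hf.law_null n _ (hn n), Measure.map_map (hf.measurable_centralSeq n _ _)
    (measurable_affineSample n _ _)]
  rfl

/-- Quadratic expansion of the log-likelihood ratio, locally uniformly in the parameter. -/
theorem tendsto_law_logLR_sub (hf : MemF1 f f') {θn σn : ℕ → ℝ} {σ C : ℝ} {τ : ℕ → Fin 3 → ℝ}
    (hσ : 0 < σ) (hn : ∀ n, 0 < σn n) (hlim : Tendsto σn atTop (𝓝 σ)) (hC : ∀ n i, |τ n i| ≤ C)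
    {ε : ℝ≥0∞} (hε : 0 < ε) :
    Tendsto (fun n : ℕ => law f f' n (θn n) (σn n) 0
      {x | ε ≤ (logLR (law f f' n (θn n + (√(n : ℝ))⁻¹ * τ n 0)
          (σn n + (√(n : ℝ))⁻¹ * τ n 1) (0 + (√(n : ℝ))⁻¹ * τ n 2))
          (law f f' n (θn n) (σn n) 0) x
        - ((τ n ⬝ᵥ (centralSeq f f' n (θn n) (σn n) x).ofLp
            - 1 / 2 * (τ n ⬝ᵥ (infoMatrix f f' σ *ᵥ τ n)) : ℝ) : EReal)).abs})
      atTop (𝓝 0) := by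
  have := hf.isProbabilityMeasure_base
  obtain ⟨δ, hδ, hδε⟩ : ∃ δ : ℝ, 0 < δ ∧ ENNReal.ofReal δ ≤ ε := by
    obtain ⟨r, hr, hrε⟩ := ENNReal.lt_iff_exists_nnreal_btwn.1 hε
    refine ⟨r, by exact_mod_cast hr, ?_⟩
    rw [ENNReal.ofReal_coe_nnreal]
    exact hrε.le
  have h0 : 0 ≤ C := (abs_nonneg _).trans (hC 0 0)
  -- The local parameter in standardized units: location and scale increments are measured relative
  -- to `σn`, while skewness is unchanged.
  set h : ℕ → Fin 3 → ℝ := fun n j => scoreScale (σn n) j * τ n j with hh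
  obtain ⟨K, hK⟩ : ∃ K, ∀ᶠ n in atTop, ∀ j, |h n j| ≤ K := by
    refine ⟨(∑ j, (|scoreScale σ j| + 1)) * C, ?_⟩
    have : ∀ j, ∀ᶠ n in atTop, |scoreScale (σn n) j| < |scoreScale σ j| + 1 := fun j =>
      (tendsto_scoreScale hσ hlim j).abs.eventually (gt_mem_nhds (lt_add_one _))
    filter_upwards [eventually_all.2 this] with n hn' j
    rw [hh, abs_mul]
    refine mul_le_mul ((hn' j).le.trans ?_) (hC n j) (abs_nonneg _) (by positivity)
    exact Finset.single_le_sum (f := fun j => |scoreScale σ j| + 1) (fun j _ => by positivity)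
      (Finset.mem_univ j)
  have hpos : ∀ᶠ n : ℕ in atTop, 0 < 1 + (√(n : ℝ))⁻¹ * h n 1 := by
    have hr : Tendsto (fun n : ℕ => (√(n : ℝ))⁻¹ * K) atTop (𝓝 0) := by
      have := (tendsto_inv_atTop_zero.comp
        (Real.tendsto_sqrt_atTop.comp tendsto_natCast_atTop_atTop)).mul_const K
      simpa using this
    filter_upwards [hK, hr.eventually (gt_mem_nhds one_pos)] with n hn1 hn2
    have h1 : (√(n : ℝ))⁻¹ * |h n 1| ≤ (√(n : ℝ))⁻¹ * K := by
      gcongr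
      exact hn1 1
    have h2 : -((√(n : ℝ))⁻¹ * |h n 1|) ≤ (√(n : ℝ))⁻¹ * h n 1 := by
      rw [← mul_neg]
      gcongr
      exact neg_abs_le _
    linarith
  classical
  -- The expansion requires a bound and a positive scale for every `n`, but `h` has them only
  -- eventually. Replacing it by zero at the remaining indices does not affect the limit.
  set g : ℕ → Fin 3 → ℝ := fun n =>
    if (∀ j, |h n j| ≤ K) ∧ 0 < 1 + (√(n : ℝ))⁻¹ * h n 1 then h n else 0 with hg
  have hgC : ∀ n j, |g n j| ≤ |K| := fun n j => by
    simp only [hg]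
    split_ifs with hc
    · exact (hc.1 j).trans (le_abs_self K)
    · simp
  have hgs : ∀ n : ℕ, 0 < 1 + (√(n : ℝ))⁻¹ * g n 1 := fun n => by
    simp only [hg]
    split_ifs with hc
    · exact hc.2
    · simp
  -- Half of `δ` pays for the expansion. The other half pays for replacing the information at `σn`
  -- by that at `σ`, whose quadratic forms eventually differ by less than `δ` and enter with the
  -- factor `1 / 2`.
  have hexp := hf.tendsto_measure_expansion hgC hgs (half_pos hδ)
  have hq := (tendsto_dotProduct_infoMatrix_sub (f := f) (f' := f') hσ hlim hC).abs
  rw [abs_zero] at hq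
  refine tendsto_of_tendsto_of_tendsto_of_le_of_le' tendsto_const_nhds hexp
    (Eventually.of_forall fun _ => zero_le) ?_
  filter_upwards [hK, hpos, hq.eventually (gt_mem_nhds hδ)] with n hn1 hn2 hn3
  have hgn : g n = h n := if_pos ⟨hn1, hn2⟩
  rw [hgn]
  have hs := (hn n).ne'
  have e0 : θn n + (√(n : ℝ))⁻¹ * τ n 0 = θn n + σn n * ((√(n : ℝ))⁻¹ • h n) 0 := by
    simp [hh, scoreScale]; field_simp
  have e1 : σn n + (√(n : ℝ))⁻¹ * τ n 1 = σn n * (1 + ((√(n : ℝ))⁻¹ • h n) 1) := by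
    simp [hh, scoreScale]; field_simp
  have e2 : 0 + (√(n : ℝ))⁻¹ * τ n 2 = ((√(n : ℝ))⁻¹ • h n) 2 := by
    simp [hh, scoreScale]
  rw [e0, e1, e2]
  have hcm : Measurable fun x => τ n ⬝ᵥ (centralSeq f f' n (θn n) (σn n) x).ofLp
      - 1 / 2 * (τ n ⬝ᵥ (infoMatrix f f' σ *ᵥ τ n)) := by
    have hc := hf.measurable_centralSeq n (θn n) (σn n)
    simp only [dotProduct]
    fun_prop
  refine (hf.law_logLR_sub_le n (hn n) (v := (√(n : ℝ))⁻¹ • h n) hn2 hcm hδε).trans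
    (measure_mono fun ω hω hc => hω ⟨hc.1, ?_⟩)
  have hc2 := hc.2
  simp only [hf.integral_scoreVec_mul] at hc2
  rw [← dotProduct_centralSeq_affineSample (τ n) n (θn n) (hn n),
    ← dotProduct_infoMatrix (τ n) (σn n)] at hc2
  rw [abs_lt] at hc2 hn3 ⊢
  constructor <;> linarith [hc2.1, hc2.2, hn3.1, hn3.2]

end MemF1

end EdgeworthFamily

theorem proposition2p1 (f f' : ℝ → ℝ) (hf : EdgeworthFamily.MemF1 f f')
    (θ σ : ℝ) (hσ : 0 < σ) :
    -- the information matrix is positive definite, hence of full rank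
    (EdgeworthFamily.infoMatrix f f' σ).PosDef ∧
    ∀ (θn σn : ℕ → ℝ) (τ : ℕ → Fin 3 → ℝ),
      (∀ n, 0 < σn n) →
      ((fun n => θn n - θ) =O[atTop] fun n : ℕ => (√(n : ℝ))⁻¹) →
      ((fun n => σn n - σ) =O[atTop] fun n : ℕ => (√(n : ℝ))⁻¹) →
      (∃ C : ℝ, ∀ n i, |τ n i| ≤ C) →
      -- quadratic expansion of the log-likelihood ratio, in probability under the null sequence
      (∀ ε : ℝ≥0∞, 0 < ε →
        Tendsto (fun n : ℕ =>
          EdgeworthFamily.law f f' n (θn n) (σn n) 0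
            {x | ε ≤ (EdgeworthFamily.logLR
                (EdgeworthFamily.law f f' n (θn n + (√(n : ℝ))⁻¹ * τ n 0)
                  (σn n + (√(n : ℝ))⁻¹ * τ n 1) (0 + (√(n : ℝ))⁻¹ * τ n 2))
                (EdgeworthFamily.law f f' n (θn n) (σn n) 0) x
              - ((τ n ⬝ᵥ (EdgeworthFamily.centralSeq f f' n (θn n) (σn n) x).ofLp
                  - 1 / 2 * (τ n ⬝ᵥ (EdgeworthFamily.infoMatrix f f' σ *ᵥ τ n)) : ℝ)
                : EReal)).abs})
          atTop (𝓝 0)) ∧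
      -- asymptotic normality of the central sequence under the null sequence
      ∃ _ : ∀ n, IsProbabilityMeasure (EdgeworthFamily.law f f' n (θn n) (σn n) 0),
        TendstoInDistribution
          (fun n => EdgeworthFamily.centralSeq f f' n (θn n) (σn n)) atTop id
          (fun n => EdgeworthFamily.law f f' n (θn n) (σn n) 0)
          (multivariateGaussian 0 (EdgeworthFamily.infoMatrix f f' σ)) := by
  refine ⟨hf.posDef_infoMatrix hσ, fun θn σn τ hn _ hO ⟨C, hC⟩ => ?_⟩
  have h0 : Tendsto (fun n : ℕ => (√(n : ℝ))⁻¹) atTop (𝓝 0) :=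
    tendsto_inv_atTop_zero.comp (Real.tendsto_sqrt_atTop.comp tendsto_natCast_atTop_atTop)
  have hlim : Tendsto σn atTop (𝓝 σ) := by
    simpa using (hO.trans_tendsto h0).add_const σ
  have h := fun n => hf.isProbabilityMeasure_law n (θn n) (hn n)
  exact ⟨fun ε hε => hf.tendsto_law_logLR_sub hσ hn hlim hC hε, h,
    hf.tendstoInDistribution_centralSeq hσ hn hlim⟩
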